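/- Let $n\ge 2$. Let $N_n$ be the group of real unipotent upper triangular $n\times n$ matrices and let $N_n^+\subset N_n$ be the set of totally positive matrices, i.e. of those $M\in N_n$ for which every minor that does not vanish identically on $N_n$ is positive. Let $P$ be the permutation matrix $P_{ij}=\delta_{i+j,n+1}$. For every $M\in N_n^+$ there are unique $M',M''\in N_n^+$ and a unique diagonal matrix $D_M$ such that $$PMP=M'\,P\,D_M\,M'';$$ this defines two maps $M\mapsto M'$ and $M\mapsto M''$ of $N_n^+$ to itself. Let $\sigma_1,\sigma_2$ be the generators of the symmetric group $S_3$ with $\sigma_1^2=\sigma_2^2=\mathrm{id}$, $\sigma_1\sigma_2\sigma_1=\sigma_2\sigma_1\sigma_2$. For $M\in N_n^+$ put $$\mathrm{id}(M)=M,\quad \sigma_1(M)=M',\quad \sigma_2(M)=M'',\quad (\sigma_2\sigma_1)(M)=(M')'',\quad (\sigma_1\sigma_2)(M)=(M'')',$$ and for the longest element $s=\sigma_1\sigma_2\sigma_1=\sigma_2\sigma_1\sigma_2$ let $s(M)$ denote either one of the (in general different) matrices $((M')'')'$ and $((M'')')''$; the claim below holds for each choice. Write $[a,b]=\{i\in\mathbb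 N: a\le i\le b\}$. For $I,J\subset[1,n]$ let $\Delta_I(M)$ be the minor of $M$ with rows $I$ and the last $|I|$ columns, let $\Delta^J(M)$ be the minor with the first $|J|$ rows and columns $J$, and let $\Delta_\emptyset=\Delta^\emptyset=1$. For $1\le a<b<c\le n$ define (all minors being those of $M$) $$Y_{abc}(M)=\frac{\Delta_{[a,b-1]\cup[c+1,n]}\,\Delta_{[a+1,b]\cup[c,n]}}{\Delta_{[a,b]\cup[c+1,n]}\,\Delta_{[a+1,b-1]\cup[c,n]}},\qquad \tilde Y_{abc}(M)=\frac{\Delta_{[1,a]\cup[b+1,c-1]}\,\Delta_{[1,a-1]\cup[b,c]}}{\Delta_{[1,a]\cup[b,c-1]}\,\Delta_{[1,a-1]\cup[b+1,c]}},$$ $$Y^{abc}(M)=\frac{\Delta^{[a,b]\cup[c+1,n]}\,\Delta^{[a+1,b-1]\cup[c,n]}}{\Delta^{[a,b-1]\cup[c+1,n]}\,\Delta^{[a+1,b]\cup[c,n]}},\qquad \tilde Y^{abc}(M)=\frac{\Delta^{[1,a]\cup[b,c-1]}\,\Delta^{[1,a-1]\cup[b+1,c]}}{\Delta^{[1,a]\cup[b+1,c-1]}\,\Delta^{[1,a-1]\cup[b,c]}}.$$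 For $x>0$ let $l(x)=\frac{6}{\pi^2}L\bigl(\frac{x}{1+x}\bigr)$, where $L(x)=\mathrm{Li}_2(x)+\frac12\log x\,\log(1-x)$, $0<x<1$, is the Rogers dilogarithm and $\mathrm{Li}_2(x)=\sum_{k\ge1}x^k/k^2$. Then for every $M\in N_n^+$ and all $s_1,s_2,s_3,s_4\in S_3$, with all sums over the integers $1\le a<b<c\le n$, $$\sum l\Bigl(\bigl(Y_{abc}(s_1(M))\bigr)^{\mathrm{sgn}(s_1)}\Bigr)=\sum l\Bigl(\bigl(\tilde Y^{abc}(s_2(M))\bigr)^{\mathrm{sgn}(s_2)}\Bigr)=\sum l\Bigl(\bigl(\tilde Y_{abc}(s_3(M))\bigr)^{\mathrm{sgn}(s_3)}\Bigr)=\sum l\Bigl(\bigl(Y^{abc}(s_4(M))\bigr)^{\mathrm{sgn}(s_4)}\Bigr).$$ -/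

import Mathlib

open scoped BigOperators

namespace TPDilog

/-! ### The normalized Rogers dilogarithm -/

/-- The dilogarithm `Li₂(x) = ∑_{k ≥ 1} x^k / k^2` (used only for `0 < x < 1`, where the
series converges absolutely). -/
noncomputable def Li2 (x : ℝ) : ℝ := ∑' k : ℕ, x ^ (k + 1) / ((k : ℝ) + 1) ^ 2

/-- The Rogers dilogarithm `L(x) = Li₂(x) + (1/2) log x log (1 - x)`, for `0 < x < 1`. -/
noncomputable def rogersL (x : ℝ) : ℝ := Li2 x + 1 / 2 * Real.log x * Real.log (1 - x)

/-- `l(x) = (6 / π^2) L(x / (1 + x))`, for `x > 0`. -/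
noncomputable def ell (x : ℝ) : ℝ := 6 / Real.pi ^ 2 * rogersL (x / (1 + x))

/-! ### Totally positive unipotent upper triangular matrices -/

/-- The group `N_n` of real unipotent upper triangular matrices, as a set of matrices. -/
def unipotentUpper (n : ℕ) : Set (Matrix (Fin n) (Fin n) ℝ) :=
  {M | (∀ i, M i i = 1) ∧ ∀ i j, j < i → M i j = 0}

/-- The variety `N_n^+`: elements of `N_n` all of whose minors that do not vanish identically
on `N_n` are positive. A minor of size `k` is given by strictly increasing
enumerations `r`, `c` of its rows and of its columns. -/
def totallyPositive (n : ℕ) : Set (Matrix (Fin n) (Fin n) ℝ) :=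
  {M | M ∈ unipotentUpper n ∧
    ∀ (k : ℕ) (r c : Fin k ↪o Fin n),
      (∃ H ∈ unipotentUpper n, (H.submatrix r c).det ≠ 0) → 0 < (M.submatrix r c).det}

/-! ### The maps `M ↦ M'` and `M ↦ M''` -/

/-- The permutation matrix of the longest element of `S_n`: with labels in `[1, n]`,
`P i j = 1` if `i + j = n + 1` and `P i j = 0` otherwise (rows and columns are labelled
from `0` here). -/
def revMatrix (n : ℕ) : Matrix (Fin n) (Fin n) ℝ :=
  Matrix.of fun i j => if (i : ℕ) + 1 + ((j : ℕ) + 1) = n + 1 then 1 else 0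

/-- `A`, `B` (both in `N_n^+`) and the diagonal matrix with entries `d` factorize
`P M P = A P D B`. -/
def IsGauss {n : ℕ} (M A B : Matrix (Fin n) (Fin n) ℝ) (d : Fin n → ℝ) : Prop :=
  A ∈ totallyPositive n ∧ B ∈ totallyPositive n ∧
    revMatrix n * M * revMatrix n = A * revMatrix n * Matrix.diagonal d * B

/-- The factorization `(M', M'', D_M)` of `P M P = M' P D_M M''`. -/
noncomputable def gaussTriple {n : ℕ} (M : Matrix (Fin n) (Fin n) ℝ) :
    Matrix (Fin n) (Fin n) ℝ × Matrix (Fin n) (Fin n) ℝ × (Fin n → ℝ) :=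
  Classical.epsilon fun q => IsGauss M q.1 q.2.1 q.2.2

/-- The map `M ↦ M'`. -/
noncomputable def prime {n : ℕ} (M : Matrix (Fin n) (Fin n) ℝ) : Matrix (Fin n) (Fin n) ℝ :=
  (gaussTriple M).1

/-- The map `M ↦ M''`. -/
noncomputable def dprime {n : ℕ} (M : Matrix (Fin n) (Fin n) ℝ) : Matrix (Fin n) (Fin n) ℝ :=
  (gaussTriple M).2.1

/-! ### The images of a matrix under the elements of `S_3` -/

/-- The generator `σ₁` of `S_3`. -/
def sigma1 : Equiv.Perm (Fin 3) := Equiv.swap 0 1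

/-- The generator `σ₂` of `S_3`. -/
def sigma2 : Equiv.Perm (Fin 3) := Equiv.swap 1 2

/-- `IsImage s M N`: the matrix `N` is (a value of) `s(M)`, where `σ₁(M) = M'`,
`σ₂(M) = M''` and a product acts by composition. For the longest element
`σ₁ σ₂ σ₁ = σ₂ σ₁ σ₂` both reduced words are admitted; the two matrices that they give
may differ. -/
inductive IsImage {n : ℕ} :
    Equiv.Perm (Fin 3) → Matrix (Fin n) (Fin n) ℝ → Matrix (Fin n) (Fin n) ℝ → Prop
  | id (M : Matrix (Fin n) (Fin n) ℝ) : IsImage 1 M M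
  | s1 (M : Matrix (Fin n) (Fin n) ℝ) : IsImage sigma1 M (prime M)
  | s2 (M : Matrix (Fin n) (Fin n) ℝ) : IsImage sigma2 M (dprime M)
  | s21 (M : Matrix (Fin n) (Fin n) ℝ) : IsImage (sigma2 * sigma1) M (dprime (prime M))
  | s12 (M : Matrix (Fin n) (Fin n) ℝ) : IsImage (sigma1 * sigma2) M (prime (dprime M))
  | s121 (M : Matrix (Fin n) (Fin n) ℝ) :
      IsImage (sigma1 * sigma2 * sigma1) M (prime (dprime (prime M)))
  | s212 (M : Matrix (Fin n) (Fin n) ℝ) :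
      IsImage (sigma2 * sigma1 * sigma2) M (dprime (prime (dprime M)))

/-- Every element of `S_3` has an image. -/
theorem exists_isImage {n : ℕ} (s : Equiv.Perm (Fin 3)) (M : Matrix (Fin n) (Fin n) ℝ) :
    ∃ N, IsImage s M N := by
  have h : s = 1 ∨ s = sigma1 ∨ s = sigma2 ∨ s = sigma2 * sigma1 ∨ s = sigma1 * sigma2 ∨
      s = sigma1 * sigma2 * sigma1 := by
    revert s
    decide
  rcases h with rfl | rfl | rfl | rfl | rfl | rfl
  · exact ⟨_, IsImage.id M⟩
  · exact ⟨_, IsImage.s1 M⟩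
  · exact ⟨_, IsImage.s2 M⟩
  · exact ⟨_, IsImage.s21 M⟩
  · exact ⟨_, IsImage.s12 M⟩
  · exact ⟨_, IsImage.s121 M⟩

/-! ### Flag minors and the four families of functions -/

/-- The indices in `Fin n` whose labels, counted from `1`, lie in `S`. -/
def labels (n : ℕ) (S : Finset ℕ) : Finset (Fin n) :=
  Finset.univ.filter fun i => (i : ℕ) + 1 ∈ S

theorem card_labels_le (n : ℕ) (S : Finset ℕ) : (labels n S).card ≤ n := by
  simpa using (labels n S).card_le_univ

/-- The first `|S ∩ [1, n]|` indices, in increasing order. -/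
def firstIdx (n : ℕ) (S : Finset ℕ) (k : Fin (labels n S).card) : Fin n :=
  ⟨k, lt_of_lt_of_le k.isLt (card_labels_le n S)⟩

/-- The last `|S ∩ [1, n]|` indices, in increasing order. -/
def lastIdx (n : ℕ) (S : Finset ℕ) (k : Fin (labels n S).card) : Fin n :=
  ⟨n - (labels n S).card + k, by have := card_labels_le n S; have := k.isLt; omega⟩

/-- The right flag minor `Δ_I(M)`: rows labelled by `I ⊆ [1, n]`, last `|I|` columns. -/
def rightMinor {n : ℕ} (M : Matrix (Fin n) (Fin n) ℝ) (I : Finset ℕ) : ℝ :=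
  (M.submatrix ((labels n I).orderEmbOfFin rfl) (lastIdx n I)).det

/-- The upper flag minor `Δ^J(M)`: first `|J|` rows, columns labelled by `J ⊆ [1, n]`. -/
def upperMinor {n : ℕ} (M : Matrix (Fin n) (Fin n) ℝ) (J : Finset ℕ) : ℝ :=
  (M.submatrix (firstIdx n J) ((labels n J).orderEmbOfFin rfl)).det

open Finset in
/-- `Y_{abc}(M)`. -/
noncomputable def Ylow {n : ℕ} (M : Matrix (Fin n) (Fin n) ℝ) (a b c : ℕ) : ℝ :=
  (rightMinor M (Icc a (b - 1) ∪ Icc (c + 1) n) * rightMinor M (Icc (a + 1) b ∪ Icc c n)) /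
    (rightMinor M (Icc a b ∪ Icc (c + 1) n) * rightMinor M (Icc (a + 1) (b - 1) ∪ Icc c n))

open Finset in
/-- `Ỹ_{abc}(M)`. -/
noncomputable def Ytlow {n : ℕ} (M : Matrix (Fin n) (Fin n) ℝ) (a b c : ℕ) : ℝ :=
  (rightMinor M (Icc 1 a ∪ Icc (b + 1) (c - 1)) * rightMinor M (Icc 1 (a - 1) ∪ Icc b c)) /
    (rightMinor M (Icc 1 a ∪ Icc b (c - 1)) * rightMinor M (Icc 1 (a - 1) ∪ Icc (b + 1) c))

open Finset in
/-- `Y^{abc}(M)`. -/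
noncomputable def Yup {n : ℕ} (M : Matrix (Fin n) (Fin n) ℝ) (a b c : ℕ) : ℝ :=
  (upperMinor M (Icc a b ∪ Icc (c + 1) n) * upperMinor M (Icc (a + 1) (b - 1) ∪ Icc c n)) /
    (upperMinor M (Icc a (b - 1) ∪ Icc (c + 1) n) * upperMinor M (Icc (a + 1) b ∪ Icc c n))

open Finset in
/-- `Ỹ^{abc}(M)`. -/
noncomputable def Ytup {n : ℕ} (M : Matrix (Fin n) (Fin n) ℝ) (a b c : ℕ) : ℝ :=
  (upperMinor M (Icc 1 a ∪ Icc b (c - 1)) * upperMinor M (Icc 1 (a - 1) ∪ Icc (b + 1) c)) /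
    (upperMinor M (Icc 1 a ∪ Icc (b + 1) (c - 1)) * upperMinor M (Icc 1 (a - 1) ∪ Icc b c))

/-- The discrete tetrahedron `T_n`: triples with `1 ≤ a < b < c ≤ n`. -/
def tetra (n : ℕ) : Finset (ℕ × ℕ × ℕ) :=
  (Finset.Icc 1 n ×ˢ Finset.Icc 1 n ×ˢ Finset.Icc 1 n).filter
    fun t => t.1 < t.2.1 ∧ t.2.1 < t.2.2

/-- `∑_{(a,b,c) ∈ T_n} l(Z(a,b,c)^{sgn s})`. -/
noncomputable def dilogSum (n : ℕ) (s : Equiv.Perm (Fin 3)) (Z : ℕ → ℕ → ℕ → ℝ) : ℝ :=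
  ∑ t ∈ tetra n, ell (Z t.1 t.2.1 t.2.2 ^ ((Equiv.Perm.sign s : ℤˣ) : ℤ))

end TPDilog

/-! All four sums at all images of `M` reduce to one number, `lowSum M`, the sum of `ell` over the
`Y_{abc}(M)`. Three facts carry the reduction.

(1) On `N_n^+` the sums over `Y_{abc}` and over `Ỹ_{abc}` agree (`lowSum_eq_tlowSum`). Each argument
is a quotient `f / g` of the two summands of a three-term Plücker relation `f + g = h`, where `f`,
`g`, `h` are products of two flag minors. With log jets written additively, the derivative of `ell
(f / g)` along a path is, up to a constant, `f ∧ g + g ∧ h + h ∧ f`, hence bilinear in the jets of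
flag minors. For the `Y_{abc}` the minors sit at the vertices of octahedra filling a tetrahedron;
wedges of translated edges cancel, and only two faces survive (`sum_octForm`). The `Ỹ_{abc}` are
treated in the same way after a reflection of the labels. The two boundary contributions agree
(`sum_flagForm_low_eq_tlow`), so the difference of the sums is constant along a path in `N_n^+` from
`M` to a matrix of binomial coefficients. There the flag minors are Vandermonde determinants up to
factors depending only on their size, and the two sums agree term by term.

(2) The transpose along the antidiagonal exchanges right and upper flag minors, so the two upper
families at `M` are the two lower ones at `antiT M`. It also permutes the summands of `lowSum`
(`lowSum_antiT`).

(3) The flag minors of `M'` are those of `M` at the reflected rows, divided by a minor depending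
only on the size (`GaussEq.flagMinor_mul`). Hence the `Y_{abc}(M')` are the inverses of the
`Ỹ_{abc}(M)` in another order. Since `ell x + ell x⁻¹` is constant, (1) gives `lowSum M' = C -
lowSum M`; by (2) the same holds for `M''`, because `antiT` exchanges the two factors. The exponent
`sgn s` undoes these reflections.

The maps stay inside `N_n^+` because positivity of the right flag minors alone already forces total
positivity (`mem_totallyPositive_of_flagMinor_pos`), again by Plücker relations. -/

namespace TPDilog

open Finset Matrix

/-! ### Minors with sorted rows and the three-term Plücker relation -/

/-- The product of the differences `f j - f i` over `i < j`. -/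
noncomputable def diffProd {m : ℕ} (f : Fin m → ℕ) : ℝ :=
  ∏ i, ∏ j, if i < j then (f j : ℝ) - f i else 1

lemma diffProd_eq_det {m : ℕ} (f : Fin m → ℕ) :
    diffProd f = (vandermonde fun i => (f i : ℝ)).det := by
  rw [det_vandermonde, diffProd]
  refine prod_congr rfl fun i _ => ?_
  rw [← Finset.prod_filter]
  congr 1
  ext
  simp

lemma diffProd_comp_perm {m : ℕ} (f : Fin m → ℕ) (σ : Equiv.Perm (Fin m)) :
    diffProd (f ∘ σ) = ((Equiv.Perm.sign σ : ℤ) : ℝ) * diffProd f := by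
  rw [diffProd_eq_det, diffProd_eq_det, ← det_permute]
  rfl

lemma diffProd_snoc {m : ℕ} (s : Fin m → ℕ) (x : ℕ) :
    diffProd (Fin.snoc s x : Fin (m + 1) → ℕ) = diffProd s * ∏ i, ((x : ℝ) - s i) := by
  have h (i : Fin m) : ¬ Fin.last m < i.castSucc := not_lt.2 (Fin.le_last _)
  simp [diffProd, Fin.prod_univ_castSucc, prod_mul_distrib, Fin.castSucc_lt_last, h]

lemma diffProd_pos {m : ℕ} {f : Fin m → ℕ} (hf : StrictMono f) : 0 < diffProd f := by
  refine prod_pos fun i _ => prod_pos fun j _ => ?_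
  split_ifs with h
  · exact sub_pos.2 (Nat.cast_lt.2 (hf h))
  · exact one_pos

/-- The determinant of the rows of `B` labelled by `I`, in increasing order. -/
noncomputable def sortedMinor {m : ℕ} (B : ℕ → Fin m → ℝ) (I : Finset ℕ) : ℝ :=
  if h : #I = m then det (of fun i j => B (I.orderEmbOfFin h i) j) else 0

lemma card_image_fin {m : ℕ} {f : Fin m → ℕ} (hf : Function.Injective f) :
    #(univ.image f) = m := by
  rw [card_image_of_injective _ hf, card_univ, Fintype.card_fin]

lemma sortedMinor_image {m : ℕ} (B : ℕ → Fin m → ℝ) {f : Fin m → ℕ} (hf : StrictMono f) :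
    sortedMinor B (univ.image f) = det (of fun i j => B (f i) j) := by
  have hc := card_image_fin hf.injective
  rw [sortedMinor, dif_pos hc,
    ← orderEmbOfFin_unique hc (fun i => mem_image_of_mem f (mem_univ i)) hf]

/-- Sorting the rows changes the determinant and the difference product by the same sign. The sign
of the sorting permutation is therefore carried by `diffProd f` and never has to be computed. -/
lemma sortedMinor_mul_abs {m : ℕ} (B : ℕ → Fin m → ℝ) {f : Fin m → ℕ}
    (hf : Function.Injective f) :
    sortedMinor B (univ.image f) * |diffProd f| = det (of fun i j => B (f i) j) * diffProd f := by
  have hc := card_image_fin hf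
  set I := univ.image f with hI
  set e := I.orderEmbOfFin hc with he
  have hmem (i : Fin m) : f i ∈ I := mem_image_of_mem f (mem_univ i)
  have hex (i : Fin m) : ∃ k, e k = f i := by
    have : f i ∈ Set.range e := by rw [he, range_orderEmbOfFin]; exact hmem i
    exact this
  choose τ hτ using hex
  have hinj : Function.Injective τ := fun i j h => hf (by rw [← hτ i, ← hτ j, h])
  let σ : Equiv.Perm (Fin m) := Equiv.ofBijective τ (Finite.injective_iff_bijective.1 hinj)
  have hfe : f = e ∘ σ := funext fun i => (hτ i).symm
  have hd : det (of fun i j => B (f i) j)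
      = ((Equiv.Perm.sign σ : ℤ) : ℝ) * det (of fun i j => B (e i) j) := by
    rw [← det_permute, hfe]
    rfl
  have hpos : 0 < diffProd e := diffProd_pos e.strictMono
  have hs : ((Equiv.Perm.sign σ : ℤ) : ℝ) * ((Equiv.Perm.sign σ : ℤ) : ℝ) = 1 := by
    rcases Int.units_eq_one_or (Equiv.Perm.sign σ) with h | h <;> simp [h]
  have hv : diffProd f = ((Equiv.Perm.sign σ : ℤ) : ℝ) * diffProd e := by
    rw [hfe, diffProd_comp_perm]
  have habs : |((Equiv.Perm.sign σ : ℤ) : ℝ)| = 1 := by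
    rcases Int.units_eq_one_or (Equiv.Perm.sign σ) with h | h <;> simp [h]
  rw [sortedMinor, dif_pos hc, hd, hv, abs_mul, habs, abs_of_pos hpos]
  linear_combination (-(det (of fun i j => B (e i) j) * diffProd e)) * hs

/-- Cramer's rule expands `a` along the rows of `B`, with the determinants of the updated matrices
as coefficients; `φ` is applied to this expansion. -/
lemma det_mul_linear {m : ℕ} (B : Matrix (Fin m) (Fin m) ℝ) (a : Fin m → ℝ)
    (φ : (Fin m → ℝ) →ₗ[ℝ] ℝ) :
    B.det * φ a = ∑ i, (B.updateRow i a).det * φ (B i) := by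
  have h := mulVec_cramer Bᵀ a
  rw [det_transpose] at h
  have h2 := congrArg φ h
  rw [map_smul, smul_eq_mul] at h2
  rw [← h2]
  have : Bᵀ *ᵥ Bᵀ.cramer a = ∑ i, (B.updateRow i a).det • B i := by
    ext j
    simp [mulVec, dotProduct, cramer_transpose_apply, mul_comm]
  rw [this, map_sum]
  simp

lemma updateRow_snoc_last {m p : ℕ} (X : Fin m → Fin p → ℝ) (v w : Fin p → ℝ) :
    (of (Fin.snoc X v : Fin (m + 1) → Fin p → ℝ)).updateRow (Fin.last m) w
      = of (Fin.snoc X w : Fin (m + 1) → Fin p → ℝ) := by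
  ext i j
  refine Fin.lastCases ?_ (fun i => ?_) i
  · simp
  · simp

lemma updateRow_snoc_castSucc {m p : ℕ} (X : Fin m → Fin p → ℝ) (v w : Fin p → ℝ) (k : Fin m) :
    (of (Fin.snoc X v : Fin (m + 1) → Fin p → ℝ)).updateRow k.castSucc w
      = of (Fin.snoc (Function.update X k w) v : Fin (m + 1) → Fin p → ℝ) := by
  ext i j
  refine Fin.lastCases ?_ (fun i => ?_) i
  · rw [updateRow_ne (Fin.castSucc_lt_last k).ne', of_apply, of_apply,
      Fin.snoc_last, Fin.snoc_last]
  · rcases eq_or_ne i k with rfl | h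
    · simp
    · have : i.castSucc ≠ k.castSucc := fun h' => h (Fin.castSucc_injective _ h')
      simp [h]

/-- The three-term Plücker relation for unsorted rows. -/
lemma plucker_snoc {k : ℕ} (X : Fin k → Fin (k + 2) → ℝ) (a b c : Fin (k + 2) → ℝ)
    (e : Fin (k + 2)) :
    let D1 : (Fin (k + 2) → ℝ) → ℝ := fun v =>
      det (of fun (i : Fin (k + 1)) j => (Fin.snoc X v : Fin (k + 1) → Fin (k + 2) → ℝ) i
        (e.succAbove j))
    let D2 : (Fin (k + 2) → ℝ) → (Fin (k + 2) → ℝ) → ℝ := fun v w =>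
      det (of (Fin.snoc (Fin.snoc X v : Fin (k + 1) → Fin (k + 2) → ℝ) w :
        Fin (k + 2) → Fin (k + 2) → ℝ))
    D1 a * D2 b c + D1 c * D2 a b = D1 b * D2 a c := by
  intro D1 D2
  have hswap (v w : Fin (k + 2) → ℝ) : D2 v w = - D2 w v := by
    have h := det_permute (Equiv.swap (Fin.last k).castSucc (Fin.last (k + 1)))
      (of (Fin.snoc (Fin.snoc X v : Fin (k + 1) → Fin (k + 2) → ℝ) w :
        Fin (k + 2) → Fin (k + 2) → ℝ))
    rw [Equiv.Perm.sign_swap (Fin.castSucc_lt_last _).ne] at h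
    have h2 : D2 w v = -1 * D2 v w := by
      simp only [D2]
      push_cast at h
      rw [← h]
      congr 1
      ext i j
      simp only [submatrix_apply, of_apply, id]
      refine Fin.lastCases ?_ (fun i => ?_) i
      · rw [Equiv.swap_apply_right]
        simp
      · refine Fin.lastCases ?_ (fun i => ?_) i
        · rw [Equiv.swap_apply_left]
          simp
        · rw [Equiv.swap_apply_of_ne_of_ne]
          · simp
          · exact fun h => (Fin.castSucc_lt_last i).ne (Fin.castSucc_injective _ h)
          · exact (Fin.castSucc_lt_last _).ne
    linarith
  -- `D1` is linear in its last row, so it can serve as the functional in Cramer's rule for the rows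
  -- `X`, `b`, `c`.
  let φ : (Fin (k + 2) → ℝ) →ₗ[ℝ] ℝ :=
    { toFun := D1
      map_add' := fun v w => by
        have := det_updateRow_add (of fun (i : Fin (k + 1)) j =>
          (Fin.snoc X v : Fin (k + 1) → Fin (k + 2) → ℝ) i (e.succAbove j)) (Fin.last k)
          (fun j => v (e.succAbove j)) (fun j => w (e.succAbove j))
        have hu (u : Fin (k + 2) → ℝ) : D1 u = ((of fun (i : Fin (k + 1)) j =>
          (Fin.snoc X v : Fin (k + 1) → Fin (k + 2) → ℝ) i (e.succAbove j)).updateRow (Fin.last k)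
          (fun j => u (e.succAbove j))).det := by
          simp only [D1]
          congr 1
          ext i j
          refine Fin.lastCases ?_ (fun i => ?_) i
          · simp
          · simp
        rw [hu (v + w), hu v, hu w, ← this]
        rfl
      map_smul' := fun r w => by
        have := det_updateRow_smul (of fun (i : Fin (k + 1)) j =>
          (Fin.snoc X w : Fin (k + 1) → Fin (k + 2) → ℝ) i (e.succAbove j)) (Fin.last k)
          r (fun j => w (e.succAbove j))
        have hu (u : Fin (k + 2) → ℝ) : D1 u = ((of fun (i : Fin (k + 1)) j =>
          (Fin.snoc X w : Fin (k + 1) → Fin (k + 2) → ℝ) i (e.succAbove j)).updateRow (Fin.last k)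
          (fun j => u (e.succAbove j))).det := by
          simp only [D1]
          congr 1
          ext i j
          refine Fin.lastCases ?_ (fun i => ?_) i
          · simp
          · simp
        rw [hu (r • w), hu w]
        simp only [RingHom.id_apply, smul_eq_mul]
        rw [← this]
        rfl }
  have hφ (v) : φ v = D1 v := rfl
  have h := det_mul_linear (of (Fin.snoc (Fin.snoc X b : Fin (k + 1) → Fin (k + 2) → ℝ) c :
        Fin (k + 2) → Fin (k + 2) → ℝ)) a φ
  rw [Fin.sum_univ_castSucc, Fin.sum_univ_castSucc, updateRow_snoc_last,
    updateRow_snoc_castSucc] at h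
  -- The terms of the expansion that come from rows of `X` vanish, since `D1` then has a repeated
  -- row; only the terms of `b` and `c` remain.
  have hz : ∀ i : Fin k, D1 (X i) = 0 := fun i => by
    refine det_zero_of_row_eq (Fin.castSucc_lt_last i).ne ?_
    ext j
    simp
  have hupd : Function.update (Fin.snoc X b : Fin (k + 1) → Fin (k + 2) → ℝ) (Fin.last k) a
      = Fin.snoc X a := by
    ext i j
    refine Fin.lastCases ?_ (fun i => ?_) i
    · simp
    · simp [(Fin.castSucc_lt_last i).ne]
  rw [hupd] at h
  have hb : of (Fin.snoc (Fin.snoc X b : Fin (k + 1) → Fin (k + 2) → ℝ) c :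
      Fin (k + 2) → Fin (k + 2) → ℝ) (Fin.last k).castSucc = b := by
    ext j; simp
  have hc : of (Fin.snoc (Fin.snoc X b : Fin (k + 1) → Fin (k + 2) → ℝ) c :
      Fin (k + 2) → Fin (k + 2) → ℝ) (Fin.last (k + 1)) = c := by
    ext j; simp
  have hX (i : Fin k) : of (Fin.snoc (Fin.snoc X b : Fin (k + 1) → Fin (k + 2) → ℝ) c :
      Fin (k + 2) → Fin (k + 2) → ℝ) i.castSucc.castSucc = X i := by
    ext j; simp
  simp only [hφ, hb, hc, hX, hz, mul_zero, sum_const_zero, zero_add] at h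
  have e1 := hswap b a
  change D2 b c * D1 a = D2 a c * D1 b + D2 b a * D1 c at h
  rw [e1] at h
  linarith

lemma image_snoc {k : ℕ} (s : Fin k → ℕ) (a : ℕ) :
    univ.image (Fin.snoc s a : Fin (k + 1) → ℕ) = insert a (univ.image s) := by
  ext x
  simp only [mem_image, mem_univ, true_and, mem_insert]
  constructor
  · rintro ⟨i, rfl⟩
    refine Fin.lastCases ?_ (fun i => ?_) i
    · simp
    · simp
  · rintro (rfl | ⟨i, rfl⟩)
    · exact ⟨Fin.last k, by simp⟩
    · exact ⟨i.castSucc, by simp⟩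

lemma snoc_injective {k : ℕ} {s : Fin k → ℕ} (hs : Function.Injective s) {a : ℕ}
    (ha : a ∉ univ.image s) : Function.Injective (Fin.snoc s a : Fin (k + 1) → ℕ) := by
  have h : ∀ i, s i ≠ a := fun i h => ha (h ▸ mem_image_of_mem s (mem_univ i))
  intro i j
  refine Fin.lastCases ?_ (fun i => ?_) i <;> refine Fin.lastCases ?_ (fun j => ?_) j
  · simp
  · simpa using fun h' => (h j h'.symm).elim
  · simpa using fun h' => (h i h').elim
  · simpa using fun h' => hs h'

/-- The product `∏_{s ∈ S} (x - s)`. -/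
noncomputable def diffTo (S : Finset ℕ) (x : ℕ) : ℝ := ∏ t ∈ S, ((x : ℝ) - t)

lemma diffTo_ne_zero {S : Finset ℕ} {x : ℕ} (hx : x ∉ S) : diffTo S x ≠ 0 :=
  prod_ne_zero_iff.2 fun _ hs => sub_ne_zero.2 fun h => hx (Nat.cast_injective h ▸ hs)

/-- Rows `S` with one more row `a`, in terms of the unsorted determinant. -/
lemma sortedMinor_insert {k : ℕ} (B : ℕ → Fin (k + 1) → ℝ) {s : Fin k → ℕ} (hs : StrictMono s)
    {a : ℕ} (ha : a ∉ univ.image s) :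
    sortedMinor B (insert a (univ.image s)) * |diffTo (univ.image s) a|
      = det (of fun i j => B ((Fin.snoc s a : Fin (k + 1) → ℕ) i) j)
        * diffTo (univ.image s) a := by
  have h := sortedMinor_mul_abs B (snoc_injective hs.injective ha)
  have hV := diffProd_pos hs
  rw [image_snoc, diffProd_snoc, abs_mul, abs_of_pos hV] at h
  have hd : diffTo (univ.image s) a = ∏ i, ((a : ℝ) - s i) := by
    rw [diffTo, prod_image fun i _ j _ h => hs.injective h]
  rw [hd]
  have := hV.ne'
  apply mul_right_cancel₀ this
  linear_combination h

/-- Rows `S` with two more rows `a < b`, in terms of the unsorted determinant. -/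
lemma sortedMinor_insert₂ {k : ℕ} (B : ℕ → Fin (k + 2) → ℝ) {s : Fin k → ℕ} (hs : StrictMono s)
    {a b : ℕ} (ha : a ∉ univ.image s) (hb : b ∉ univ.image s) (hab : a < b) :
    sortedMinor B (insert a (insert b (univ.image s)))
        * (|diffTo (univ.image s) a| * |diffTo (univ.image s) b|)
      = det (of fun i j => B ((Fin.snoc (Fin.snoc s a : Fin (k + 1) → ℕ) b :
          Fin (k + 2) → ℕ) i) j)
        * (diffTo (univ.image s) a * diffTo (univ.image s) b) := by
  have hb' : b ∉ univ.image (Fin.snoc s a : Fin (k + 1) → ℕ) := by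
    rw [image_snoc, mem_insert]
    rintro (h | h)
    · exact hab.ne' h
    · exact hb h
  have h := sortedMinor_mul_abs B (snoc_injective (snoc_injective hs.injective ha) hb')
  have hV := diffProd_pos hs
  have hba : (0 : ℝ) < b - a := sub_pos.2 (Nat.cast_lt.2 hab)
  have hd (x : ℕ) : diffTo (univ.image s) x = ∏ i, ((x : ℝ) - s i) := by
    rw [diffTo, prod_image fun i _ j _ h => hs.injective h]
  have hs2 : diffProd (Fin.snoc (Fin.snoc s a : Fin (k + 1) → ℕ) b : Fin (k + 2) → ℕ)
      = diffProd s * ((∏ i, ((a : ℝ) - s i)) * ((∏ i, ((b : ℝ) - s i)) * (b - a))) := by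
    rw [diffProd_snoc, diffProd_snoc, Fin.prod_univ_castSucc]
    simp [mul_assoc]
  rw [image_snoc, image_snoc, hs2, abs_mul, abs_mul, abs_mul, abs_of_pos hV, abs_of_pos hba,
    insert_comm] at h
  rw [hd, hd]
  apply mul_right_cancel₀ hV.ne'
  apply mul_right_cancel₀ hba.ne'
  linear_combination h

lemma exists_strictMono_image (S : Finset ℕ) :
    ∃ s : Fin #S → ℕ, StrictMono s ∧ univ.image s = S :=
  ⟨S.orderEmbOfFin rfl, (S.orderEmbOfFin rfl).strictMono, by
    apply coe_injective
    rw [coe_image, coe_univ, Set.image_univ, range_orderEmbOfFin]⟩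

/-- The three-term Plücker relation for minors with sorted rows. -/
theorem sortedMinor_plucker {k : ℕ} (B : ℕ → Fin (k + 2) → ℝ) (e : Fin (k + 2))
    {S : Finset ℕ} (hS : #S = k) {a b c : ℕ} (ha : a ∉ S) (hb : b ∉ S) (hc : c ∉ S)
    (hab : a < b) (hbc : b < c) :
    sortedMinor (fun i j => B i (e.succAbove j)) (insert a S)
          * sortedMinor B (insert b (insert c S))
        + sortedMinor (fun i j => B i (e.succAbove j)) (insert c S)
          * sortedMinor B (insert a (insert b S))
      = sortedMinor (fun i j => B i (e.succAbove j)) (insert b S)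
          * sortedMinor B (insert a (insert c S)) := by
  subst hS
  obtain ⟨s, hs, hsS⟩ := exists_strictMono_image S
  generalize #S = k at s B e hs hsS
  subst hsS
  set S := univ.image s
  have h1 := @sortedMinor_insert k (fun i j => B i (e.succAbove j)) s hs
  have h2 := @sortedMinor_insert₂ k B s hs
  have hP := plucker_snoc (fun i => B (s i)) (B a) (B b) (B c) e
  have hsn (a : ℕ) (i : Fin (k + 1)) : (Fin.snoc (fun i => B (s i)) (B a) :
      Fin (k + 1) → Fin (k + 2) → ℝ) i = B ((Fin.snoc s a : Fin (k + 1) → ℕ) i) := by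
    refine Fin.lastCases ?_ (fun i => ?_) i <;> simp
  have hsn2 (a b : ℕ) (i : Fin (k + 2)) : (Fin.snoc (Fin.snoc (fun i => B (s i)) (B a) :
      Fin (k + 1) → Fin (k + 2) → ℝ) (B b) : Fin (k + 2) → Fin (k + 2) → ℝ) i
      = B ((Fin.snoc (Fin.snoc s a : Fin (k + 1) → ℕ) b : Fin (k + 2) → ℕ) i) := by
    refine Fin.lastCases ?_ (fun i => ?_) i
    · simp
    · simp only [Fin.snoc_castSucc]
      exact hsn a i
  have hd2 (a b : ℕ) : det (of (Fin.snoc (Fin.snoc (fun i => B (s i)) (B a) :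
      Fin (k + 1) → Fin (k + 2) → ℝ) (B b) : Fin (k + 2) → Fin (k + 2) → ℝ))
      = det (of fun i j => B ((Fin.snoc (Fin.snoc s a : Fin (k + 1) → ℕ) b :
        Fin (k + 2) → ℕ) i) j) := by
    congr 1
    ext i j
    rw [of_apply, of_apply, hsn2]
  simp only [hd2, hsn] at hP
  have h1a := h1 ha
  have h1b := h1 hb
  have h1c := h1 hc
  have h2ab := h2 ha hb hab
  have h2ac := h2 ha hc (hab.trans hbc)
  have h2bc := h2 hb hc hbc
  have na := abs_ne_zero.2 (diffTo_ne_zero ha)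
  have nb := abs_ne_zero.2 (diffTo_ne_zero hb)
  have nc := abs_ne_zero.2 (diffTo_ne_zero hc)
  -- Each of the three products involves each of `a`, `b`, `c` exactly once, so the sorting signs
  -- contribute the same factor to every term.
  apply mul_right_cancel₀ (mul_ne_zero na (mul_ne_zero nb nc))
  have p1 := congrArg₂ (· * ·) h1a h2bc
  have p2 := congrArg₂ (· * ·) h1c h2ab
  have p3 := congrArg₂ (· * ·) h1b h2ac
  linear_combination p1 + p2 - p3 + (diffTo S a * diffTo S b * diffTo S c) * hP

section

variable {n : ℕ}

/-! ### Total positivity in terms of minors -/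

/-- The entries of `M`, extended by zero to all natural numbers. -/
noncomputable def entry (M : Matrix (Fin n) (Fin n) ℝ) (i j : ℕ) : ℝ :=
  if h : i < n ∧ j < n then M ⟨i, h.1⟩ ⟨j, h.2⟩ else 0

@[simp] lemma entry_val (M : Matrix (Fin n) (Fin n) ℝ) (i j : Fin n) : entry M i j = M i j := by
  simp [entry]

lemma entry_of_lt {M : Matrix (Fin n) (Fin n) ℝ} (hM : M ∈ unipotentUpper n) {i j : ℕ}
    (h : j < i) : entry M i j = 0 := by
  rw [entry]
  split_ifs with h'
  · exact hM.2 _ _ h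
  · rfl

lemma entry_self {M : Matrix (Fin n) (Fin n) ℝ} (hM : M ∈ unipotentUpper n) {i : ℕ}
    (h : i < n) : entry M i i = 1 := by
  rw [entry, dif_pos ⟨h, h⟩]
  exact hM.1 _

/-- The minor with rows `I` and the last `#I` columns, with labels counted from `0`. -/
noncomputable def flagMinor (M : Matrix (Fin n) (Fin n) ℝ) (I : Finset ℕ) : ℝ :=
  sortedMinor (fun i (j : Fin #I) => entry M i (n - #I + j)) I

lemma flagMinor_eq (M : Matrix (Fin n) (Fin n) ℝ) {I : Finset ℕ} {k : ℕ} (h : #I = k) :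
    flagMinor M I = sortedMinor (fun i (j : Fin k) => entry M i (n - k + j)) I := by
  subst h
  rfl

lemma flagMinor_image (M : Matrix (Fin n) (Fin n) ℝ) {k : ℕ} {f : Fin k → ℕ}
    (hf : StrictMono f) :
    flagMinor M (univ.image f) = det (of fun i j => entry M (f i) (n - k + j)) := by
  rw [flagMinor_eq M (card_image_fin hf.injective), sortedMinor_image _ hf]

/-- A nonzero term of the Leibniz expansion needs `r (σ i) ≤ c i` for all `i`. Monotonicity then
forces `σ` to inject the indices up to `i₀` into those strictly below `i₀`. -/
lemma det_entry_eq_zero {M : Matrix (Fin n) (Fin n) ℝ} (hM : M ∈ unipotentUpper n) {k : ℕ}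
    {r c : Fin k → ℕ} (hr : StrictMono r) (hc : StrictMono c) {i₀ : Fin k} (h : c i₀ < r i₀) :
    det (of fun i j => entry M (r i) (c j)) = 0 := by
  rw [det_apply]
  refine sum_eq_zero fun σ _ => ?_
  suffices ∃ i, r (σ i) > c i by
    obtain ⟨i, hi⟩ := this
    rw [prod_eq_zero (mem_univ i), smul_zero]
    exact entry_of_lt hM hi
  by_contra! hcon
  have key : ∀ i ∈ Iic i₀, σ i ∈ Iio i₀ := fun i hi => by
    rw [mem_Iic] at hi
    rw [mem_Iio]
    by_contra! h'
    have h1 := hcon i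
    have h2 := hc.monotone hi
    have h3 := hr.monotone h'
    omega
  have := card_le_card_of_injOn σ key σ.injective.injOn
  simp at this

/-- Together with `det_entry_eq_zero` this shows that the minors not vanishing identically on `N_n`
are exactly those with `r i ≤ c i`. The witness has ones on the diagonal and at the places `(r l, c
l)`, which makes the chosen submatrix lower unitriangular. -/
lemma exists_unipotent_det_ne_zero {k : ℕ} {r c : Fin k → Fin n} (hr : StrictMono r)
    (hc : StrictMono c) (h : ∀ i, r i ≤ c i) :
    ∃ H ∈ unipotentUpper n, (H.submatrix r c).det ≠ 0 := by
  classical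
  refine ⟨of fun i j => if i = j ∨ ∃ l, r l = i ∧ c l = j then 1 else 0, ⟨?_, ?_⟩, ?_⟩
  · simp
  · intro i j hij
    rw [of_apply, if_neg]
    rintro (rfl | ⟨l, rfl, rfl⟩)
    · exact lt_irrefl _ hij
    · exact absurd (h l) (not_le.2 hij)
  · rw [det_of_isLowerTriangular]
    · rw [prod_eq_one]
      · exact one_ne_zero
      · intro i _
        rw [submatrix_apply, of_apply, if_pos (Or.inr ⟨i, rfl, rfl⟩)]
    · intro i j hij
      rw [submatrix_apply, of_apply, if_neg]
      have hij : i < j := hij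
      rintro (h' | ⟨l, h1, h2⟩)
      · exact absurd (h j) (not_le.2 (h' ▸ hr hij))
      · exact hij.ne ((hr.injective h1).symm.trans (hc.injective h2))

lemma entry_submatrix (M : Matrix (Fin n) (Fin n) ℝ) {k : ℕ} (r c : Fin k → Fin n) :
    M.submatrix r c = of fun i j => entry M (r i) (c j) := by
  ext i j
  simp

lemma det_pos_of_le {M : Matrix (Fin n) (Fin n) ℝ} (hM : M ∈ totallyPositive n) {k : ℕ}
    {r c : Fin k → ℕ} (hr : StrictMono r) (hc : StrictMono c) (h : ∀ i, r i ≤ c i)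
    (hn : ∀ i, c i < n) : 0 < det (of fun i j => entry M (r i) (c j)) := by
  let r' : Fin k ↪o Fin n := OrderEmbedding.ofStrictMono
    (fun i => ⟨r i, (h i).trans_lt (hn i)⟩) fun _ _ hij => hr hij
  let c' : Fin k ↪o Fin n := OrderEmbedding.ofStrictMono (fun i => ⟨c i, hn i⟩)
    fun _ _ hij => hc hij
  have := hM.2 k r' c' (exists_unipotent_det_ne_zero r'.strictMono c'.strictMono h)
  rwa [entry_submatrix] at this

lemma det_nonneg {M : Matrix (Fin n) (Fin n) ℝ} (hM : M ∈ totallyPositive n) {k : ℕ}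
    {r c : Fin k → ℕ} (hr : StrictMono r) (hc : StrictMono c)
    (hn : ∀ i, c i < n) : 0 ≤ det (of fun i j => entry M (r i) (c j)) := by
  by_cases h : ∀ i, r i ≤ c i
  · exact (det_pos_of_le hM hr hc h hn).le
  · push Not at h
    obtain ⟨i, hi⟩ := h
    rw [det_entry_eq_zero hM.1 hr hc hi]

lemma mem_totallyPositive {M : Matrix (Fin n) (Fin n) ℝ} (hM : M ∈ unipotentUpper n)
    (h : ∀ (k : ℕ) (r c : Fin k → ℕ), StrictMono r → StrictMono c → (∀ i, r i ≤ c i) →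
      (∀ i, c i < n) → 0 < det (of fun i j => entry M (r i) (c j))) :
    M ∈ totallyPositive n := by
  refine ⟨hM, fun k r c ⟨H, hH, hdet⟩ => ?_⟩
  rw [entry_submatrix] at hdet ⊢
  refine h k _ _ (fun _ _ hij => r.strictMono hij) (fun _ _ hij => c.strictMono hij)
    (fun i => ?_) fun i => (c i).isLt
  by_contra! hlt
  exact hdet (det_entry_eq_zero hH (fun _ _ hij => r.strictMono hij)
    (fun _ _ hij => c.strictMono hij) hlt)

lemma le_add_of_strictMono {k : ℕ} {f : Fin k → ℕ} (hf : StrictMono f) (hn : ∀ i, f i < n) :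
    ∀ i : Fin k, f i ≤ n - k + i := by
  have key : ∀ d : ℕ, ∀ i : Fin k, (i : ℕ) + d + 1 = k → f i + d + 1 ≤ n := by
    intro d
    induction d with
    | zero => intro i _; exact hn i
    | succ d ih =>
      intro i hi
      have hlt : (i : ℕ) + 1 < k := by omega
      have h1 := ih ⟨i + 1, hlt⟩ (by simp only; omega)
      have h2 : f i < f ⟨i + 1, hlt⟩ := hf (by rw [Fin.lt_def]; simp)
      omega
  intro i
  have h1 := key (k - 1 - i) i (by have := i.isLt; omega)
  have := i.isLt
  omega

lemma card_le_of_strictMono {k : ℕ} {f : Fin k → ℕ} (hf : StrictMono f) (hn : ∀ i, f i < n) :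
    k ≤ n := by
  have : univ.image f ⊆ range n := fun x hx => by
    obtain ⟨i, -, rfl⟩ := mem_image.1 hx
    exact mem_range.2 (hn i)
  have := card_le_card this
  rwa [card_image_fin hf.injective, card_range] at this

lemma flagMinor_pos {M : Matrix (Fin n) (Fin n) ℝ} (hM : M ∈ totallyPositive n) {I : Finset ℕ}
    (hI : I ⊆ range n) : 0 < flagMinor M I := by
  obtain ⟨s, hs, hsI⟩ := exists_strictMono_image I
  have hlt : ∀ i, s i < n := fun i => mem_range.1 (hI (hsI ▸ mem_image_of_mem s (mem_univ i)))
  have hk := card_le_of_strictMono hs hlt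
  rw [← hsI, flagMinor_image _ hs]
  refine det_pos_of_le hM hs (fun i j hij => ?_) (le_add_of_strictMono hs hlt) fun i => ?_
  · have : (i : ℕ) < j := hij
    omega
  · have := i.isLt
    omega

/-- Removing unipotent rows at the bottom. -/
lemma det_rows_tail {M : Matrix (Fin n) (Fin n) ℝ} (hM : M ∈ unipotentUpper n) (r : ℕ → ℕ)
    (m d t : ℕ) (h : d + m + t ≤ n) :
    det (of fun i j : Fin (m + t) =>
        entry M (if (i : ℕ) < m then r i else d + i) (d + j))
      = det (of fun i j : Fin m => entry M (r i) (d + j)) := by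
  induction t with
  | zero =>
    congr 1
    ext i j
    have hi : (i : ℕ) < m := i.isLt
    simp only [of_apply, if_pos hi]
  | succ t ih =>
    -- Expansion along the last row: it is row `d + m + t` of `M`, zero to the left of its diagonal
    -- entry `1`, which is the corner of the minor.
    rw [← ih (by omega), det_succ_row (n := m + t) _ (Fin.last _), Fin.sum_univ_castSucc,
      sum_eq_zero, zero_add]
    · have hlast : ¬ ((Fin.last (m + t) : Fin (m + t + 1)) : ℕ) < m := by simp
      simp only [of_apply, if_neg hlast]
      rw [entry_self hM (by simp only [Fin.val_last]; omega)]
      simp only [Fin.val_last, mul_one, ← two_mul, pow_mul, neg_one_sq, one_pow, one_mul]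
      congr 1
      ext i j
      simp [Fin.succAbove_last]
    · intro j _
      have hlast : ¬ ((Fin.last (m + t) : Fin (m + t + 1)) : ℕ) < m := by simp
      have hj := j.isLt
      simp only [of_apply, if_neg hlast]
      rw [entry_of_lt hM, mul_zero, zero_mul]
      simp only [Fin.val_last, Fin.val_castSucc]
      omega

lemma image_rows_tail (r : ℕ → ℕ) (m d t : ℕ) :
    univ.image (fun i : Fin (m + t) => if (i : ℕ) < m then r i else d + i)
      = (range m).image r ∪ Ico (d + m) (d + m + t) := by
  ext x
  simp only [mem_image, mem_univ, true_and, mem_union, mem_range, mem_Ico]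
  constructor
  · rintro ⟨i, rfl⟩
    have := i.isLt
    split_ifs with h
    · exact Or.inl ⟨i, h, rfl⟩
    · right; omega
  · rintro (⟨i, hi, rfl⟩ | h)
    · exact ⟨⟨i, by omega⟩, by simp [hi]⟩
    · refine ⟨⟨x - d, by omega⟩, ?_⟩
      have : ¬ x - d < m := by omega
      simp only [if_neg this]
      omega

/-- A flag minor whose rows end with a full tail is a minor with consecutive columns. -/
lemma flagMinor_tail {M : Matrix (Fin n) (Fin n) ℝ} (hM : M ∈ unipotentUpper n) {r : ℕ → ℕ}
    {m d : ℕ} (hr : ∀ i j, i < j → j < m → r i < r j) (hd : ∀ i < m, r i < d + m)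
    (h : d + m ≤ n) :
    flagMinor M ((range m).image r ∪ Ico (d + m) n)
      = det (of fun i j : Fin m => entry M (r i) (d + j)) := by
  obtain ⟨t, rfl⟩ := Nat.exists_eq_add_of_le h
  rw [← image_rows_tail, flagMinor_image, ← det_rows_tail hM r m d t le_rfl]
  · have : d + m + t - (m + t) = d := by omega
    rw [this]
  · intro i j hij
    have hij : (i : ℕ) < j := hij
    simp only
    split_ifs with h1 h2 h2
    · exact hr _ _ hij h2
    · have := hd i h1
      omega
    · omega
    · omega

/-! ### A criterion for total positivity -/

/-- The condition `r i ≤ c i` is recast as a bound on the number of columns below `r i`; in this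
form it is easily followed when one column is exchanged for another. -/
lemma le_orderEmbOfFin {J : Finset ℕ} {k : ℕ} (h : #J = k) {x : ℕ} {i : Fin k}
    (hx : #{j ∈ J | j < x} ≤ i) : x ≤ J.orderEmbOfFin h i := by
  by_contra! hlt
  have : (Iic i).map (J.orderEmbOfFin h).toEmbedding ⊆ {j ∈ J | j < x} := fun y hy => by
    obtain ⟨a, ha, rfl⟩ := mem_map.1 hy
    exact mem_filter.2 ⟨orderEmbOfFin_mem _ _ _,
      ((J.orderEmbOfFin h).monotone (mem_Iic.1 ha)).trans_lt hlt⟩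
  have := card_le_card this
  rw [card_map, Fin.card_Iic] at this
  omega

lemma orderEmbOfFin_lt {J : Finset ℕ} {k : ℕ} (h : #J = k) {x : ℕ} {i : Fin k}
    (hx : i < #{j ∈ J | j < x}) : J.orderEmbOfFin h i < x := by
  by_contra! hle
  have : {j ∈ J | j < x} ⊆ (Iio i).map (J.orderEmbOfFin h).toEmbedding := fun y hy => by
    obtain ⟨hy, hyx⟩ := mem_filter.1 hy
    have : y ∈ Set.range (J.orderEmbOfFin h) := by rw [range_orderEmbOfFin]; exact hy
    obtain ⟨a, rfl⟩ := this
    exact mem_map.2 ⟨a, mem_Iio.2 ((J.orderEmbOfFin h).lt_iff_lt.1 (hyx.trans_le hle)), rfl⟩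
  have := card_le_card this
  rw [card_map, Fin.card_Iio] at this
  omega

/-- The columns of `M`, restricted to the rows `r`. -/
noncomputable def columns (M : Matrix (Fin n) (Fin n) ℝ) {k : ℕ} (r : Fin k → ℕ) (j : ℕ)
    (i : Fin k) : ℝ := entry M (r i) j

lemma sortedMinor_columns (M : Matrix (Fin n) (Fin n) ℝ) {k : ℕ} (r : Fin k → ℕ)
    {J : Finset ℕ} (h : #J = k) :
    sortedMinor (columns M r) J = det (of fun i j => entry M (r i) (J.orderEmbOfFin h j)) := by
  rw [sortedMinor, dif_pos h, ← det_transpose]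
  rfl

lemma sortedMinor_columns_eq_zero {M : Matrix (Fin n) (Fin n) ℝ} (hM : M ∈ unipotentUpper n)
    {k : ℕ} {r : Fin k → ℕ} (hr : StrictMono r) {J : Finset ℕ} (h : #J = k) {i : Fin k}
    (hi : i < #{j ∈ J | j < r i}) : sortedMinor (columns M r) J = 0 := by
  rw [sortedMinor_columns M r h]
  exact det_entry_eq_zero hM hr (J.orderEmbOfFin h).strictMono (orderEmbOfFin_lt h hi)

/-- Base case of the criterion: appending the tail rows turns a minor with consecutive columns into
a flag minor. -/
lemma sortedMinor_columns_Icc_pos {M : Matrix (Fin n) (Fin n) ℝ} (hM : M ∈ unipotentUpper n)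
    (hf : ∀ I ⊆ range n, 0 < flagMinor M I) {lo w k : ℕ} (hk : #(Icc lo (lo + w)) = k)
    (hJ : Icc lo (lo + w) ⊆ range n) {r : Fin k → ℕ} (hr : StrictMono r)
    (hc : ∀ i, #{j ∈ Icc lo (lo + w) | j < r i} ≤ i) :
    0 < sortedMinor (columns M r) (Icc lo (lo + w)) := by
  have hk' : w + 1 = k := by rw [← hk, Nat.card_Icc]; omega
  have hn : lo + w < n := mem_range.1 (hJ (mem_Icc.2 (by omega)))
  have he : ∀ j : Fin k, (Icc lo (lo + w)).orderEmbOfFin hk j = lo + j := by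
    have := orderEmbOfFin_unique hk (f := fun j : Fin k => lo + (j : ℕ))
      (fun j => mem_Icc.2 (by have := j.isLt; omega))
      (fun i j hij => by have hij : (i : ℕ) < j := hij; simp only; omega)
    intro j
    rw [← this]
  have hle : ∀ i, r i ≤ lo + i := fun i => by
    rw [← he]
    exact le_orderEmbOfFin hk (hc i)
  set r' : ℕ → ℕ := fun i => if h : i < k then r ⟨i, h⟩ else 0 with hr'
  have hrr (i : Fin k) : r' i = r i := by simp [hr']
  have h1 := flagMinor_tail hM (r := r') (m := k) (d := lo) (fun i j hij hj => by
      simp only [hr', dif_pos hj, dif_pos (hij.trans hj)]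
      exact hr hij) (fun i hi => by
      have := hle ⟨i, hi⟩
      simp only [hr', dif_pos hi]
      simp only at this
      omega) (by omega)
  rw [sortedMinor_columns M r hk]
  simp only [he]
  simp only [hrr] at h1
  rw [← h1]
  refine hf _ fun x hx => ?_
  rcases mem_union.1 hx with hx | hx
  · obtain ⟨i, hi, rfl⟩ := mem_image.1 hx
    have hi := mem_range.1 hi
    have := hle ⟨i, hi⟩
    simp only [hr', dif_pos hi, mem_range]
    simp only at this
    omega
  · exact mem_range.2 (mem_Ico.1 hx).2

/-- Exchanging a column for one further to the right cannot increase the number of columns to the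
left of `x`, so the nonvanishing condition is preserved. -/
lemma card_filter_insert_le {S T : Finset ℕ} {a b x : ℕ} (hab : a ≤ b) (ha : a ∉ S)
    (hT : insert a S ⊆ T) : #{j ∈ insert b S | j < x} ≤ #{j ∈ T | j < x} := by
  refine le_trans ?_ (card_le_card (filter_subset_filter _ hT))
  rw [filter_insert, filter_insert]
  split_ifs with h1 h2 h2
  · rw [card_insert_of_notMem (s := {j ∈ S | j < x}) (a := a) (by simp [ha])]
    exact card_insert_le _ _
  · omega
  · exact card_le_card (subset_insert _ _)
  · exact le_rfl

/-- Double induction on the number `k` of columns and on the width `w` of an interval containing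
them. If the extreme columns `lo`, `hi` belong to `J` and some `p` between them does not, the
Plücker relation for `lo < p < hi` expresses the wanted minor times `[p, S]` as `[lo, S] [p, hi, S]
+ [hi, S] [lo, p, S]`. The minors `[x, S]` have one row fewer, and the other two on the right occupy
a shorter interval. -/
lemma sortedMinor_columns_pos {M : Matrix (Fin n) (Fin n) ℝ} (hM : M ∈ unipotentUpper n)
    (hf : ∀ I ⊆ range n, 0 < flagMinor M I) (k : ℕ) :
    ∀ (w lo : ℕ) (J : Finset ℕ), J ⊆ Icc lo (lo + w) → #J = k → J ⊆ range n →
      ∀ r : Fin k → ℕ, StrictMono r → (∀ i, #{j ∈ J | j < r i} ≤ i) →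
        0 < sortedMinor (columns M r) J := by
  induction k with
  | zero =>
    intro w lo J _ hk _ r _ _
    rw [sortedMinor_columns M r hk, det_fin_zero]
    exact one_pos
  | succ k ihk =>
    intro w
    induction w with
    | zero =>
      intro lo J hJ hk hn r hr hc
      have : J = Icc lo (lo + 0) := eq_of_subset_of_card_le hJ (by simp [hk])
      subst this
      exact sortedMinor_columns_Icc_pos hM hf hk hn hr hc
    | succ w ihw =>
      intro lo J hJ hk hn r hr hc
      by_cases hJI : J = Icc lo (lo + (w + 1))
      · subst hJI
        exact sortedMinor_columns_Icc_pos hM hf hk hn hr hc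
      by_cases hlo : lo ∈ J
      swap
      · refine ihw (lo + 1) J (fun x hx => ?_) hk hn r hr hc
        have h1 := mem_Icc.1 (hJ hx)
        have h2 : x ≠ lo := fun h => hlo (h ▸ hx)
        exact mem_Icc.2 (by omega)
      by_cases hhi : lo + (w + 1) ∈ J
      swap
      · refine ihw lo J (fun x hx => ?_) hk hn r hr hc
        have h1 := mem_Icc.1 (hJ hx)
        have h2 : x ≠ lo + (w + 1) := fun h => hhi (h ▸ hx)
        exact mem_Icc.2 (by omega)
      obtain ⟨p, hpI, hp⟩ := exists_of_ssubset (ssubset_of_subset_of_ne hJ hJI)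
      have hpI := mem_Icc.1 hpI
      have hplo : p ≠ lo := fun h => hp (h ▸ hlo)
      have hphi : p ≠ lo + (w + 1) := fun h => hp (h ▸ hhi)
      set hi := lo + (w + 1) with hhi_def
      set S := (J.erase lo).erase hi with hS
      have hhi' : hi ∈ J.erase lo := mem_erase.2 ⟨by omega, hhi⟩
      have hJS : insert lo (insert hi S) = J := by
        rw [hS, insert_erase hhi', insert_erase hlo]
      obtain ⟨k', rfl⟩ : ∃ k', k = k' + 1 := by
        have h1 := card_erase_of_mem hlo
        have h2 := card_pos.2 ⟨hi, hhi'⟩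
        exact ⟨k - 1, by omega⟩
      have hScard : #S = k' := by
        rw [hS, card_erase_of_mem hhi', card_erase_of_mem hlo, hk]
        omega
      have hSJ : S ⊆ J := (erase_subset _ _).trans (erase_subset _ _)
      have hloS : lo ∉ S := fun h => by simp [hS] at h
      have hhiS : hi ∉ S := fun h => by simp [hS] at h
      have hpS : p ∉ S := fun h => hp (hSJ h)
      have hSlo {x : ℕ} (hx : x ∈ S) : lo < x ∧ x < hi := by
        have h1 := mem_Icc.1 (hJ (hSJ hx))
        have h2 : x ≠ lo := fun h => hloS (h ▸ hx)
        have h3 : x ≠ hi := fun h => hhiS (h ▸ hx)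
        omega
      have hSn {x : ℕ} (hx : x ∈ S) : x < n := mem_range.1 (hn (hSJ hx))
      have hhin : hi < n := mem_range.1 (hn hhi)
      have hP := sortedMinor_plucker (columns M r) (Fin.last (k' + 1)) hScard hloS hpS hhiS
        (by omega) (by omega : p < hi)
      rw [hJS] at hP
      have hcast : (fun i j => columns M r i ((Fin.last (k' + 1)).succAbove j))
          = columns M (r ∘ Fin.castSucc) := by
        ext i j
        simp [columns, Fin.succAbove_last]
      rw [hcast] at hP
      have hr' : StrictMono (r ∘ Fin.castSucc) := hr.comp (Fin.strictMono_castSucc)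
      have hc' (i : Fin (k' + 1)) : #{j ∈ J | j < (r ∘ Fin.castSucc) i} ≤ i := hc i.castSucc
      have small (x : ℕ) (hx : lo ≤ x) (hx' : x ≤ hi) (hxS : x ∉ S) :
          0 < sortedMinor (columns M (r ∘ Fin.castSucc)) (insert x S) := by
        refine ihk (w + 1) lo _ (fun y hy => ?_) ?_ (fun y hy => ?_) _ hr' fun i => ?_
        · rcases mem_insert.1 hy with rfl | hy
          · exact mem_Icc.2 ⟨hx, hx'⟩
          · exact hJ (hSJ hy)
        · rw [card_insert_of_notMem hxS, hScard]
        · rcases mem_insert.1 hy with rfl | hy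
          · exact mem_range.2 (by omega)
          · exact mem_range.2 (hSn hy)
        · exact (card_filter_insert_le hx hloS (insert_subset hlo hSJ)).trans (hc' i)
      have hcard2 {x y : ℕ} (hx : x ∉ S) (hy : y ∉ S) (hxy : x ≠ y) :
          #(insert x (insert y S)) = k' + 1 + 1 := by
        rw [card_insert_of_notMem, card_insert_of_notMem hy, hScard]
        simp [hx, hxy]
      have h1 := small lo le_rfl (by omega) hloS
      have h2 := small hi (by omega) le_rfl hhiS
      have h3 := small p (by omega) (by omega) hpS
      have h4 : 0 < sortedMinor (columns M r) (insert p (insert hi S)) := by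
        refine ihw (lo + 1) _ (fun y hy => ?_) (hcard2 hpS hhiS (by omega)) (fun y hy => ?_) r hr
          fun i => ?_
        · rcases mem_insert.1 hy with rfl | hy
          · exact mem_Icc.2 (by omega)
          · rcases mem_insert.1 hy with rfl | hy
            · exact mem_Icc.2 (by omega)
            · have := hSlo hy
              exact mem_Icc.2 (by omega)
        · rcases mem_insert.1 hy with rfl | hy
          · exact mem_range.2 (by omega)
          · rcases mem_insert.1 hy with rfl | hy
            · exact mem_range.2 (by omega)
            · exact mem_range.2 (hSn hy)
        · refine (card_filter_insert_le (a := lo) (by omega) ?_ hJS.le).trans (hc i)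
          rw [mem_insert]
          rintro (h | h)
          · omega
          · exact hloS h
      -- Here a column moves to the left, so the minor may vanish identically. Nonnegativity
      -- suffices, because the other product is positive.
      have h5 : 0 ≤ sortedMinor (columns M r) (insert lo (insert p S)) := by
        have hcard := hcard2 hloS hpS (by omega)
        by_cases hcc : ∀ i, #{j ∈ insert lo (insert p S) | j < r i} ≤ i
        · refine (ihw lo _ (fun y hy => ?_) hcard (fun y hy => ?_) r hr hcc).le
          · rcases mem_insert.1 hy with rfl | hy
            · exact mem_Icc.2 (by omega)
            · rcases mem_insert.1 hy with rfl | hy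
              · exact mem_Icc.2 (by omega)
              · have := hSlo hy
                exact mem_Icc.2 (by omega)
          · rcases mem_insert.1 hy with rfl | hy
            · exact mem_range.2 (by omega)
            · rcases mem_insert.1 hy with rfl | hy
              · exact mem_range.2 (by omega)
              · exact mem_range.2 (hSn hy)
        · push Not at hcc
          obtain ⟨i, hi⟩ := hcc
          rw [sortedMinor_columns_eq_zero hM hr hcard hi]
      refine pos_of_mul_pos_right ?_ h3.le
      rw [← hP]
      positivity

/-- A unipotent upper triangular matrix is totally positive as soon as its right flag minors
are positive. -/
theorem mem_totallyPositive_of_flagMinor_pos {M : Matrix (Fin n) (Fin n) ℝ}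
    (hM : M ∈ unipotentUpper n) (hf : ∀ I ⊆ range n, 0 < flagMinor M I) :
    M ∈ totallyPositive n := by
  refine mem_totallyPositive hM fun k r c hr hc hle hn => ?_
  have hcard := card_image_fin hc.injective
  have hsub : univ.image c ⊆ range n := fun x hx => by
    obtain ⟨i, -, rfl⟩ := mem_image.1 hx
    exact mem_range.2 (hn i)
  have h := sortedMinor_columns_pos hM hf k n 0 (univ.image c)
    (fun x hx => mem_Icc.2 ⟨Nat.zero_le _, by have := mem_range.1 (hsub hx); omega⟩) hcard hsub r
    hr fun i => by
      have : {j ∈ univ.image c | j < r i} ⊆ (Iio i).image c := fun x hx => by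
        obtain ⟨hx, hlt⟩ := mem_filter.1 hx
        obtain ⟨j, -, rfl⟩ := mem_image.1 hx
        exact mem_image_of_mem _ (mem_Iio.2 (hc.lt_iff_lt.1 (hlt.trans_le (hle i))))
      refine (card_le_card this).trans (card_image_le.trans ?_)
      rw [Fin.card_Iio]
  rwa [sortedMinor_columns M r hcard,
    ← orderEmbOfFin_unique hcard (fun i => mem_image_of_mem c (mem_univ i)) hc] at h

/-! ### The three-term relation for flag minors, and a base point -/

/-- Deleting the first of the last `#S + 2` columns leaves the last `#S + 1`, so the choice `e = 0`
makes all six determinants flag minors. -/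
lemma flagMinor_plucker (M : Matrix (Fin n) (Fin n) ℝ) {S : Finset ℕ} (hS : #S + 2 ≤ n)
    {a b c : ℕ} (ha : a ∉ S) (hb : b ∉ S) (hc : c ∉ S) (hab : a < b) (hbc : b < c) :
    flagMinor M (insert a S) * flagMinor M (insert b (insert c S))
        + flagMinor M (insert a (insert b S)) * flagMinor M (insert c S)
      = flagMinor M (insert a (insert c S)) * flagMinor M (insert b S) := by
  have hP := sortedMinor_plucker (fun i (j : Fin (#S + 2)) => entry M i (n - (#S + 2) + j)) 0
    rfl ha hb hc hab hbc
  have h1 {x : ℕ} (hx : x ∉ S) : flagMinor M (insert x S)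
      = sortedMinor (fun i (j : Fin (#S + 1)) =>
        entry M i (n - (#S + 2) + ((0 : Fin (#S + 2)).succAbove j : Fin (#S + 2)))) (insert x S) := by
    rw [flagMinor_eq M (card_insert_of_notMem hx)]
    congr 1
    ext i j
    congr 1
    simp only [Fin.zero_succAbove, Fin.val_succ]
    omega
  have h2 {x y : ℕ} (hx : x ∉ S) (hy : y ∉ S) (hxy : x < y) :
      flagMinor M (insert x (insert y S))
      = sortedMinor (fun i (j : Fin (#S + 2)) => entry M i (n - (#S + 2) + j))
        (insert x (insert y S)) :=
    flagMinor_eq M (by rw [card_insert_of_notMem (by simp [hx, hxy.ne]), card_insert_of_notMem hy])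
  rw [h1 ha, h1 hb, h1 hc, h2 hb hc hbc, h2 ha hb hab, h2 ha hc (hab.trans hbc)]
  linear_combination hP

/-- The cross ratio of flag minors attached to rows `S` and three further rows. -/
noncomputable def flagRatio (M : Matrix (Fin n) (Fin n) ℝ) (S : Finset ℕ) (a b c : ℕ) : ℝ :=
  (flagMinor M (insert a S) * flagMinor M (insert b (insert c S))) /
    (flagMinor M (insert a (insert b S)) * flagMinor M (insert c S))

/-- A totally positive matrix with binomial entries. -/
noncomputable def binomMatrix (n : ℕ) : Matrix (Fin n) (Fin n) ℝ :=
  of fun i j => ((n - 1 - i).choose (n - 1 - j) : ℝ)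

lemma binomMatrix_mem_unipotentUpper : binomMatrix n ∈ unipotentUpper n := by
  refine ⟨fun i => by simp [binomMatrix], fun i j hij => ?_⟩
  have hij : (j : ℕ) < i := hij
  rw [binomMatrix, of_apply, Nat.choose_eq_zero_of_lt (by omega), Nat.cast_zero]

/-- Up to the factor `j!`, `x.choose j` is a monic polynomial of degree `j` in `x`, so column
operations reduce the determinant to a Vandermonde determinant. -/
lemma det_choose_mul {k : ℕ} (v : Fin k → ℕ) :
    det (of fun i j : Fin k => ((v i).choose j : ℝ)) * ∏ j : Fin k, (Nat.factorial j : ℝ)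
      = diffProd v := by
  have h := det_eval_matrixOfPolynomials_eq_det_vandermonde (fun i => (v i : ℝ))
      (fun j : Fin k => descPochhammer ℝ j)
      (fun i => descPochhammer_natDegree ℝ i) (fun i => monic_descPochhammer ℝ i)
  rw [diffProd_eq_det, h, mul_comm, ← det_mul_row]
  congr 1
  ext i j
  simp only [of_apply]
  rw [descPochhammer_eval_eq_descFactorial, Nat.descFactorial_eq_factorial_mul_choose]
  push_cast
  rfl

lemma diffProd_rev {k : ℕ} {f g : Fin k → ℕ} {N : ℕ} (h : ∀ i, f i + g i.rev = N) :
    diffProd g = diffProd f := by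
  rw [diffProd, diffProd, prod_comm, ← Equiv.prod_comp Fin.revPerm]
  refine prod_congr rfl fun i _ => ?_
  rw [← Equiv.prod_comp Fin.revPerm]
  refine prod_congr rfl fun j _ => ?_
  simp only [Fin.revPerm_apply, Fin.rev_lt_rev]
  split_ifs
  · have h1 : (f i : ℝ) + g i.rev = N := by exact_mod_cast h i
    have h2 : (f j : ℝ) + g j.rev = N := by exact_mod_cast h j
    linarith
  · rfl

/-- In row `i` the last `k` columns contain `(n - 1 - i).choose` of `k - 1, …, 0`. Reversing rows
and columns gives the determinant of `det_choose_mul` at the points `n - 1 - i`, whose differences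
are those of the row labels. -/
lemma flagMinor_binomMatrix_mul {I : Finset ℕ} {k : ℕ} (hk : #I = k) (hI : I ⊆ range n) :
    flagMinor (binomMatrix n) I * ∏ j : Fin k, (Nat.factorial j : ℝ)
      = sortedMinor (fun i (j : Fin k) => (i : ℝ) ^ (j : ℕ)) I := by
  subst hk
  obtain ⟨s, hs, hsI⟩ := exists_strictMono_image I
  have hlt : ∀ i, s i < n := fun i => mem_range.1 (hI (hsI ▸ mem_image_of_mem s (mem_univ i)))
  have hk := card_le_of_strictMono hs hlt
  generalize #I = k at s hs hsI hlt hk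
  subst hsI
  rw [flagMinor_image _ hs, sortedMinor_image _ hs]
  have hV : det (of fun i j : Fin k => (s i : ℝ) ^ (j : ℕ)) = diffProd s := by
    rw [diffProd_eq_det]
    rfl
  rw [hV, ← diffProd_rev (f := s) (g := fun i => n - 1 - s i.rev) (N := n - 1)
    (fun i => by have := hlt i; simp only [Fin.rev_rev]; omega), ← det_choose_mul,
    ← det_submatrix_equiv_self Fin.revPerm]
  congr 2
  ext i j
  simp only [submatrix_apply, of_apply, Fin.revPerm_apply]
  have hj : n - k + (j.rev : ℕ) < n := by have := j.rev.isLt; omega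
  rw [entry, dif_pos ⟨hlt _, hj⟩, binomMatrix, of_apply]
  congr 2
  simp only [Fin.val_rev]
  have := j.isLt
  omega

lemma sortedMinor_pow_insert {k : ℕ} {s : Fin k → ℕ} (hs : StrictMono s)
    {a : ℕ} (ha : a ∉ univ.image s) :
    sortedMinor (fun i (j : Fin (k + 1)) => (i : ℝ) ^ (j : ℕ)) (insert a (univ.image s))
      = diffProd s * |diffTo (univ.image s) a| := by
  have h := sortedMinor_insert (fun i (j : Fin (k + 1)) => (i : ℝ) ^ (j : ℕ)) hs ha
  have h2 : det (of fun i j : Fin (k + 1) => ((Fin.snoc s a : Fin (k + 1) → ℕ) i : ℝ) ^ (j : ℕ))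
      = diffProd s * diffTo (univ.image s) a := by
    rw [diffTo, prod_image fun i _ j _ h => hs.injective h, ← diffProd_snoc, diffProd_eq_det]
    rfl
  rw [h2] at h
  apply mul_right_cancel₀ (abs_ne_zero.2 (diffTo_ne_zero ha))
  rw [h, mul_assoc, mul_assoc, abs_mul_abs_self]

lemma sortedMinor_pow_insert₂ {k : ℕ} {s : Fin k → ℕ} (hs : StrictMono s)
    {a b : ℕ} (ha : a ∉ univ.image s) (hb : b ∉ univ.image s) (hab : a < b) :
    sortedMinor (fun i (j : Fin (k + 2)) => (i : ℝ) ^ (j : ℕ)) (insert a (insert b (univ.image s)))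
      = diffProd s * |diffTo (univ.image s) a| * |diffTo (univ.image s) b| * (b - a) := by
  have h := sortedMinor_insert₂ (fun i (j : Fin (k + 2)) => (i : ℝ) ^ (j : ℕ)) hs ha hb hab
  have h2 : det (of fun i j : Fin (k + 2) => ((Fin.snoc (Fin.snoc s a : Fin (k + 1) → ℕ) b :
      Fin (k + 2) → ℕ) i : ℝ) ^ (j : ℕ))
      = diffProd s * diffTo (univ.image s) a * diffTo (univ.image s) b * (b - a) := by
    have hd (x : ℕ) : diffTo (univ.image s) x = ∏ i, ((x : ℝ) - s i) := by
      rw [diffTo, prod_image fun i _ j _ h => hs.injective h]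
    have h3 : diffProd (Fin.snoc (Fin.snoc s a : Fin (k + 1) → ℕ) b : Fin (k + 2) → ℕ)
        = diffProd s * diffTo (univ.image s) a * diffTo (univ.image s) b * (b - a) := by
      rw [diffProd_snoc, diffProd_snoc, Fin.prod_univ_castSucc, hd, hd]
      simp [mul_assoc]
    rw [← h3, diffProd_eq_det]
    rfl
  rw [h2] at h
  apply mul_right_cancel₀ (mul_ne_zero (abs_ne_zero.2 (diffTo_ne_zero ha))
    (abs_ne_zero.2 (diffTo_ne_zero hb)))
  rw [h]
  have e1 := abs_mul_abs_self (diffTo (univ.image s) a)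
  have e2 := abs_mul_abs_self (diffTo (univ.image s) b)
  set x := |diffTo (univ.image s) a|
  set y := |diffTo (univ.image s) b|
  set u := diffTo (univ.image s) a
  set v := diffTo (univ.image s) b
  linear_combination -(diffProd s * (b - a)) * (y * y) * e1 - (diffProd s * (b - a)) * u * u * e2

lemma binomMatrix_mem : binomMatrix n ∈ totallyPositive n := by
  refine mem_totallyPositive_of_flagMinor_pos binomMatrix_mem_unipotentUpper fun I hI => ?_
  have h := flagMinor_binomMatrix_mul rfl hI
  obtain ⟨s, hs, hsI⟩ := exists_strictMono_image I
  have hpos : 0 < sortedMinor (fun i (j : Fin #I) => (i : ℝ) ^ (j : ℕ)) I := by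
    conv => enter [2, 2]; rw [← hsI]
    rw [sortedMinor_image _ hs]
    have := diffProd_pos hs
    rw [diffProd_eq_det] at this
    exact this
  rw [← h] at hpos
  exact pos_of_mul_pos_left hpos (prod_nonneg fun i _ => Nat.cast_nonneg _)

/-- All factors involving `S` cancel. The independence of `S` is what makes the two sums coincide
term by term at this matrix. -/
lemma flagRatio_binomMatrix {S : Finset ℕ} (hS : S ⊆ range n) {a b c : ℕ} (ha : a ∉ S)
    (hb : b ∉ S) (hc : c ∉ S) (hab : a < b) (hbc : b < c) (hcn : c < n) :
    flagRatio (binomMatrix n) S a b c = ((c : ℝ) - b) / (b - a) := by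
  obtain ⟨s, hs, hsS⟩ := exists_strictMono_image S
  have hsub1 {x : ℕ} (hx : x < n) : insert x S ⊆ range n :=
    insert_subset (mem_range.2 hx) hS
  have hsub2 {x y : ℕ} (hx : x < n) (hy : y < n) : insert x (insert y S) ⊆ range n :=
    insert_subset (mem_range.2 hx) (hsub1 hy)
  have h1 {x : ℕ} (hx : x ∉ S) (hxn : x < n) : flagMinor (binomMatrix n) (insert x S)
      * ∏ j : Fin (#S + 1), (Nat.factorial j : ℝ) = diffProd s * |diffTo S x| := by
    rw [flagMinor_binomMatrix_mul (card_insert_of_notMem hx) (hsub1 hxn)]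
    have := sortedMinor_pow_insert hs (a := x) (by rwa [hsS])
    rwa [hsS] at this
  have h2 {x y : ℕ} (hx : x ∉ S) (hy : y ∉ S) (hxy : x < y) (hyn : y < n) :
      flagMinor (binomMatrix n) (insert x (insert y S))
      * ∏ j : Fin (#S + 2), (Nat.factorial j : ℝ)
      = diffProd s * |diffTo S x| * |diffTo S y| * (y - x) := by
    rw [flagMinor_binomMatrix_mul (by
      rw [card_insert_of_notMem (by simp [hx, hxy.ne]), card_insert_of_notMem hy])
      (hsub2 (hxy.trans hyn) hyn)]
    have := sortedMinor_pow_insert₂ hs (a := x) (b := y) (by rwa [hsS]) (by rwa [hsS]) hxy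
    rwa [hsS] at this
  have hV := diffProd_pos hs
  have na := abs_pos.2 (diffTo_ne_zero ha)
  have nb := abs_pos.2 (diffTo_ne_zero hb)
  have nc := abs_pos.2 (diffTo_ne_zero hc)
  have hp1 : 0 < ∏ j : Fin (#S + 1), (Nat.factorial j : ℝ) :=
    prod_pos fun i _ => Nat.cast_pos.2 (Nat.factorial_pos _)
  have hp2 : 0 < ∏ j : Fin (#S + 2), (Nat.factorial j : ℝ) :=
    prod_pos fun i _ => Nat.cast_pos.2 (Nat.factorial_pos _)
  have hba : (0 : ℝ) < b - a := sub_pos.2 (Nat.cast_lt.2 hab)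
  have e1 := eq_div_of_mul_eq hp1.ne' (h1 ha (by omega))
  have e2 := eq_div_of_mul_eq hp1.ne' (h1 hc hcn)
  have e3 := eq_div_of_mul_eq hp2.ne' (h2 hb hc hbc hcn)
  have e4 := eq_div_of_mul_eq hp2.ne' (h2 ha hb hab (by omega))
  rw [flagRatio, e1, e2, e3, e4]
  field_simp

/-! ### Products of totally positive matrices and paths of totally positive matrices -/

/-- The Cauchy-Binet formula, symmetrized over all choices of columns. -/
lemma factorial_mul_det_mul {k : ℕ} (A : Matrix (Fin k) (Fin n) ℝ) (B : Matrix (Fin n) (Fin k) ℝ) :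
    (k.factorial : ℝ) * det (A * B)
      = ∑ p : Fin k → Fin n, det (A.submatrix id p) * det (B.submatrix p id) := by
  have h1 : det (A * B) = ∑ p : Fin k → Fin n, det (A.submatrix id p) * ∏ i, B (p i) i := by
    simp only [det_apply', mul_apply, prod_univ_sum, mul_sum, Fintype.piFinset_univ]
    rw [sum_comm]
    refine sum_congr rfl fun p _ => ?_
    rw [sum_mul]
    refine sum_congr rfl fun σ _ => ?_
    rw [prod_mul_distrib, mul_assoc]
    rfl
  -- Relabelling `p` by `τ` leaves the sum unchanged; summing over all `τ` assembles the products of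
  -- entries of `B` into a second determinant, at the price of the factor `k!`.
  have h2 (τ : Equiv.Perm (Fin k)) : det (A * B) = ∑ p : Fin k → Fin n,
      det (A.submatrix id p) * (((Equiv.Perm.sign τ : ℤ) : ℝ) * ∏ i, B (p (τ i)) i) := by
    rw [h1, ← Equiv.sum_comp (Equiv.arrowCongr τ.symm (Equiv.refl (Fin n)))]
    refine sum_congr rfl fun p _ => ?_
    have : A.submatrix id ((Equiv.arrowCongr τ.symm (Equiv.refl (Fin n))) p)
        = (A.submatrix id p).submatrix id τ := by
      ext i j
      simp
    rw [this, det_permute']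
    simp only [Equiv.arrowCongr_apply, Equiv.symm_symm, Equiv.coe_refl, Function.comp_apply, id]
    ring
  have h3 : ∑ _τ : Equiv.Perm (Fin k), det (A * B) = (k.factorial : ℝ) * det (A * B) := by
    rw [sum_const, card_univ, Fintype.card_perm, Fintype.card_fin, nsmul_eq_mul]
  rw [← h3, sum_congr rfl fun τ _ => h2 τ, sum_comm]
  refine sum_congr rfl fun p _ => ?_
  rw [← mul_sum]
  congr 1
  rw [det_apply']
  rfl

lemma det_submatrix_nonneg {M : Matrix (Fin n) (Fin n) ℝ} (hM : M ∈ totallyPositive n) {k : ℕ}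
    {r c : Fin k → Fin n} (hr : StrictMono r) (hc : StrictMono c) :
    0 ≤ det (M.submatrix r c) := by
  rw [entry_submatrix]
  exact det_nonneg hM (fun _ _ h => hr h) (fun _ _ h => hc h) fun i => (c i).isLt

lemma det_submatrix_pos {M : Matrix (Fin n) (Fin n) ℝ} (hM : M ∈ totallyPositive n) {k : ℕ}
    {r c : Fin k → Fin n} (hr : StrictMono r) (hc : StrictMono c) (h : ∀ i, r i ≤ c i) :
    0 < det (M.submatrix r c) := by
  rw [entry_submatrix]
  exact det_pos_of_le hM (fun _ _ h => hr h) (fun _ _ h => hc h) h fun i => (c i).isLt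

lemma unipotentUpper_mul {M N : Matrix (Fin n) (Fin n) ℝ} (hM : M ∈ unipotentUpper n)
    (hN : N ∈ unipotentUpper n) : M * N ∈ unipotentUpper n := by
  constructor
  · intro i
    rw [mul_apply, sum_eq_single i, hM.1, hN.1, one_mul]
    · intro j _ hj
      rcases lt_or_gt_of_ne hj with h | h
      · rw [hM.2 _ _ h, zero_mul]
      · rw [hN.2 _ _ h, mul_zero]
    · simp
  · intro i j hij
    rw [mul_apply]
    refine sum_eq_zero fun l _ => ?_
    rcases lt_or_ge l i with h | h
    · rw [hM.2 _ _ h, zero_mul]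
    · rw [hN.2 _ _ (hij.trans_le h), mul_zero]

/-- In the Cauchy-Binet sum every injective `p` contributes a product of two minors whose sorting
signs cancel, hence a nonnegative number; a noninjective `p` contributes zero. The choice `p = r'`
gives a principal minor of `M` times the corresponding minor of `N`, both positive. -/
theorem totallyPositive_mul {M N : Matrix (Fin n) (Fin n) ℝ} (hM : M ∈ totallyPositive n)
    (hN : N ∈ totallyPositive n) : M * N ∈ totallyPositive n := by
  refine mem_totallyPositive (unipotentUpper_mul hM.1 hN.1) fun k r c hr hc hle hn => ?_
  set r' : Fin k → Fin n := fun i => ⟨r i, (hle i).trans_lt (hn i)⟩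
  set c' : Fin k → Fin n := fun i => ⟨c i, hn i⟩
  have hr' : StrictMono r' := fun _ _ h => hr h
  have hc' : StrictMono c' := fun _ _ h => hc h
  have hsub : (of fun i j => entry (M * N) (r i) (c j)) = M.submatrix r' id * N.submatrix id c' := by
    rw [← submatrix_mul _ _ r' id c' Function.bijective_id, entry_submatrix]
  rw [hsub]
  refine pos_of_mul_pos_right ?_ (Nat.cast_nonneg (α := ℝ) k.factorial)
  rw [factorial_mul_det_mul]
  refine sum_pos' (fun p _ => ?_) ⟨r', mem_univ _, mul_pos ?_ ?_⟩
  · by_cases hp : Function.Injective p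
    · have hmono : StrictMono (p ∘ Tuple.sort p) :=
        (Tuple.monotone_sort p).strictMono_of_injective (hp.comp (Tuple.sort p).injective)
      have h1 : det (M.submatrix r' (p ∘ Tuple.sort p)) = ((Equiv.Perm.sign (Tuple.sort p) : ℤ) : ℝ)
          * det ((M.submatrix r' id).submatrix id p) := by
        rw [← det_permute']
        rfl
      have h2 : det (N.submatrix (p ∘ Tuple.sort p) c') = ((Equiv.Perm.sign (Tuple.sort p) : ℤ) : ℝ)
          * det ((N.submatrix id c').submatrix p id) := by
        rw [← det_permute]
        rfl
      have h3 := mul_nonneg (det_submatrix_nonneg hM hr' hmono) (det_submatrix_nonneg hN hmono hc')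
      rw [h1, h2] at h3
      have hs : ((Equiv.Perm.sign (Tuple.sort p) : ℤ) : ℝ) *
          ((Equiv.Perm.sign (Tuple.sort p) : ℤ) : ℝ) = 1 := by
        rcases Int.units_eq_one_or (Equiv.Perm.sign (Tuple.sort p)) with h | h <;> simp [h]
      rw [mul_mul_mul_comm, hs, one_mul] at h3
      exact h3
    · rw [Function.Injective] at hp
      push Not at hp
      obtain ⟨i, j, hij, hne⟩ := hp
      rw [det_zero_of_column_eq hne (fun l => by simp [hij]), zero_mul]
  · exact det_submatrix_pos hM hr' hr' fun i => le_rfl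
  · exact det_submatrix_pos hN hr' hc' hle

/-- The conjugate of `M` by the diagonal matrix with entries `t ^ (-i)`. -/
noncomputable def scaleBy (t : ℝ) (M : Matrix (Fin n) (Fin n) ℝ) : Matrix (Fin n) (Fin n) ℝ :=
  of fun i j => t ^ ((j : ℕ) - i) * M i j

lemma scaleBy_one (M : Matrix (Fin n) (Fin n) ℝ) : scaleBy 1 M = M := by
  ext i j
  simp [scaleBy]

/-- The exponent `j - i` and the convention `0 ^ 0 = 1` let the conjugation degenerate to the
identity at `t = 0`, where the conjugating matrix itself would be singular or undefined. -/
lemma scaleBy_zero {M : Matrix (Fin n) (Fin n) ℝ} (hM : M ∈ unipotentUpper n) :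
    scaleBy 0 M = 1 := by
  ext i j
  rw [scaleBy, of_apply]
  rcases lt_trichotomy i j with h | rfl | h
  · have h' : (i : ℕ) < j := h
    rw [one_apply_ne h.ne, zero_pow (by omega), zero_mul]
  · rw [one_apply_eq, hM.1, Nat.sub_self, pow_zero, one_mul]
  · rw [one_apply_ne h.ne', hM.2 _ _ h, mul_zero]

lemma scaleBy_mem {t : ℝ} (ht : 0 < t) {M : Matrix (Fin n) (Fin n) ℝ}
    (hM : M ∈ totallyPositive n) : scaleBy t M ∈ totallyPositive n := by
  refine mem_totallyPositive ⟨fun i => ?_, fun i j hij => ?_⟩ fun k r c hr hc hle hn => ?_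
  · simp [scaleBy, hM.1.1]
  · simp [scaleBy, hM.1.2 i j hij]
  · have h := det_pos_of_le hM hr hc hle hn
    -- Scaling the rows by `t ^ r i` amounts to scaling the columns of the original minor by `t ^ c
    -- j`. The truncated subtraction in `scaleBy` matters only below the diagonal, where the entries
    -- vanish.
    have h1 : det (of fun i j => t ^ r i * (of fun i j => entry (scaleBy t M) (r i) (c j)) i j)
        = det (of fun i j => t ^ c j * (of fun i j => entry M (r i) (c j)) i j) := by
      congr 1
      ext i j
      have hr' : r i < n := (hle i).trans_lt (hn i)
      simp only [of_apply]
      rcases lt_or_ge (c j) (r i) with hlt | hge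
      · rw [entry_of_lt hM.1 hlt, entry, dif_pos ⟨hr', hn j⟩, scaleBy, of_apply,
          hM.1.2 _ _ hlt]
        simp
      · rw [entry, dif_pos ⟨hr', hn j⟩, entry, dif_pos ⟨hr', hn j⟩, scaleBy, of_apply, ← mul_assoc,
          ← pow_add]
        congr 2
        simp only
        omega
    rw [det_mul_column, det_mul_row] at h1
    refine pos_of_mul_pos_right (a := ∏ i, t ^ r i) ?_ (prod_nonneg fun i _ => (pow_pos ht _).le)
    rw [h1]
    exact mul_pos (prod_pos fun i _ => pow_pos ht _) h

/-- A polynomial path from `M` to `N`. -/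
noncomputable def pathBetween (M N : Matrix (Fin n) (Fin n) ℝ) (t : ℝ) :
    Matrix (Fin n) (Fin n) ℝ := scaleBy (1 - t) M * scaleBy t N

lemma pathBetween_zero (M : Matrix (Fin n) (Fin n) ℝ) {N : Matrix (Fin n) (Fin n) ℝ}
    (hN : N ∈ unipotentUpper n) : pathBetween M N 0 = M := by
  rw [pathBetween, sub_zero, scaleBy_one, scaleBy_zero hN, mul_one]

lemma pathBetween_one {M : Matrix (Fin n) (Fin n) ℝ} (hM : M ∈ unipotentUpper n)
    (N : Matrix (Fin n) (Fin n) ℝ) : pathBetween M N 1 = N := by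
  rw [pathBetween, sub_self, scaleBy_one, scaleBy_zero hM, one_mul]

/-- Inside the interval both factors are totally positive. The endpoints are separate because one
factor becomes the identity there. -/
lemma pathBetween_mem {M N : Matrix (Fin n) (Fin n) ℝ} (hM : M ∈ totallyPositive n)
    (hN : N ∈ totallyPositive n) {t : ℝ} (ht : t ∈ Set.Icc (0 : ℝ) 1) :
    pathBetween M N t ∈ totallyPositive n := by
  rcases ht.1.eq_or_lt with rfl | h0
  · rwa [pathBetween_zero M hN.1]
  rcases ht.2.eq_or_lt with rfl | h1
  · rwa [pathBetween_one hM.1]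
  · exact totallyPositive_mul (scaleBy_mem (sub_pos.2 h1) hM) (scaleBy_mem h0 hN)

lemma differentiable_entry_pathBetween (M N : Matrix (Fin n) (Fin n) ℝ) (i j : ℕ) :
    Differentiable ℝ fun t => entry (pathBetween M N t) i j := by
  unfold entry
  split_ifs with h
  · simp only [pathBetween, mul_apply, scaleBy, of_apply]
    fun_prop
  · fun_prop

lemma differentiable_flagMinor_pathBetween (M N : Matrix (Fin n) (Fin n) ℝ) (I : Finset ℕ) :
    Differentiable ℝ fun t => flagMinor (pathBetween M N t) I := by
  have h := differentiable_entry_pathBetween M N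
  simp only [flagMinor, sortedMinor, dite_true, det_apply', of_apply]
  refine Differentiable.fun_sum fun σ _ => (differentiable_const _).mul ?_
  exact Differentiable.fun_finsetProd fun i _ => h _ _

end

/-! ### The derivative of the dilogarithm -/

/-- Termwise differentiation on `(-r, r)` with `x < r < 1`, dominated by the geometric series; the
differentiated series is that of the logarithm. -/
lemma hasDerivAt_Li2 {x : ℝ} (h0 : 0 < x) (h1 : x < 1) :
    HasDerivAt Li2 (-Real.log (1 - x) / x) x := by
  obtain ⟨r, hxr, hr1⟩ := exists_between h1
  have hr0 : 0 < r := h0.trans hxr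
  have hx : x ∈ Set.Ioo (-r) r := ⟨by linarith, hxr⟩
  have h := hasDerivAt_tsum_of_isPreconnected (u := fun k : ℕ => r ^ k) (t := Set.Ioo (-r) r)
    (g := fun (k : ℕ) (y : ℝ) => y ^ (k + 1) / ((k : ℝ) + 1) ^ 2)
    (g' := fun (k : ℕ) (y : ℝ) => y ^ k / ((k : ℝ) + 1)) (y₀ := 0) (y := x)
    (summable_geometric_of_lt_one hr0.le hr1) isOpen_Ioo isPreconnected_Ioo
    (fun k y _ => by
      have hk : ((k : ℝ) + 1) ≠ 0 := by positivity
      convert! (hasDerivAt_pow (k + 1) y).div_const (((k : ℝ) + 1) ^ 2) using 1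
      simp only [Nat.add_sub_cancel]
      push_cast
      field_simp)
    (fun k y hy => by
      have hk : (1 : ℝ) ≤ (k : ℝ) + 1 := by linarith [Nat.cast_nonneg (α := ℝ) k]
      rw [norm_div, norm_pow, Real.norm_eq_abs, Real.norm_eq_abs, abs_of_pos (a := (k : ℝ) + 1) (by linarith)]
      exact (div_le_self (by positivity) hk).trans
        (pow_le_pow_left₀ (abs_nonneg _) (abs_le.2 ⟨hy.1.le, hy.2.le⟩) _))
    ⟨by linarith, hr0⟩ (by simp) hx
  have hs := Real.hasSum_pow_div_log_of_abs_lt_one (x := x) (by rw [abs_of_pos h0]; exact h1)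
  have hs2 : ∑' k : ℕ, x ^ k / ((k : ℝ) + 1) = -Real.log (1 - x) / x := by
    rw [← hs.tsum_eq, ← tsum_div_const]
    refine tsum_congr fun k => ?_
    have hk : ((k : ℝ) + 1) ≠ 0 := by positivity
    field_simp
    exact (pow_succ x k).symm
  rw [← hs2]
  exact h

lemma hasDerivAt_rogersL {x : ℝ} (h0 : 0 < x) (h1 : x < 1) :
    HasDerivAt rogersL (-(1 / 2) * (Real.log (1 - x) / x + Real.log x / (1 - x))) x := by
  have hl := (Real.hasDerivAt_log h0.ne')
  have hm : HasDerivAt (fun y : ℝ => Real.log (1 - y)) (-1 / (1 - x)) x := by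
    have : HasDerivAt (fun y : ℝ => 1 - y) (-1) x := by
      simpa using (hasDerivAt_id x).const_sub 1
    exact this.log (by linarith)
  convert! (hasDerivAt_Li2 h0 h1).add ((hl.const_mul (1 / 2)).mul hm) using 1
  have : 1 - x ≠ 0 := by linarith
  have := h0.ne'
  field_simp
  ring

/-- After the substitution `x / (1 + x)` the differential is a multiple of `log (1 + x) dlog x - log
x dlog (1 + x)`, an exterior product of logarithmic jets. -/
lemma hasDerivAt_ell {x : ℝ} (h0 : 0 < x) :
    HasDerivAt ell (3 / Real.pi ^ 2 * (Real.log (1 + x) / x - Real.log x / (1 + x))) x := by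
  have h1 : 0 < 1 + x := by linarith
  have hu0 : 0 < x / (1 + x) := by positivity
  have hu1 : x / (1 + x) < 1 := (div_lt_one h1).2 (by linarith)
  have hu : HasDerivAt (fun y : ℝ => y / (1 + y)) ((1 * (1 + x) - x * 1) / (1 + x) ^ 2) x :=
    (hasDerivAt_id x).div ((hasDerivAt_id x).const_add 1) h1.ne'
  have h := (((hasDerivAt_rogersL hu0 hu1).comp x hu).const_mul (6 / Real.pi ^ 2))
  convert! h using 1
  have e1 : 1 - x / (1 + x) = (1 + x)⁻¹ := by field_simp; ring
  rw [e1, Real.log_inv, Real.log_div h0.ne' h1.ne']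
  have := Real.pi_ne_zero
  field_simp
  ring

/-- `ell x + ell x⁻¹` does not depend on `x`. -/
lemma ell_inv {x : ℝ} (h0 : 0 < x) : ell x⁻¹ = 2 * ell 1 - ell x := by
  have hd : ∀ y ∈ Set.Ioi (0 : ℝ), HasDerivAt (fun y => ell y + ell y⁻¹) 0 y := fun y hy => by
    have hy : 0 < y := hy
    have h := (hasDerivAt_ell hy).add
      ((hasDerivAt_ell (inv_pos.2 hy)).comp y (hasDerivAt_inv hy.ne'))
    convert! h using 1
    have h1 : 0 < 1 + y := by linarith
    have e1 : 1 + y⁻¹ = (1 + y) / y := by field_simp; ring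
    rw [e1, Real.log_div h1.ne' hy.ne', Real.log_inv]
    field_simp
    ring
  have hc := (convex_Ioi (0 : ℝ)).is_const_of_fderivWithin_eq_zero (𝕜 := ℝ)
    (f := fun y => ell y + ell y⁻¹)
    (fun y hy => (hd y hy).differentiableAt.differentiableWithinAt)
    (fun y hy => by
      rw [fderivWithin_of_isOpen isOpen_Ioi hy]
      ext
      simp [(hd y hy).hasFDerivAt.fderiv]) (x := x) (y := 1) h0 (Set.mem_Ioi.2 one_pos)
  simp only [inv_one] at hc
  linarith

/-- The exterior product of two logarithmic jets `(value, derivative)`. -/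
def wedge (u v : ℝ × ℝ) : ℝ := u.1 * v.2 - u.2 * v.1

/-- The cyclic sum of exterior products. -/
def tri (u v w : ℝ × ℝ) : ℝ := wedge u v + wedge v w + wedge w u

/-- The logarithmic jet of a function with value `x` and derivative `x'`. -/
noncomputable def logJet (x x' : ℝ) : ℝ × ℝ := (Real.log x, x' / x)

lemma logJet_mul {x y x' y' : ℝ} (hx : 0 < x) (hy : 0 < y) :
    logJet (x * y) (x' * y + x * y') = logJet x x' + logJet y y' := by
  ext
  · exact Real.log_mul hx.ne' hy.ne'
  · simp only [logJet, Prod.snd_add]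
    field_simp

/-- Since `log (1 + f / g) = log (f + g) - log g`, the exterior product becomes cyclic in `f`, `g`,
`f + g`. Once a Plücker relation writes `f + g` as a product, the derivative is bilinear in the jets
of flag minors. -/
lemma hasDerivAt_ell_div {f g : ℝ → ℝ} {f' g' t : ℝ} (hf : HasDerivAt f f' t)
    (hg : HasDerivAt g g' t) (hf0 : 0 < f t) (hg0 : 0 < g t) :
    HasDerivAt (fun s => ell (f s / g s))
      (3 / Real.pi ^ 2 * tri (logJet (f t) f') (logJet (g t) g')
        (logJet (f t + g t) (f' + g'))) t := by
  have h := (hasDerivAt_ell (div_pos hf0 hg0)).comp t (hf.div hg hg0.ne')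
  convert! h using 1
  have e1 : 1 + f t / g t = (f t + g t) / g t := by field_simp; ring
  have hfg : 0 < f t + g t := by linarith
  simp only [tri, wedge, logJet]
  rw [e1, Real.log_div hfg.ne' hg0.ne', Real.log_div hf0.ne' hg0.ne']
  field_simp
  ring

/-! ### Telescoping sums over the discrete tetrahedron -/

lemma wedge_zero_left (u : ℝ × ℝ) : wedge 0 u = 0 := by simp [wedge]

lemma wedge_zero_right (u : ℝ × ℝ) : wedge u 0 = 0 := by simp [wedge]

lemma wedge_self (u : ℝ × ℝ) : wedge u u = 0 := by simp only [wedge]; ring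

lemma wedge_swap (u v : ℝ × ℝ) : wedge u v = -wedge v u := by simp only [wedge]; ring

/-- This lemma and the next two telescope a difference over the triangle `i < j < m` in its three
directions; the vanishing hypotheses remove boundary terms. -/
lemma sum_triangle_sub_right (g : ℕ → ℕ → ℝ) (hg : ∀ i, g i (i + 1) = 0) (m : ℕ) :
    ∑ j ∈ range m, ∑ i ∈ range j, (g i j - g i (j + 1)) = -∑ i ∈ range m, g i m := by
  induction m with
  | zero => simp
  | succ m ih =>
    rw [sum_range_succ, ih, sum_sub_distrib, sum_range_succ _ m, hg]
    ring

lemma sum_triangle_sub_diag (g : ℕ → ℕ → ℝ) (hg : g 0 0 = 0) (m : ℕ) :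
    ∑ j ∈ range m, ∑ i ∈ range j, (g i j - g (i + 1) (j + 1))
      = ∑ j ∈ range (m + 1), g 0 j - ∑ i ∈ range m, g i m := by
  induction m with
  | zero => simp [hg]
  | succ m ih =>
    rw [sum_range_succ, ih, sum_sub_distrib, sum_range_succ _ (m + 1),
      sum_range_succ' (fun i => g i (m + 1)) m]
    ring

lemma sum_triangle_sub_left (g : ℕ → ℕ → ℝ) (hg : ∀ i, g i i = 0) (m : ℕ) :
    ∑ j ∈ range m, ∑ i ∈ range j, (g (i + 1) j - g i j) = -∑ j ∈ range m, g 0 j := by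
  rw [← sum_neg_distrib]
  refine sum_congr rfl fun j _ => ?_
  rw [sum_range_sub (fun i => g i j), hg, zero_sub]

/-- The exterior form attached to an octahedron. -/
noncomputable def octForm (h : ℕ → ℕ → ℕ → ℝ × ℝ) (i j k : ℕ) : ℝ :=
  tri (h i j (k + 1) + h (i + 1) (j + 1) k) (h i (j + 1) (k + 1) + h (i + 1) j k)
    (h i j k + h (i + 1) (j + 1) (k + 1))

/-- The exterior form attached to a triangular face. -/
noncomputable def faceForm (f : ℕ → ℕ → ℝ × ℝ) (m : ℕ) : ℝ :=
  ∑ j ∈ range m, ∑ i ∈ range j, wedge (f i j) (f i (j + 1) + f (i + 1) j - f (i + 1) (j + 1))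

lemma faceForm_eq (f : ℕ → ℕ → ℝ × ℝ) (m : ℕ) :
    faceForm f m = ∑ j ∈ range m, ∑ i ∈ range j, wedge (f i j) (f i (j + 1))
      + ∑ j ∈ range m, ∑ i ∈ range j, wedge (f i j) (f (i + 1) j)
      - ∑ j ∈ range m, ∑ i ∈ range j, wedge (f i j) (f (i + 1) (j + 1)) := by
  rw [faceForm, ← sum_add_distrib, ← sum_sub_distrib]
  refine sum_congr rfl fun j _ => ?_
  rw [← sum_add_distrib, ← sum_sub_distrib]
  refine sum_congr rfl fun i _ => ?_
  simp [wedge]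
  ring

/-- One layer of octahedra: wedges of translated edges cancel between neighbours, leaving the change
of the face form from level `m` to level `m + 1` and a strip of the face `i = 0`. The faces `i = j`
and `j = k` contribute nothing because the jets vanish there. -/
lemma sum_layer_octForm {h : ℕ → ℕ → ℕ → ℝ × ℝ} {m : ℕ} (h1 : ∀ i k, h i i k = 0)
    (h2 : ∀ i j, i ≤ j → j ≤ m + 1 → h i j j = 0) :
    ∑ j ∈ range m, ∑ i ∈ range j, octForm h i j m
      = faceForm (fun i j => h i j (m + 1)) (m + 1) - faceForm (fun i j => h i j m) m
        + ∑ j ∈ range m, wedge (h 0 j m)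
          (h 0 j (m + 1) + h 0 (j + 1) m - h 0 (j + 1) (m + 1)) := by
  -- The twelve edges of the octahedron, grouped into differences of translates; the edge `wedge (h
  -- i j m) (h i (j + 1) m)` is subtracted and added once to make the first two brackets telescope.
  have hoct (i j : ℕ) : octForm h i j m
      = (wedge (h i j (m + 1)) (h i (j + 1) (m + 1)) - wedge (h i j m) (h i (j + 1) m))
      - (wedge (h (i + 1) j m) (h (i + 1) (j + 1) m) - wedge (h i j m) (h i (j + 1) m))
      + (wedge (h i j (m + 1)) (h (i + 1) j m)
        - wedge (h i (j + 1) (m + 1)) (h (i + 1) (j + 1) m))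
      + (wedge (h i (j + 1) (m + 1)) (h (i + 1) (j + 1) (m + 1)) - wedge (h i j m) (h (i + 1) j m))
      + (wedge (h (i + 1) j m) (h (i + 1) (j + 1) (m + 1)) - wedge (h i j m) (h i (j + 1) (m + 1)))
      + (wedge (h i j m) (h i j (m + 1))
        - wedge (h (i + 1) (j + 1) m) (h (i + 1) (j + 1) (m + 1)))
      - (wedge (h i j (m + 1)) (h (i + 1) (j + 1) (m + 1))
        - wedge (h i j m) (h (i + 1) (j + 1) m)) := by
    simp only [octForm, tri, wedge, Prod.fst_add, Prod.snd_add]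
    ring
  simp only [hoct]
  have t1 := sum_triangle_sub_left (fun i j => wedge (h i j m) (h i (j + 1) m))
    (fun i => by simp only [h1, wedge_zero_left]) m
  have t2 := sum_triangle_sub_right (fun i j => wedge (h i j (m + 1)) (h (i + 1) j m))
    (fun i => by simp only [h1, wedge_zero_right]) m
  have t2' : ∑ i ∈ range m, wedge (h i m (m + 1)) (h (i + 1) m m) = 0 :=
    sum_eq_zero fun i hi => by
      rw [h2 _ _ (by have := mem_range.1 hi; omega) (by omega), wedge_zero_right]
  have t4 := sum_triangle_sub_left (fun i j => wedge (h i j m) (h i (j + 1) (m + 1)))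
    (fun i => by simp only [h1, wedge_zero_left]) m
  have t5 := sum_triangle_sub_diag (fun i j => wedge (h i j m) (h i j (m + 1)))
    (by simp only [h1, wedge_zero_left]) m
  have t5' : ∑ i ∈ range m, wedge (h i m m) (h i m (m + 1)) = 0 :=
    sum_eq_zero fun i hi => by
      rw [h2 _ _ (by have := mem_range.1 hi; omega) (by omega), wedge_zero_left]
  have t5'' : ∑ j ∈ range (m + 1), wedge (h 0 j m) (h 0 j (m + 1))
      = ∑ j ∈ range m, wedge (h 0 j m) (h 0 j (m + 1)) := by
    rw [sum_range_succ, h2 0 m (by omega) (by omega), wedge_zero_left, add_zero]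
  have f1 : ∑ j ∈ range (m + 1), ∑ i ∈ range j, wedge (h i j (m + 1)) (h i (j + 1) (m + 1))
      = ∑ j ∈ range m, ∑ i ∈ range j, wedge (h i j (m + 1)) (h i (j + 1) (m + 1)) := by
    rw [sum_range_succ, sum_eq_zero (s := range m) (f := fun i => wedge (h i m (m + 1))
      (h i (m + 1) (m + 1))), add_zero]
    intro i hi
    rw [h2 _ _ (by have := mem_range.1 hi; omega) (by omega), wedge_zero_right]
  have f2 : ∑ j ∈ range (m + 1), ∑ i ∈ range j, wedge (h i j (m + 1)) (h (i + 1) j (m + 1))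
      = ∑ j ∈ range m, ∑ i ∈ range j,
        wedge (h i (j + 1) (m + 1)) (h (i + 1) (j + 1) (m + 1)) := by
    rw [sum_range_succ', range_zero, sum_empty, add_zero]
    refine sum_congr rfl fun j _ => ?_
    rw [sum_range_succ, h1, wedge_zero_right, add_zero]
  have f3 : ∑ j ∈ range (m + 1), ∑ i ∈ range j,
        wedge (h i j (m + 1)) (h (i + 1) (j + 1) (m + 1))
      = ∑ j ∈ range m, ∑ i ∈ range j,
        wedge (h i j (m + 1)) (h (i + 1) (j + 1) (m + 1)) := by
    rw [sum_range_succ, sum_eq_zero (s := range m) (f := fun i => wedge (h i m (m + 1))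
      (h (i + 1) (m + 1) (m + 1))), add_zero]
    intro i hi
    rw [h2 _ _ (by have := mem_range.1 hi; omega) (by omega), wedge_zero_right]
  have q (j : ℕ) : wedge (h 0 j m) (h 0 j (m + 1) + h 0 (j + 1) m - h 0 (j + 1) (m + 1))
      = wedge (h 0 j m) (h 0 j (m + 1)) + wedge (h 0 j m) (h 0 (j + 1) m)
        - wedge (h 0 j m) (h 0 (j + 1) (m + 1)) := by
    simp only [wedge, Prod.fst_add, Prod.snd_add, Prod.fst_sub, Prod.snd_sub]
    ring
  rw [faceForm_eq, faceForm_eq, f1, f2, f3]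
  simp only [sum_sub_distrib] at t1 t2 t4 t5
  simp only [q, sum_add_distrib, sum_sub_distrib]
  linarith

/-- The octahedral forms add up to the forms of two faces of the tetrahedron. -/
lemma sum_octForm {h : ℕ → ℕ → ℕ → ℝ × ℝ} {n : ℕ} (h1 : ∀ i k, h i i k = 0)
    (h2 : ∀ i j, i ≤ j → j ≤ n → h i j j = 0) :
    ∑ k ∈ range n, ∑ j ∈ range k, ∑ i ∈ range j, octForm h i j k
      = faceForm (fun i j => h i j n) n + faceForm (h 0) n := by
  induction n with
  | zero => simp [faceForm]
  | succ m ih =>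
    rw [sum_range_succ, ih fun i j hij hj => h2 i j hij (hj.trans m.le_succ),
      sum_layer_octForm h1 h2]
    have : faceForm (h 0) (m + 1) = faceForm (h 0) m + ∑ j ∈ range m, wedge (h 0 j m)
        (h 0 j (m + 1) + h 0 (j + 1) m - h 0 (j + 1) (m + 1)) := sum_range_succ _ _
    rw [this]
    ring

/-- The form of the reflected face. -/
noncomputable def coFaceForm (f : ℕ → ℕ → ℝ × ℝ) (m : ℕ) : ℝ :=
  ∑ j ∈ range m, ∑ i ∈ range j, wedge (f (i + 1) (j + 1)) (f i (j + 1) + f (i + 1) j - f i j)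

lemma sum_triangle_reflect (F : ℕ → ℕ → ℝ) (n : ℕ) :
    ∑ j ∈ range n, ∑ i ∈ range j, F (n - 1 - j) (n - 1 - i)
      = ∑ j ∈ range n, ∑ i ∈ range j, F i j := by
  rw [sum_sigma', sum_sigma']
  refine sum_nbij' (fun x => ⟨n - 1 - x.2, n - 1 - x.1⟩) (fun x => ⟨n - 1 - x.2, n - 1 - x.1⟩)
    ?_ ?_ ?_ ?_ ?_
  · rintro ⟨j, i⟩ h
    simp only [mem_sigma, mem_range] at h ⊢
    omega
  · rintro ⟨j, i⟩ h
    simp only [mem_sigma, mem_range] at h ⊢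
    omega
  · rintro ⟨j, i⟩ h
    simp only [mem_sigma, mem_range] at h
    simp only [Sigma.mk.injEq, heq_eq_eq]
    omega
  · rintro ⟨j, i⟩ h
    simp only [mem_sigma, mem_range] at h
    simp only [Sigma.mk.injEq, heq_eq_eq]
    omega
  · rintro ⟨j, i⟩ _
    rfl

lemma sum_tetra_reflect (F : ℕ → ℕ → ℕ → ℝ) (n : ℕ) :
    ∑ k ∈ range n, ∑ j ∈ range k, ∑ i ∈ range j, F (n - 1 - k) (n - 1 - j) (n - 1 - i)
      = ∑ k ∈ range n, ∑ j ∈ range k, ∑ i ∈ range j, F i j k := by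
  simp only [sum_sigma']
  refine sum_nbij' (fun x => ⟨n - 1 - x.2.2, n - 1 - x.2.1, n - 1 - x.1⟩)
    (fun x => ⟨n - 1 - x.2.2, n - 1 - x.2.1, n - 1 - x.1⟩)
    ?_ ?_ ?_ ?_ ?_
  · rintro ⟨k, j, i⟩ h
    simp only [mem_sigma, mem_range] at h ⊢
    omega
  · rintro ⟨k, j, i⟩ h
    simp only [mem_sigma, mem_range] at h ⊢
    omega
  · rintro ⟨k, j, i⟩ h
    simp only [mem_sigma, mem_range] at h
    simp only [Sigma.mk.injEq, heq_eq_eq]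
    omega
  · rintro ⟨k, j, i⟩ h
    simp only [mem_sigma, mem_range] at h
    simp only [Sigma.mk.injEq, heq_eq_eq]
    omega
  · rintro ⟨k, j, i⟩ _
    rfl

lemma faceForm_reflect {f : ℕ → ℕ → ℝ × ℝ} {n : ℕ} :
    faceForm (fun i j => f (n - j) (n - i)) n = coFaceForm f n := by
  rw [faceForm, coFaceForm, ← sum_triangle_reflect]
  refine sum_congr rfl fun j hj => sum_congr rfl fun i hi => ?_
  have hj := mem_range.1 hj
  have hi := mem_range.1 hi
  have e1 : n - (n - 1 - j) = j + 1 := by omega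
  have e2 : n - (n - 1 - i) = i + 1 := by omega
  have e3 : n - (n - 1 - j + 1) = j := by omega
  have e4 : n - (n - 1 - i + 1) = i := by omega
  rw [e1, e2, e3, e4]

/-- The diagonal wedges of the two forms are opposite and cancel; the others telescope to two edges
of the triangle. -/
lemma faceForm_add_coFaceForm {f : ℕ → ℕ → ℝ × ℝ} (hf : ∀ i, f i i = 0) (n : ℕ) :
    faceForm f n + coFaceForm f n
      = ∑ j ∈ range n, wedge (f 0 j) (f 0 (j + 1))
        - ∑ i ∈ range n, wedge (f i n) (f (i + 1) n) := by
  have t1 := sum_triangle_sub_left (fun i j => wedge (f i j) (f i (j + 1)))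
    (fun i => by simp only [hf, wedge_zero_left]) n
  have t2 := sum_triangle_sub_right (fun i j => wedge (f i j) (f (i + 1) j))
    (fun i => by simp only [hf, wedge_zero_right]) n
  rw [faceForm, coFaceForm, ← neg_eq_iff_eq_neg.2 t1, sub_eq_add_neg, ← t2, ← sum_neg_distrib,
    ← sum_add_distrib, ← sum_add_distrib]
  refine sum_congr rfl fun j _ => ?_
  rw [← sum_neg_distrib, ← sum_add_distrib, ← sum_add_distrib]
  refine sum_congr rfl fun i _ => ?_
  simp only [wedge, Prod.fst_add, Prod.snd_add, Prod.fst_sub, Prod.snd_sub]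
  ring

/-- `γ` depends only on `j - i`, so the cross terms and the terms `γ ∧ γ` telescope. A change of
normalization is thus visible only on the edges of the face. -/
lemma faceForm_sub {f γ : ℕ → ℕ → ℝ × ℝ} (hf : ∀ i, f i i = 0)
    (hγ : ∀ i j, γ (i + 1) (j + 1) = γ i j) (hγ0 : ∀ i, γ i i = 0) (n : ℕ) :
    faceForm f n - faceForm (fun i j => f i j - γ i j) n
      = ∑ i ∈ range n, (wedge (γ (i + 1) n) (f i n) - wedge (γ i n) (f i n)
          + wedge (γ i n) (γ (i + 1) n))
        + ∑ j ∈ range n, (wedge (γ 0 j) (f 0 j) - wedge (γ 0 (j + 1)) (f 0 j))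
        + wedge (γ 0 n) (f 0 n) := by
  have t1 := sum_triangle_sub_right (fun i j => wedge (γ (i + 1) j) (f i j))
    (fun i => by simp only [hγ0, wedge_zero_left]) n
  have t2 := sum_triangle_sub_left (fun i j => wedge (γ i (j + 1)) (f i j))
    (fun i => by simp only [hf, wedge_zero_right]) n
  have t3 := sum_triangle_sub_diag (fun i j => wedge (γ i j) (f i j))
    (by simp only [hf, wedge_zero_right]) n
  have t4 := sum_triangle_sub_right (fun i j => wedge (γ i j) (γ (i + 1) j))
    (fun i => by simp only [hγ0, wedge_zero_right]) n
  rw [sum_range_succ] at t3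
  simp only [sum_add_distrib, sum_sub_distrib]
  have key : faceForm f n - faceForm (fun i j => f i j - γ i j) n
      = -∑ j ∈ range n, ∑ i ∈ range j, (wedge (γ (i + 1) j) (f i j)
          - wedge (γ (i + 1) (j + 1)) (f i (j + 1)))
        + ∑ j ∈ range n, ∑ i ∈ range j, (wedge (γ (i + 1) (j + 1)) (f (i + 1) j)
          - wedge (γ i (j + 1)) (f i j))
        + ∑ j ∈ range n, ∑ i ∈ range j, (wedge (γ i j) (f i j)
          - wedge (γ (i + 1) (j + 1)) (f (i + 1) (j + 1)))
        - ∑ j ∈ range n, ∑ i ∈ range j, (wedge (γ i j) (γ (i + 1) j)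
          - wedge (γ i (j + 1)) (γ (i + 1) (j + 1))) := by
    simp only [faceForm, ← sum_neg_distrib, ← sum_add_distrib, ← sum_sub_distrib]
    refine sum_congr rfl fun j _ => sum_congr rfl fun i _ => ?_
    simp only [hγ, wedge, Prod.fst_add, Prod.snd_add, Prod.fst_sub, Prod.snd_sub]
    ring
  rw [key, t1, t2, t3, t4]
  ring

lemma faceForm_congr {f f' : ℕ → ℕ → ℝ × ℝ} {n : ℕ}
    (h : ∀ i j, i ≤ j → j ≤ n → f i j = f' i j) : faceForm f n = faceForm f' n := by
  refine sum_congr rfl fun j hj => sum_congr rfl fun i hi => ?_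
  have hj := mem_range.1 hj
  have hi := mem_range.1 hi
  rw [h i j (by omega) (by omega), h i (j + 1) (by omega) (by omega),
    h (i + 1) j (by omega) (by omega), h (i + 1) (j + 1) (by omega) (by omega)]

/-- The exterior form attached to rows `S` and three further rows. -/
noncomputable def flagForm (l : Finset ℕ → ℝ × ℝ) (S : Finset ℕ) (a b c : ℕ) : ℝ :=
  tri (l (insert a S) + l (insert b (insert c S))) (l (insert a (insert b S)) + l (insert c S))
    (l (insert a (insert c S)) + l (insert b S))

lemma flagForm_low (l : Finset ℕ → ℝ × ℝ) {n i j k : ℕ} (hij : i < j) (hjk : j < k) (hk : k < n) :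
    flagForm l (Ico (i + 1) j ∪ Ico (k + 1) n) i j k
      = octForm (fun i j k => l (Ico i j ∪ Ico k n)) i j k := by
  have e1 : insert i (Ico (i + 1) j ∪ Ico (k + 1) n) = Ico i j ∪ Ico (k + 1) n := by
    ext x; simp only [mem_insert, mem_union, mem_Ico]; omega
  have e2 : insert k (Ico (i + 1) j ∪ Ico (k + 1) n) = Ico (i + 1) j ∪ Ico k n := by
    ext x; simp only [mem_insert, mem_union, mem_Ico]; omega
  have e3 : insert j (Ico (i + 1) j ∪ Ico k n) = Ico (i + 1) (j + 1) ∪ Ico k n := by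
    ext x; simp only [mem_insert, mem_union, mem_Ico]; omega
  have e4 : insert j (Ico (i + 1) j ∪ Ico (k + 1) n) = Ico (i + 1) (j + 1) ∪ Ico (k + 1) n := by
    ext x; simp only [mem_insert, mem_union, mem_Ico]; omega
  have e5 : insert i (Ico (i + 1) (j + 1) ∪ Ico (k + 1) n) = Ico i (j + 1) ∪ Ico (k + 1) n := by
    ext x; simp only [mem_insert, mem_union, mem_Ico]; omega
  have e6 : insert i (Ico (i + 1) j ∪ Ico k n) = Ico i j ∪ Ico k n := by
    ext x; simp only [mem_insert, mem_union, mem_Ico]; omega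
  rw [flagForm, octForm, e2, e1, e3, e4, e5, e6]

/-- `tri` depends only on the differences of its arguments, so a common summand may be removed from
all three. -/
lemma tri_swap_sub (u v w g : ℝ × ℝ) : tri v u w = -tri (u - g) (v - g) (w - g) := by
  simp only [tri, wedge, Prod.fst_sub, Prod.snd_sub]
  ring

/-- The logarithmic jets of the reflected rows, normalized by those of the initial rows. -/
noncomputable def reflectedJet (l : Finset ℕ → ℝ × ℝ) (n a b c : ℕ) : ℝ × ℝ :=
  l (Ico 0 (n - c) ∪ Ico (n - b) (n - a)) - l (Ico 0 (n - c + (b - a)))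

/-- Reflecting the labels exchanges two of the three products, which gives the sign. The
normalization in `reflectedJet` makes the jets vanish where two consecutive indices coincide, as
`sum_octForm` requires. -/
lemma flagForm_tlow (l : Finset ℕ → ℝ × ℝ) {n i j k : ℕ} (hij : i < j) (hjk : j < k)
    (hk : k < n) : flagForm l (Ico 0 i ∪ Ico (j + 1) k) i j k
      = -octForm (reflectedJet l n) (n - 1 - k) (n - 1 - j) (n - 1 - i) := by
  have e1 : insert i (Ico 0 i ∪ Ico (j + 1) k) = Ico 0 (i + 1) ∪ Ico (j + 1) k := by
    ext x; simp only [mem_insert, mem_union, mem_Ico]; omega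
  have e2 : insert k (Ico 0 i ∪ Ico (j + 1) k) = Ico 0 i ∪ Ico (j + 1) (k + 1) := by
    ext x; simp only [mem_insert, mem_union, mem_Ico]; omega
  have e3 : insert j (Ico 0 i ∪ Ico (j + 1) (k + 1)) = Ico 0 i ∪ Ico j (k + 1) := by
    ext x; simp only [mem_insert, mem_union, mem_Ico]; omega
  have e4 : insert j (Ico 0 i ∪ Ico (j + 1) k) = Ico 0 i ∪ Ico j k := by
    ext x; simp only [mem_insert, mem_union, mem_Ico]; omega
  have e5 : insert i (Ico 0 i ∪ Ico j k) = Ico 0 (i + 1) ∪ Ico j k := by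
    ext x; simp only [mem_insert, mem_union, mem_Ico]; omega
  have e6 : insert i (Ico 0 i ∪ Ico (j + 1) (k + 1)) = Ico 0 (i + 1) ∪ Ico (j + 1) (k + 1) := by
    ext x; simp only [mem_insert, mem_union, mem_Ico]; omega
  have i1 : n - (n - 1 - i + 1) = i := by omega
  have i2 : n - (n - 1 - i) = i + 1 := by omega
  have j1 : n - (n - 1 - j + 1) = j := by omega
  have j2 : n - (n - 1 - j) = j + 1 := by omega
  have k1 : n - (n - 1 - k + 1) = k := by omega
  have k2 : n - (n - 1 - k) = k + 1 := by omega
  have s1 : i + (n - 1 - j - (n - 1 - k)) = i + (k - j) := by omega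
  have s2 : i + 1 + (n - 1 - j + 1 - (n - 1 - k + 1)) = i + (k - j) + 1 := by omega
  have s3 : i + (n - 1 - j + 1 - (n - 1 - k)) = i + (k - j) + 1 := by omega
  have s4 : i + 1 + (n - 1 - j - (n - 1 - k + 1)) = i + (k - j) := by omega
  have s5 : i + 1 + (n - 1 - j - (n - 1 - k)) = i + (k - j) + 1 := by omega
  have s6 : i + (n - 1 - j + 1 - (n - 1 - k + 1)) = i + (k - j) := by omega
  simp only [flagForm, octForm, reflectedJet, e1, e2, e3, e4, e5, e6, i1, i2, j1, j2, k1, k2, s1,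
    s2, s3, s4, s5, s6]
  -- Each of the three products pairs a minor of size `#S + 1` with one of size `#S + 2`, so the
  -- normalizing jets add the same `g` to every argument of `tri`.
  rw [tri_swap_sub (g := l (Ico 0 (i + (k - j))) + l (Ico 0 (i + (k - j) + 1)))]
  congr 2 <;> abel

lemma sum_wedge_reflect (g : ℕ → ℝ × ℝ) (n : ℕ) :
    ∑ b ∈ range n, wedge (g (n - b)) (g (n - (b + 1)))
      = -∑ j ∈ range n, wedge (g j) (g (j + 1)) := by
  rw [← sum_range_reflect, ← sum_neg_distrib]
  refine sum_congr rfl fun j hj => ?_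
  have hj := mem_range.1 hj
  have e1 : n - (n - 1 - j) = j + 1 := by omega
  have e2 : n - (n - 1 - j + 1) = j := by omega
  rw [e1, e2, wedge_swap]

/-- The forms of the two sides agree. -/
theorem sum_flagForm_low_eq_tlow {l : Finset ℕ → ℝ × ℝ} {n : ℕ} (hl : ∀ a, l (Ico a n) = 0) :
    ∑ k ∈ range n, ∑ j ∈ range k, ∑ i ∈ range j,
        flagForm l (Ico (i + 1) j ∪ Ico (k + 1) n) i j k
      = ∑ k ∈ range n, ∑ j ∈ range k, ∑ i ∈ range j,
        flagForm l (Ico 0 i ∪ Ico (j + 1) k) i j k := by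
  have hl0 : l ∅ = 0 := by simpa using hl n
  have hr : l (range n) = 0 := by simpa using hl 0
  have hg {a : ℕ} (ha : n ≤ a) : Ico 0 n ∪ Ico a n = Ico 0 n := by
    rw [Ico_eq_empty (a := a) (by omega), union_empty]
  -- The surviving faces are `k = n`, carrying the intervals, and `i = 0`, carrying an initial
  -- together with a final interval. The truncation `min a n` makes the second family vanish on its
  -- diagonal for all indices, also beyond `n`.
  have L : ∑ k ∈ range n, ∑ j ∈ range k, ∑ i ∈ range j,
        flagForm l (Ico (i + 1) j ∪ Ico (k + 1) n) i j k
      = faceForm (fun a b => l (Ico a b)) n + faceForm (fun a b => l (Ico 0 (min a n) ∪ Ico b n)) n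
      := by
    have h := sum_octForm (h := fun i j k => l (Ico i j ∪ Ico k n)) (n := n)
      (fun i k => by simp [hl]) (fun i j hij hj => by
        simp only [Ico_union_Ico_eq_Ico hij hj, hl])
    rw [faceForm_congr (f := fun a b => l (Ico a b ∪ Ico n n)) (f' := fun a b => l (Ico a b))
        (fun i j _ _ => by simp),
      faceForm_congr (f := fun a b => l (Ico 0 a ∪ Ico b n)) (f' := fun a b => l (Ico 0 (min a n) ∪ Ico b n))
        (fun i j hi hj => by simp only [min_eq_left (hi.trans hj)])] at h
    rw [← h]
    refine sum_congr rfl fun k hk => sum_congr rfl fun j hj => sum_congr rfl fun i hi => ?_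
    exact flagForm_low l (mem_range.1 hi) (mem_range.1 hj) (mem_range.1 hk)
  -- The reflected tetrahedron has the same two faces, with normalized jets and the forms
  -- `coFaceForm`.
  have R : ∑ k ∈ range n, ∑ j ∈ range k, ∑ i ∈ range j,
        flagForm l (Ico 0 i ∪ Ico (j + 1) k) i j k
      = -(coFaceForm (fun a b => l (Ico a b) - l (Ico 0 (b - a))) n
        + coFaceForm (fun a b => l (Ico 0 (min a n) ∪ Ico b n) - l (Ico 0 (n - (b - a)))) n) := by
    have h := sum_octForm (h := reflectedJet l n) (n := n)
      (fun i k => by simp [reflectedJet]) (fun i j hij hj => by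
        have e : n - j + (j - i) = n - i := by omega
        rw [reflectedJet, Ico_union_Ico_eq_Ico (Nat.zero_le _) (by omega), e, sub_self])
    rw [faceForm_congr (f := fun i j => reflectedJet l n i j n)
      (f' := fun i j => l (Ico (n - j) (n - i)) - l (Ico 0 (n - i - (n - j))))
      (fun i j hi hj => by
        have e : n - i - (n - j) = j - i := by omega
        simp [reflectedJet, e]),
      faceForm_congr (f := reflectedJet l n 0) (f' := fun i j => l (Ico 0 (min (n - j) n) ∪ Ico (n - i) n)
        - l (Ico 0 (n - (n - i - (n - j))))) (fun i j hi hj => by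
        have e : n - (n - i - (n - j)) = n - j + i := by omega
        simp [reflectedJet, e])] at h
    rw [faceForm_reflect (f := fun a b => l (Ico a b) - l (Ico 0 (b - a))),
      faceForm_reflect (f := fun a b => l (Ico 0 (min a n) ∪ Ico b n)
        - l (Ico 0 (n - (b - a)))), ← sum_tetra_reflect] at h
    rw [← h, ← sum_neg_distrib]
    refine sum_congr rfl fun k hk => ?_
    rw [← sum_neg_distrib]
    refine sum_congr rfl fun j hj => ?_
    rw [← sum_neg_distrib]
    refine sum_congr rfl fun i hi => ?_
    exact flagForm_tlow l (mem_range.1 hi) (mem_range.1 hj) (mem_range.1 hk)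
  rw [L, R]
  -- On either face, first the normalization is removed and then `coFaceForm` is traded for
  -- `faceForm`. The resulting edge sums cancel between the two faces.
  have a1 := faceForm_sub (f := fun a b => l (Ico a b)) (γ := fun a b => l (Ico 0 (b - a)))
    (fun i => by simp [hl0]) (fun i j => by simp) (fun i => by simp [hl0]) n
  have a2 := faceForm_add_coFaceForm (f := fun a b => l (Ico a b) - l (Ico 0 (b - a)))
    (fun i => by simp [hl0]) n
  have b1 := faceForm_sub (f := fun a b => l (Ico 0 (min a n) ∪ Ico b n))
    (γ := fun a b => l (Ico 0 (n - (b - a))))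
    (fun i => by
      rcases le_total i n with h | h
      · rw [min_eq_left h, Ico_union_Ico_eq_Ico (Nat.zero_le _) h, hl]
      · rw [min_eq_right h, hg h, hl]) (fun i j => by simp) (fun i => by simp [hr]) n
  have b2 := faceForm_add_coFaceForm
    (f := fun a b => l (Ico 0 (min a n) ∪ Ico b n) - l (Ico 0 (n - (b - a))))
    (fun i => by
      rcases le_total i n with h | h
      · rw [min_eq_left h, Ico_union_Ico_eq_Ico (Nat.zero_le _) h]; simp
      · rw [min_eq_right h, hg h]; simp) n
  have hq {i : ℕ} (hi : i ≤ n) : l (Ico 0 (min i n) ∪ Ico n n) = l (Ico 0 i) := by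
    rw [min_eq_left hi, Ico_self, union_empty]
  have hz {b : ℕ} : l (Ico 0 (min 0 n) ∪ Ico b n) = 0 := by
    rw [Nat.zero_min, Ico_self, empty_union, hl]
  have hs : ∑ i ∈ range n, (wedge (l (Ico 0 (n - (n - (i + 1))))) (l (Ico 0 (min i n) ∪ Ico n n))
      - wedge (l (Ico 0 (n - (n - i)))) (l (Ico 0 (min i n) ∪ Ico n n))
      + wedge (l (Ico 0 (n - (n - i)))) (l (Ico 0 (n - (n - (i + 1)))))) = 0 := by
    refine sum_eq_zero fun i hi => ?_
    have hi := mem_range.1 hi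
    have e1 : n - (n - (i + 1)) = i + 1 := by omega
    have e2 : n - (n - i) = i := by omega
    rw [hq hi.le, e1, e2, wedge_self, wedge_swap (l (Ico 0 (i + 1)))]
    ring
  have hs2 : ∑ i ∈ range n, wedge (l (Ico 0 (min i n) ∪ Ico n n) - l (Ico 0 (n - (n - i))))
      (l (Ico 0 (min (i + 1) n) ∪ Ico n n) - l (Ico 0 (n - (n - (i + 1))))) = 0 := by
    refine sum_eq_zero fun i hi => ?_
    have hi := mem_range.1 hi
    have e2 : n - (n - i) = i := by omega
    rw [hq hi.le, e2, sub_self, wedge_zero_left]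
  simp only [hs] at b1
  simp only [hs2] at b2
  have neg (u v : ℝ × ℝ) : wedge (0 - u) (0 - v) = wedge u v := by simp [wedge]
  have sw : ∑ j ∈ range n, wedge (l (Ico 0 (j + 1))) (l (Ico 0 j))
      = -∑ j ∈ range n, wedge (l (Ico 0 j)) (l (Ico 0 (j + 1))) := by
    rw [← sum_neg_distrib]
    exact sum_congr rfl fun j _ => wedge_swap _ _
  simp only [hl, hz, wedge_zero_right, wedge_self, sub_zero, zero_sub, zero_add, add_zero,
    Nat.sub_zero, sub_self, sum_const_zero, sum_neg_distrib, sw, neg_neg]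
    at a1 a2 b1 b2
  simp only [← zero_sub (l _), neg] at a2 b2
  have r := sum_wedge_reflect (fun k => l (Ico 0 k)) n
  linarith

variable {n : ℕ}

/-! ### Equality of the two sums over right flag minors -/

/-- The dilogarithm sum over the ratios `Y_{abc}`. -/
noncomputable def lowSum (M : Matrix (Fin n) (Fin n) ℝ) : ℝ :=
  ∑ k ∈ range n, ∑ j ∈ range k, ∑ i ∈ range j,
    ell (flagRatio M (Ico (i + 1) j ∪ Ico (k + 1) n) i j k)

/-- The dilogarithm sum over the ratios `Ỹ_{abc}`. -/
noncomputable def tlowSum (M : Matrix (Fin n) (Fin n) ℝ) : ℝ :=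
  ∑ k ∈ range n, ∑ j ∈ range k, ∑ i ∈ range j,
    ell (flagRatio M (Ico 0 i ∪ Ico (j + 1) k) i j k)

lemma flagMinor_Ico {M : Matrix (Fin n) (Fin n) ℝ} (hM : M ∈ unipotentUpper n) (a : ℕ) :
    flagMinor M (Ico a n) = 1 := by
  rcases le_total a n with h | h
  · have := flagMinor_tail hM (r := id) (m := 0) (d := a) (by omega) (by omega) (by omega)
    simpa using this
  · have := flagMinor_tail hM (r := id) (m := 0) (d := n) (by omega) (by omega) (by omega)
    simpa [Ico_eq_empty_of_le h] using this

lemma scaleBy_mem_unipotentUpper (t : ℝ) {M : Matrix (Fin n) (Fin n) ℝ}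
    (hM : M ∈ unipotentUpper n) : scaleBy t M ∈ unipotentUpper n :=
  ⟨fun i => by simp [scaleBy, hM.1], fun i j hij => by simp [scaleBy, hM.2 i j hij]⟩

lemma pathBetween_mem_unipotentUpper {M N : Matrix (Fin n) (Fin n) ℝ} (hM : M ∈ unipotentUpper n)
    (hN : N ∈ unipotentUpper n) (t : ℝ) : pathBetween M N t ∈ unipotentUpper n :=
  unipotentUpper_mul (scaleBy_mem_unipotentUpper _ hM) (scaleBy_mem_unipotentUpper _ hN)

/-- The logarithmic jets of the flag minors along a path. -/
noncomputable def pathJet (M N : Matrix (Fin n) (Fin n) ℝ) (t : ℝ) (I : Finset ℕ) : ℝ × ℝ :=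
  logJet (flagMinor (pathBetween M N t) I) (deriv (fun s => flagMinor (pathBetween M N s) I) t)

lemma pathJet_Ico {M N : Matrix (Fin n) (Fin n) ℝ} (hM : M ∈ unipotentUpper n)
    (hN : N ∈ unipotentUpper n) (t : ℝ) (a : ℕ) : pathJet M N t (Ico a n) = 0 := by
  have h : (fun s => flagMinor (pathBetween M N s) (Ico a n)) = fun _ => 1 :=
    funext fun s => flagMinor_Ico (pathBetween_mem_unipotentUpper hM hN s) a
  rw [pathJet, h, flagMinor_Ico (pathBetween_mem_unipotentUpper hM hN t) a]
  ext <;> simp [logJet]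

/-- By the Plücker relation all three arguments of `tri` in `hasDerivAt_ell_div` are jets of
products of two flag minors, and they split additively. -/
lemma hasDerivAt_ell_flagRatio {M N : Matrix (Fin n) (Fin n) ℝ} (hM : M ∈ totallyPositive n)
    (hN : N ∈ totallyPositive n) {t : ℝ} (ht : t ∈ Set.Icc (0 : ℝ) 1) {S : Finset ℕ}
    (hS : S ⊆ range n) {a b c : ℕ} (ha : a ∉ S) (hb : b ∉ S) (hc : c ∉ S) (hab : a < b)
    (hbc : b < c) (hcn : c < n) :
    HasDerivAt (fun s => ell (flagRatio (pathBetween M N s) S a b c))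
      (3 / Real.pi ^ 2 * flagForm (pathJet M N t) S a b c) t := by
  have hbn : b < n := hbc.trans hcn
  have han : a < n := hab.trans hbn
  have hsub {x : ℕ} (hx : x < n) {T : Finset ℕ} (hT : T ⊆ range n) : insert x T ⊆ range n :=
    insert_subset (mem_range.2 hx) hT
  have hcard : #S + 2 ≤ n := by
    have h := card_le_card (hsub han (hsub hbn hS))
    rwa [card_insert_of_notMem (by simp [ha, hab.ne]), card_insert_of_notMem hb, card_range] at h
  have hpos {I : Finset ℕ} (hI : I ⊆ range n) : 0 < flagMinor (pathBetween M N t) I :=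
    flagMinor_pos (pathBetween_mem hM hN ht) hI
  have hd (I : Finset ℕ) := (differentiable_flagMinor_pathBetween M N I t).hasDerivAt
  have pa := hpos (hsub han hS)
  have pb := hpos (hsub hbn hS)
  have pc := hpos (hsub hcn hS)
  have pab := hpos (hsub han (hsub hbn hS))
  have pac := hpos (hsub han (hsub hcn hS))
  have pbc := hpos (hsub hbn (hsub hcn hS))
  have hf := (hd (insert a S)).fun_mul (hd (insert b (insert c S)))
  have hg := (hd (insert a (insert b S))).fun_mul (hd (insert c S))
  have hh := (hd (insert a (insert c S))).fun_mul (hd (insert b S))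
  have hplu : (fun s => flagMinor (pathBetween M N s) (insert a S)
        * flagMinor (pathBetween M N s) (insert b (insert c S))
      + flagMinor (pathBetween M N s) (insert a (insert b S))
        * flagMinor (pathBetween M N s) (insert c S))
      = fun s => flagMinor (pathBetween M N s) (insert a (insert c S))
        * flagMinor (pathBetween M N s) (insert b S) :=
    funext fun s => flagMinor_plucker _ hcard ha hb hc hab hbc
  have hfg := hf.fun_add hg
  rw [hplu] at hfg
  have h := hasDerivAt_ell_div hf hg (mul_pos pa pbc) (mul_pos pab pc)
  -- The sum and the third product are the same function of `s`, so their derivatives agree and the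
  -- jet of `f + g` is that of the product.
  rw [hfg.unique hh, flagMinor_plucker _ hcard ha hb hc hab hbc, logJet_mul pa pbc,
    logJet_mul pab pc, logJet_mul pac pb] at h
  exact h

lemma low_rows {i j k n : ℕ} (hij : i < j) (hjk : j < k) (hk : k < n) :
    Ico (i + 1) j ∪ Ico (k + 1) n ⊆ range n ∧ i ∉ Ico (i + 1) j ∪ Ico (k + 1) n ∧
      j ∉ Ico (i + 1) j ∪ Ico (k + 1) n ∧ k ∉ Ico (i + 1) j ∪ Ico (k + 1) n := by
  refine ⟨fun x hx => ?_, ?_, ?_, ?_⟩ <;>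
    simp only [mem_union, mem_Ico, mem_range] at * <;> omega

lemma tlow_rows {i j k n : ℕ} (hij : i < j) (hjk : j < k) (hk : k < n) :
    Ico 0 i ∪ Ico (j + 1) k ⊆ range n ∧ i ∉ Ico 0 i ∪ Ico (j + 1) k ∧
      j ∉ Ico 0 i ∪ Ico (j + 1) k ∧ k ∉ Ico 0 i ∪ Ico (j + 1) k := by
  refine ⟨fun x hx => ?_, ?_, ?_, ?_⟩ <;>
    simp only [mem_union, mem_Ico, mem_range] at * <;> omega

/-- The difference of the sums has derivative zero along the path from `M` to `binomMatrix n`, and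
it vanishes at the end of the path. -/
theorem lowSum_eq_tlowSum {M : Matrix (Fin n) (Fin n) ℝ} (hM : M ∈ totallyPositive n) :
    lowSum M = tlowSum M := by
  have hN : binomMatrix n ∈ totallyPositive n := binomMatrix_mem
  set N := binomMatrix n with hN_def
  have hd : ∀ t ∈ Set.Icc (0 : ℝ) 1, HasDerivAt
      (fun s => lowSum (pathBetween M N s) - tlowSum (pathBetween M N s)) 0 t := fun t ht => by
    have h1 : HasDerivAt (fun s => lowSum (pathBetween M N s))
        (∑ k ∈ range n, ∑ j ∈ range k, ∑ i ∈ range j, 3 / Real.pi ^ 2 *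
          flagForm (pathJet M N t) (Ico (i + 1) j ∪ Ico (k + 1) n) i j k) t := by
      refine HasDerivAt.fun_sum fun k hk => HasDerivAt.fun_sum fun j hj =>
        HasDerivAt.fun_sum fun i hi => ?_
      have hi := mem_range.1 hi
      have hj := mem_range.1 hj
      have hk := mem_range.1 hk
      obtain ⟨e1, e2, e3, e4⟩ := low_rows hi hj hk
      exact hasDerivAt_ell_flagRatio hM hN ht e1 e2 e3 e4 hi hj hk
    have h2 : HasDerivAt (fun s => tlowSum (pathBetween M N s))
        (∑ k ∈ range n, ∑ j ∈ range k, ∑ i ∈ range j, 3 / Real.pi ^ 2 *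
          flagForm (pathJet M N t) (Ico 0 i ∪ Ico (j + 1) k) i j k) t := by
      refine HasDerivAt.fun_sum fun k hk => HasDerivAt.fun_sum fun j hj =>
        HasDerivAt.fun_sum fun i hi => ?_
      have hi := mem_range.1 hi
      have hj := mem_range.1 hj
      have hk := mem_range.1 hk
      obtain ⟨e1, e2, e3, e4⟩ := tlow_rows hi hj hk
      exact hasDerivAt_ell_flagRatio hM hN ht e1 e2 e3 e4 hi hj hk
    have h := h1.fun_sub h2
    simp only [← mul_sum] at h
    rwa [sum_flagForm_low_eq_tlow (pathJet_Ico hM.1 hN.1 t), sub_self] at h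
  have hc := constant_of_has_deriv_right_zero (a := (0 : ℝ)) (b := 1)
    (fun t ht => (hd t ht).continuousAt.continuousWithinAt)
    (fun t ht => (hd t (Set.Ico_subset_Icc_self ht)).hasDerivWithinAt) 1
    (Set.right_mem_Icc.2 zero_le_one)
  rw [pathBetween_zero M hN.1, pathBetween_one hM.1] at hc
  have hbase : lowSum N = tlowSum N := by
    refine sum_congr rfl fun k hk => sum_congr rfl fun j hj => sum_congr rfl fun i hi => ?_
    have hi := mem_range.1 hi
    have hj := mem_range.1 hj
    have hk := mem_range.1 hk
    obtain ⟨e1, e2, e3, e4⟩ := low_rows hi hj hk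
    obtain ⟨f1, f2, f3, f4⟩ := tlow_rows hi hj hk
    rw [hN_def, flagRatio_binomMatrix e1 e2 e3 e4 hi hj hk,
      flagRatio_binomMatrix f1 f2 f3 f4 hi hj hk]
  linarith

/-! ### The four families of functions in terms of flag ratios -/

lemma rightMinor_eq_flagMinor (M : Matrix (Fin n) (Fin n) ℝ) {S I : Finset ℕ}
    (h : ∀ x, x ∈ I ↔ x < n ∧ x + 1 ∈ S) : rightMinor M S = flagMinor M I := by
  set e := (labels n S).orderEmbOfFin rfl with he
  have hf : StrictMono fun i => (e i : ℕ) := fun _ _ hij => e.strictMono hij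
  have hI : I = univ.image fun i => (e i : ℕ) := by
    ext x
    rw [h, mem_image]
    constructor
    · rintro ⟨hx, hS⟩
      have hmem : (⟨x, hx⟩ : Fin n) ∈ Set.range e := by
        rw [he, range_orderEmbOfFin]
        simp [labels, hS]
      obtain ⟨i, hi⟩ := hmem
      exact ⟨i, mem_univ _, by rw [hi]⟩
    · rintro ⟨i, -, rfl⟩
      have : e i ∈ labels n S := orderEmbOfFin_mem _ _ _
      simp only [labels, mem_filter, mem_univ, true_and] at this
      exact ⟨(e i).isLt, this⟩
  rw [hI, flagMinor_image _ hf, rightMinor]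
  congr 1
  ext i j
  have : n - (labels n S).card + (j : ℕ) = (lastIdx n S j : ℕ) := rfl
  rw [submatrix_apply, of_apply, this, entry_val]

/-- The transpose of `M` along the antidiagonal. -/
def antiT (M : Matrix (Fin n) (Fin n) ℝ) : Matrix (Fin n) (Fin n) ℝ :=
  of fun i j => M j.rev i.rev

lemma antiT_antiT (M : Matrix (Fin n) (Fin n) ℝ) : antiT (antiT M) = M := by
  ext i j
  simp [antiT]

lemma antiT_mem_unipotentUpper {M : Matrix (Fin n) (Fin n) ℝ} (hM : M ∈ unipotentUpper n) :
    antiT M ∈ unipotentUpper n :=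
  ⟨fun i => by simp [antiT, hM.1], fun i j hij => hM.2 _ _ (Fin.rev_lt_rev.2 hij)⟩

lemma entry_antiT (M : Matrix (Fin n) (Fin n) ℝ) {i j : ℕ} (hi : i < n) (hj : j < n) :
    entry (antiT M) i j = entry M (n - 1 - j) (n - 1 - i) := by
  rw [entry, dif_pos ⟨hi, hj⟩, entry, dif_pos (by omega), antiT, of_apply]
  congr 1 <;> ext <;> simp only [Fin.val_rev] <;> omega

/-- Reversal of the order of the rows and columns of a minor. -/
lemma det_entry_antiT (M : Matrix (Fin n) (Fin n) ℝ) {k : ℕ} {r c r' c' : Fin k → ℕ}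
    (hr : ∀ i, r i + c' i.rev + 1 = n) (hc : ∀ i, c i + r' i.rev + 1 = n) :
    det (of fun i j => entry (antiT M) (r i) (c j)) = det (of fun i j => entry M (r' i) (c' j)) := by
  rw [← det_transpose, ← det_submatrix_equiv_self Fin.revPerm]
  congr 1
  ext i j
  have h1 := hr j.rev
  have h2 := hc i.rev
  rw [Fin.rev_rev] at h1 h2
  simp only [submatrix_apply, transpose_apply, of_apply, Fin.revPerm_apply]
  rw [entry_antiT M (by omega) (by omega)]
  congr 1 <;> omega

/-- The antitranspose reverses both rows and columns of a minor, so no sign appears, and it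
preserves the condition `r i ≤ c i`. -/
lemma antiT_mem {M : Matrix (Fin n) (Fin n) ℝ} (hM : M ∈ totallyPositive n) :
    antiT M ∈ totallyPositive n := by
  refine mem_totallyPositive (antiT_mem_unipotentUpper hM.1) fun k r c hr hc hle hn => ?_
  have hr' : ∀ i, r i < n := fun i => (hle i).trans_lt (hn i)
  have hlt {i j : Fin k} (h : i < j) : j.rev < i.rev := Fin.rev_lt_rev.2 h
  rw [det_entry_antiT M (r' := fun i => n - 1 - c i.rev) (c' := fun i => n - 1 - r i.rev)]
  · refine det_pos_of_le hM (fun i j hij => ?_) (fun i j hij => ?_) (fun i => ?_) fun i => ?_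
    · have := hc (hlt hij)
      have := hn i.rev
      omega
    · have := hr (hlt hij)
      have := hr' i.rev
      omega
    · have := hle i.rev
      omega
    · have := hr' i.rev
      omega
  · intro i
    have := hr' i
    simp only [Fin.rev_rev]
    omega
  · intro i
    have := hn i
    simp only [Fin.rev_rev]
    omega

/-- The antitranspose turns the first rows into the last columns. A column with label `s`, counted
from `1`, becomes row `n - s`, counted from `0`. -/
lemma upperMinor_eq_flagMinor (M : Matrix (Fin n) (Fin n) ℝ) {S I : Finset ℕ}
    (h : ∀ x, x ∈ I ↔ x < n ∧ n - x ∈ S) : upperMinor M S = flagMinor (antiT M) I := by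
  set e := (labels n S).orderEmbOfFin rfl with he
  have hk := card_labels_le n S
  have hf : StrictMono fun i : Fin #(labels n S) => n - 1 - (e i.rev : ℕ) := fun i j hij => by
    have h1 : e j.rev < e i.rev := e.strictMono (Fin.rev_lt_rev.2 hij)
    have h2 : (e j.rev : ℕ) < e i.rev := h1
    have := (e i.rev).isLt
    simp only
    omega
  have hI : I = univ.image fun i : Fin #(labels n S) => n - 1 - (e i.rev : ℕ) := by
    ext x
    rw [h, mem_image]
    constructor
    · rintro ⟨hx, hS⟩
      have hmem : (⟨n - 1 - x, by omega⟩ : Fin n) ∈ Set.range e := by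
        rw [he, range_orderEmbOfFin]
        have : n - 1 - x + 1 = n - x := by omega
        simp [labels, this, hS]
      obtain ⟨i, hi⟩ := hmem
      refine ⟨i.rev, mem_univ _, ?_⟩
      rw [Fin.rev_rev, hi]
      simp only
      omega
    · rintro ⟨i, -, rfl⟩
      have : e i.rev ∈ labels n S := orderEmbOfFin_mem _ _ _
      simp only [labels, mem_filter, mem_univ, true_and] at this
      have hlt := (e i.rev).isLt
      refine ⟨by omega, ?_⟩
      have h2 : n - (n - 1 - (e i.rev : ℕ)) = e i.rev + 1 := by omega
      rwa [h2]
  rw [hI, flagMinor_image _ hf, upperMinor, det_entry_antiT M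
    (r' := fun i => (firstIdx n S i : ℕ)) (c' := fun i => (e i : ℕ))]
  · congr 1
    ext i j
    simp
    rfl
  · intro i
    have := (e i.rev).isLt
    omega
  · intro i
    have := i.isLt
    simp only [firstIdx, Fin.val_rev]
    omega

lemma Ylow_eq (M : Matrix (Fin n) (Fin n) ℝ) {i j k : ℕ} (hij : i < j) (hjk : j < k) (hk : k < n) :
    Ylow M (i + 1) (j + 1) (k + 1) = flagRatio M (Ico (i + 1) j ∪ Ico (k + 1) n) i j k := by
  rw [Ylow, flagRatio]
  congr 2 <;>
  · apply rightMinor_eq_flagMinor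
    intro x
    simp only [mem_insert, mem_union, mem_Ico, mem_Icc]
    omega

lemma Ytlow_eq (M : Matrix (Fin n) (Fin n) ℝ) {i j k : ℕ} (hij : i < j) (hjk : j < k)
    (hk : k < n) :
    Ytlow M (i + 1) (j + 1) (k + 1) = flagRatio M (Ico 0 i ∪ Ico (j + 1) k) i j k := by
  rw [Ytlow, flagRatio]
  congr 2 <;>
  · apply rightMinor_eq_flagMinor
    intro x
    simp only [mem_insert, mem_union, mem_Ico, mem_Icc]
    omega

/-- The reversal of labels exchanges initial and final intervals, so an upper ratio with a tilde
becomes a lower one without; in `Yup_eq` the tilde appears instead. -/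
lemma Ytup_eq (M : Matrix (Fin n) (Fin n) ℝ) {i j k : ℕ} (hij : i < j) (hjk : j < k)
    (hk : k < n) :
    Ytup M (n - k) (n - j) (n - i) = flagRatio (antiT M) (Ico (i + 1) j ∪ Ico (k + 1) n) i j k := by
  rw [Ytup, flagRatio, mul_comm (upperMinor _ _), mul_comm (flagMinor _ (insert i (insert j _)))]
  congr 2 <;>
  · apply upperMinor_eq_flagMinor
    intro x
    simp only [mem_insert, mem_union, mem_Ico, mem_Icc]
    omega

lemma Yup_eq (M : Matrix (Fin n) (Fin n) ℝ) {i j k : ℕ} (hij : i < j) (hjk : j < k)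
    (hk : k < n) :
    Yup M (n - k) (n - j) (n - i) = flagRatio (antiT M) (Ico 0 i ∪ Ico (j + 1) k) i j k := by
  rw [Yup, flagRatio, mul_comm (upperMinor _ _), mul_comm (flagMinor _ (insert i (insert j _)))]
  congr 2 <;>
  · apply upperMinor_eq_flagMinor
    intro x
    simp only [mem_insert, mem_union, mem_Ico, mem_Icc]
    omega

lemma flagRatio_pos {M : Matrix (Fin n) (Fin n) ℝ} (hM : M ∈ totallyPositive n) {S : Finset ℕ}
    (hS : S ⊆ range n) {a b c : ℕ} (ha : a < n) (hb : b < n) (hc : c < n) :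
    0 < flagRatio M S a b c := by
  have hsub {x : ℕ} (hx : x < n) {T : Finset ℕ} (hT : T ⊆ range n) : insert x T ⊆ range n :=
    insert_subset (mem_range.2 hx) hT
  have h {I : Finset ℕ} (hI : I ⊆ range n) := flagMinor_pos hM hI
  exact div_pos (mul_pos (h (hsub ha hS)) (h (hsub hb (hsub hc hS))))
    (mul_pos (h (hsub ha (hsub hb hS))) (h (hsub hc hS)))

/-- The determinant of the block of size `m` with upper left corner `(a, d)`. -/
noncomputable def solidMinor (M : Matrix (Fin n) (Fin n) ℝ) (a d m : ℕ) : ℝ :=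
  det (of fun i j : Fin m => entry M (a + i) (d + j))

lemma flagMinor_eq_solidMinor {M : Matrix (Fin n) (Fin n) ℝ} (hM : M ∈ unipotentUpper n)
    {I : Finset ℕ} {a d m : ℕ} (hI : ∀ x, x ∈ I ↔ (a ≤ x ∧ x < a + m) ∨ (d + m ≤ x ∧ x < n))
    (had : a ≤ d) (h : d + m ≤ n) : flagMinor M I = solidMinor M a d m := by
  rw [solidMinor, ← flagMinor_tail hM (r := fun i => a + i) (fun i j hij _ => by omega)
    (fun i hi => by omega) h]
  congr 1
  ext x
  rw [hI]
  simp only [mem_union, mem_image, mem_range, mem_Ico]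
  constructor
  · rintro (hx | hx)
    · exact Or.inl ⟨x - a, by omega⟩
    · exact Or.inr hx
  · rintro (⟨i, hi, rfl⟩ | hx)
    · left; omega
    · exact Or.inr hx

lemma solidMinor_antiT (M : Matrix (Fin n) (Fin n) ℝ) {a d m a' d' : ℕ} (ha : a + d' + m = n)
    (hd : d + a' + m = n) : solidMinor (antiT M) a d m = solidMinor M a' d' m := by
  refine det_entry_antiT M (fun i => ?_) fun i => ?_
  · have := i.isLt
    simp only [Fin.val_rev]
    omega
  · have := i.isLt
    simp only [Fin.val_rev]
    omega

lemma flagRatio_low_eq {M : Matrix (Fin n) (Fin n) ℝ} (hM : M ∈ unipotentUpper n) {i m d : ℕ}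
    (hid : i < d) (hd : d + m + 1 < n) :
    flagRatio M (Ico (i + 1) (i + m + 1) ∪ Ico (d + m + 1 + 1) n) i (i + m + 1) (d + m + 1)
      = (solidMinor M i (d + 1) (m + 1) * solidMinor M (i + 1) d (m + 1)) /
        (solidMinor M i d (m + 2) * solidMinor M (i + 1) (d + 1) m) := by
  rw [flagRatio]
  congr 2 <;>
  · refine flagMinor_eq_solidMinor hM (fun x => ?_) (by omega) (by omega)
    simp only [mem_insert, mem_union, mem_Ico]
    omega

/-- The minors in `Y_{abc}` have rows consisting of an interval and a tail, hence are solid minors.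
The antitranspose maps solid minors to solid minors of the same size, which preserves the shape of
the ratio and the difference `j - i`. -/
lemma flagRatio_low_antiT {M : Matrix (Fin n) (Fin n) ℝ} (hM : M ∈ unipotentUpper n) {i j k : ℕ}
    (hij : i < j) (hjk : j < k) (hk : k < n) :
    flagRatio (antiT M) (Ico (i + 1) j ∪ Ico (k + 1) n) i j k
      = flagRatio M (Ico (n - 1 - k + 1) (n - 1 - k + (j - i)) ∪ Ico (n - 1 - i + 1) n)
        (n - 1 - k) (n - 1 - k + (j - i)) (n - 1 - i) := by
  obtain ⟨m, rfl⟩ : ∃ m, j = i + m + 1 := ⟨j - i - 1, by omega⟩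
  obtain ⟨d, rfl⟩ : ∃ d, k = d + m + 1 := ⟨k - m - 1, by omega⟩
  have h1 := flagRatio_low_eq (antiT_mem_unipotentUpper hM) (i := i) (m := m) (d := d) (by omega) hk
  have h2 := flagRatio_low_eq hM (i := n - 1 - (d + m + 1)) (m := m) (d := n - 1 - (i + m + 1))
    (by omega) (by omega)
  have e1 : n - 1 - (d + m + 1) + (i + m + 1 - i) = n - 1 - (d + m + 1) + m + 1 := by omega
  have e2 : n - 1 - (i + m + 1) + m + 1 = n - 1 - i := by omega
  rw [e2] at h2
  rw [e1, h1, h2]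
  congr 2 <;> refine solidMinor_antiT M ?_ ?_ <;> omega

/-- The index change of `flagRatio_low_antiT` is an involution of the tetrahedron, so only the order
of the summands changes. -/
lemma lowSum_antiT {M : Matrix (Fin n) (Fin n) ℝ} (hM : M ∈ unipotentUpper n) :
    lowSum (antiT M) = lowSum M := by
  simp only [lowSum, sum_sigma']
  refine sum_nbij' (fun x => ⟨n - 1 - x.2.2, n - 1 - x.1 + (x.2.1 - x.2.2), n - 1 - x.1⟩)
    (fun x => ⟨n - 1 - x.2.2, n - 1 - x.1 + (x.2.1 - x.2.2), n - 1 - x.1⟩)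
    ?_ ?_ ?_ ?_ ?_
  · rintro ⟨k, j, i⟩ h
    simp only [mem_sigma, mem_range] at h ⊢
    omega
  · rintro ⟨k, j, i⟩ h
    simp only [mem_sigma, mem_range] at h ⊢
    omega
  · rintro ⟨k, j, i⟩ h
    simp only [mem_sigma, mem_range] at h
    simp only [Sigma.mk.injEq, heq_eq_eq]
    omega
  · rintro ⟨k, j, i⟩ h
    simp only [mem_sigma, mem_range] at h
    simp only [Sigma.mk.injEq, heq_eq_eq]
    omega
  · rintro ⟨k, j, i⟩ h
    simp only [mem_sigma, mem_range] at h
    simp only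
    rw [flagRatio_low_antiT hM h.2.2 h.2.1 h.1]

/-- Sums over the tetrahedron as iterated sums. -/
lemma sum_tetra (F : ℕ → ℕ → ℕ → ℝ) : ∑ t ∈ tetra n, F t.1 t.2.1 t.2.2
    = ∑ k ∈ range n, ∑ j ∈ range k, ∑ i ∈ range j, F (i + 1) (j + 1) (k + 1) := by
  simp only [sum_sigma']
  refine sum_nbij' (fun x => ⟨x.2.2 - 1, x.2.1 - 1, x.1 - 1⟩)
    (fun x => (x.2.2 + 1, x.2.1 + 1, x.1 + 1)) ?_ ?_ ?_ ?_ ?_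
  · rintro ⟨a, b, c⟩ h
    simp only [tetra, mem_filter, mem_product, mem_Icc] at h
    simp only [mem_sigma, mem_range]
    omega
  · rintro ⟨k, j, i⟩ h
    simp only [mem_sigma, mem_range] at h
    simp only [tetra, mem_filter, mem_product, mem_Icc]
    omega
  · rintro ⟨a, b, c⟩ h
    simp only [tetra, mem_filter, mem_product, mem_Icc] at h
    simp only [Prod.mk.injEq]
    omega
  · rintro ⟨k, j, i⟩ _
    rfl
  · rintro ⟨a, b, c⟩ h
    simp only [tetra, mem_filter, mem_product, mem_Icc] at h
    have e1 : a - 1 + 1 = a := by omega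
    have e2 : b - 1 + 1 = b := by omega
    have e3 : c - 1 + 1 = c := by omega
    simp only [e1, e2, e3]

lemma sum_tetra_reverse (F : ℕ → ℕ → ℕ → ℝ) : ∑ t ∈ tetra n, F t.1 t.2.1 t.2.2
    = ∑ k ∈ range n, ∑ j ∈ range k, ∑ i ∈ range j, F (n - k) (n - j) (n - i) := by
  rw [sum_tetra, ← sum_tetra_reflect]
  refine sum_congr rfl fun k hk => sum_congr rfl fun j hj => sum_congr rfl fun i hi => ?_
  have hi := mem_range.1 hi
  have hj := mem_range.1 hj
  have hk := mem_range.1 hk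
  congr 1 <;> omega

/-! ### The triangular factorization -/

/-- Lower times diagonal times upper triangular factorization. -/
lemma exists_ldu {n : ℕ} (X : Matrix (Fin n) (Fin n) ℝ)
    (h : ∀ k (hk : k ≤ n), det (X.submatrix (Fin.castLE hk) (Fin.castLE hk)) ≠ 0) :
    ∃ (L U : Matrix (Fin n) (Fin n) ℝ) (d : Fin n → ℝ),
      (∀ i, L i i = 1) ∧ (∀ i j, i < j → L i j = 0) ∧ U ∈ unipotentUpper n ∧
        X = L * diagonal d * U := by
  induction n with
  | zero =>
    exact ⟨1, 1, 0, fun i => i.elim0, fun i => i.elim0, ⟨fun i => i.elim0, fun i => i.elim0⟩,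
      by ext i; exact i.elim0⟩
  | succ n ih =>
    obtain ⟨L, U, d, hL1, hL0, hU, hX⟩ := ih (X.submatrix Fin.castSucc Fin.castSucc)
      fun k hk => h k (hk.trans n.le_succ)
    have hdet : det (X.submatrix Fin.castSucc Fin.castSucc) ≠ 0 := h n n.le_succ
    set T := L * diagonal d with hT
    set R := diagonal d * U with hR
    have hTR : T * U = L * R := by rw [hT, hR, Matrix.mul_assoc]
    have hTdet : IsUnit T.det := by
      rw [hX, det_mul] at hdet
      exact (left_ne_zero_of_mul hdet).isUnit
    have hRdet : IsUnit R.det := by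
      rw [hX, hTR, det_mul] at hdet
      exact (right_ne_zero_of_mul hdet).isUnit
    -- Bordering: `u` and `w` solve the block equations for the last column and the last row, and
    -- the new pivot is the Schur complement.
    set u := T⁻¹ *ᵥ fun i => X i.castSucc (Fin.last n) with hu
    set w := (fun j => X (Fin.last n) j.castSucc) ᵥ* R⁻¹ with hw
    have hTu : T *ᵥ u = fun i => X i.castSucc (Fin.last n) := by
      rw [hu, mulVec_mulVec, mul_nonsing_inv _ hTdet, one_mulVec]
    have hwR : w ᵥ* R = fun j => X (Fin.last n) j.castSucc := by
      rw [hw, vecMul_vecMul, nonsing_inv_mul _ hRdet, vecMul_one]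
    refine ⟨of (Fin.snoc (fun i => Fin.snoc (L i) 0) (Fin.snoc w 1)),
      of (Fin.snoc (fun i => Fin.snoc (U i) (u i)) (Fin.snoc 0 1)),
      Fin.snoc d (X (Fin.last n) (Fin.last n) - ∑ l, w l * d l * u l), ?_, ?_, ⟨?_, ?_⟩, ?_⟩
    · intro i
      refine Fin.lastCases ?_ (fun i => ?_) i <;> simp [hL1]
    · intro i j hij
      induction j using Fin.lastCases with
      | last =>
        induction i using Fin.lastCases with
        | last => exact absurd hij (lt_irrefl _)
        | cast i => simp
      | cast j =>
        induction i using Fin.lastCases with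
        | last => exact absurd hij (not_lt.2 (Fin.le_last _))
        | cast i => simpa using hL0 i j hij
    · intro i
      refine Fin.lastCases ?_ (fun i => ?_) i <;> simp [hU.1]
    · intro i j hij
      induction i using Fin.lastCases with
      | last =>
        induction j using Fin.lastCases with
        | last => exact absurd hij (lt_irrefl _)
        | cast j => simp
      | cast i =>
        induction j using Fin.lastCases with
        | last => exact absurd hij (not_lt.2 (Fin.le_last _))
        | cast j => simpa using hU.2 i j hij
    · ext i j
      simp only [mul_apply (M := _ * diagonal _), mul_diagonal, Fin.sum_univ_castSucc, of_apply,
        Fin.snoc_castSucc, Fin.snoc_last]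
      induction i using Fin.lastCases with
      | last =>
        induction j using Fin.lastCases with
        | last => simp
        | cast j =>
          have := congrFun hwR j
          simp only [vecMul, dotProduct, hR, diagonal_mul] at this
          simp only [Fin.snoc_castSucc, Fin.snoc_last, ← this]
          simp [mul_assoc]
      | cast i =>
        induction j using Fin.lastCases with
        | last =>
          have := congrFun hTu i
          simp only [mulVec, dotProduct, hT, mul_diagonal] at this
          simp only [Fin.snoc_castSucc, Fin.snoc_last, ← this]
          simp
        | cast j =>
          have := congrFun (congrFun hX i) j
          rw [hT, mul_apply] at this
          simp only [mul_diagonal, submatrix_apply] at this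
          simp [this]

/-! ### The factorization `P M P = A P D B`: flag minors of the factors, uniqueness and existence -/

lemma revMatrix_apply (i j : Fin n) : revMatrix n i j = if j = i.rev then 1 else 0 := by
  rw [revMatrix, of_apply]
  congr 1
  rw [eq_iff_iff, Fin.ext_iff, Fin.val_rev]
  have := i.isLt
  have := j.isLt
  omega

lemma revMatrix_mul (M : Matrix (Fin n) (Fin n) ℝ) (i j : Fin n) :
    (revMatrix n * M) i j = M i.rev j := by
  simp [mul_apply, revMatrix_apply]

lemma mul_revMatrix (M : Matrix (Fin n) (Fin n) ℝ) (i j : Fin n) :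
    (M * revMatrix n) i j = M i j.rev := by
  have (l : Fin n) : (j = l.rev) = (l = j.rev) := by
    rw [eq_iff_iff]
    exact ⟨fun h => by rw [h, Fin.rev_rev], fun h => by rw [h, Fin.rev_rev]⟩
  simp [mul_apply, revMatrix_apply, this]

lemma revMatrix_mul_revMatrix : revMatrix n * revMatrix n = 1 := by
  ext i j
  rw [revMatrix_mul, revMatrix_apply, Fin.rev_rev, one_apply]
  simp only [eq_comm]

lemma revMatrix_mul_mul_revMatrix (M : Matrix (Fin n) (Fin n) ℝ) :
    revMatrix n * M * revMatrix n = of fun i j => M i.rev j.rev := by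
  ext i j
  rw [mul_revMatrix, revMatrix_mul, of_apply]

/-- The factorization `P M P = A P D B` with unipotent factors. -/
def GaussEq (M A B : Matrix (Fin n) (Fin n) ℝ) (d : Fin n → ℝ) : Prop :=
  A ∈ unipotentUpper n ∧ B ∈ unipotentUpper n ∧
    revMatrix n * M * revMatrix n = A * revMatrix n * Matrix.diagonal d * B

/-- Cancelling `P` on the right leaves `P M = A X` with `X = P D B P`, which is lower triangular
when `B` is upper triangular. -/
lemma gaussEq_iff {M A B : Matrix (Fin n) (Fin n) ℝ} {d : Fin n → ℝ} :
    revMatrix n * M * revMatrix n = A * revMatrix n * Matrix.diagonal d * B ↔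
      ∀ i j, M i.rev j = ∑ l, A i l * (d l.rev * B l.rev j.rev) := by
  have key (i j : Fin n) : (A * revMatrix n * Matrix.diagonal d * B) i j
      = ∑ l, A i l * (d l.rev * B l.rev j) := by
    rw [mul_apply, ← Equiv.sum_comp Fin.revPerm]
    refine sum_congr rfl fun l _ => ?_
    rw [Fin.revPerm_apply, mul_diagonal, mul_revMatrix, Fin.rev_rev, mul_assoc]
  rw [revMatrix_mul_mul_revMatrix]
  constructor
  · intro h i j
    rw [← key, ← h, of_apply, Fin.rev_rev]
  · intro h
    ext i j
    rw [key, of_apply, h, Fin.rev_rev]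

/-- The two unipotent factors change places, so every statement about `B` follows from the one about
`A`. -/
lemma GaussEq.antiT {M A B : Matrix (Fin n) (Fin n) ℝ} {d : Fin n → ℝ} (h : GaussEq M A B d) :
    GaussEq (antiT M) (antiT B) (antiT A) d := by
  refine ⟨antiT_mem_unipotentUpper h.2.1, antiT_mem_unipotentUpper h.1, gaussEq_iff.2 fun i j => ?_⟩
  simp only [TPDilog.antiT, of_apply, Fin.rev_rev]
  rw [gaussEq_iff.1 h.2.2 j i]
  refine sum_congr rfl fun l _ => ?_
  ring

/-- Because `P D B P` is lower triangular, the last `k` columns of `P M` involve only the last `k`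
columns of `A`, multiplied by one `k × k` block. -/
lemma reflect_sum_entry {M A B : Matrix (Fin n) (Fin n) ℝ} {d : Fin n → ℝ} (h : GaussEq M A B d)
    {k : ℕ} (hk : k ≤ n) : ∃ X : Fin k → Fin k → ℝ, ∀ a < n, ∀ j : Fin k,
      entry M (n - 1 - a) (n - k + j) = ∑ l : Fin k, entry A a (n - k + l) * X l j := by
  set X : Matrix (Fin n) (Fin n) ℝ := of fun l j => d l.rev * B l.rev j.rev with hX
  refine ⟨fun l j => entry X (n - k + l) (n - k + j), fun a ha j => ?_⟩
  have hj : n - k + (j : ℕ) < n := by have := j.isLt; omega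
  have h1 : entry M (n - 1 - a) (n - k + j) = ∑ l ∈ range n, entry A a l * entry X l (n - k + j) := by
    rw [← Fin.sum_univ_eq_sum_range fun l => entry A a l * entry X l (n - k + j)]
    have := gaussEq_iff.1 h.2.2 ⟨a, ha⟩ ⟨n - k + j, hj⟩
    have e1 : entry M (n - 1 - a) (n - k + j) = M (Fin.rev ⟨a, ha⟩) ⟨n - k + j, hj⟩ := by
      rw [entry, dif_pos ⟨by omega, hj⟩]
      congr 1
      ext
      simp only [Fin.val_rev]
      omega
    rw [e1, this]
    refine sum_congr rfl fun l _ => ?_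
    rw [entry, dif_pos ⟨ha, l.isLt⟩, entry, dif_pos ⟨l.isLt, hj⟩, hX, of_apply]
  rw [h1, Fin.sum_univ_eq_sum_range fun l => entry A a (n - k + l)
    * entry X (n - k + l) (n - k + j)]
  have hn : n = n - k + k := by omega
  rw [show range n = range (n - k + k) by rw [← hn], sum_range_add, sum_eq_zero, zero_add]
  intro l hl
  have hl := mem_range.1 hl
  have hXl : entry X l (n - k + j) = 0 := by
    rw [entry, dif_pos ⟨by omega, hj⟩, hX, of_apply, h.2.1.2, mul_zero]
    rw [Fin.rev_lt_rev, Fin.lt_def]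
    simp only
    omega
  rw [hXl, mul_zero]

/-- The reflection of a set of labels. -/
def reflectSet (n : ℕ) (I : Finset ℕ) : Finset ℕ := I.image fun x => n - 1 - x

lemma mem_reflectSet {I : Finset ℕ} (hI : I ⊆ range n) {x : ℕ} :
    x ∈ reflectSet n I ↔ x < n ∧ n - 1 - x ∈ I := by
  rw [reflectSet, mem_image]
  constructor
  · rintro ⟨y, hy, rfl⟩
    have := mem_range.1 (hI hy)
    have e : n - 1 - (n - 1 - y) = y := by omega
    exact ⟨by omega, by rwa [e]⟩
  · rintro ⟨hx, hy⟩
    exact ⟨_, hy, by omega⟩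

lemma flagMinor_reflectSet_image (M : Matrix (Fin n) (Fin n) ℝ) {k : ℕ} {f : Fin k → ℕ}
    (hf : StrictMono f) (hn : ∀ i, f i < n) :
    flagMinor M (reflectSet n (univ.image f)) = ((Equiv.Perm.sign (@Fin.revPerm k) : ℤ) : ℝ)
      * det (of fun i j => entry M (n - 1 - f i) (n - k + j)) := by
  have hg : StrictMono fun i : Fin k => n - 1 - f i.rev := fun i j hij => by
    have := hf (Fin.rev_lt_rev.2 hij)
    have := hn i.rev
    simp only
    omega
  have himg : reflectSet n (univ.image f) = univ.image fun i : Fin k => n - 1 - f i.rev := by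
    rw [reflectSet, image_image]
    ext x
    simp only [mem_image, mem_univ, true_and, Function.comp_apply]
    constructor
    · rintro ⟨i, rfl⟩
      exact ⟨i.rev, by rw [Fin.rev_rev]⟩
    · rintro ⟨i, rfl⟩
      exact ⟨i.rev, rfl⟩
  rw [himg, flagMinor_image _ hg, ← det_permute]
  rfl

/-- The flag minors of the first factor. -/
lemma GaussEq.flagMinor_mul {M A B : Matrix (Fin n) (Fin n) ℝ} {d : Fin n → ℝ}
    (h : GaussEq M A B d) {I : Finset ℕ} (hI : I ⊆ range n) :
    flagMinor A I * flagMinor M (Ico 0 #I) = flagMinor M (reflectSet n I) := by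
  obtain ⟨s, hs, hsI⟩ := exists_strictMono_image I
  have hlt : ∀ i, s i < n := fun i => mem_range.1 (hI (hsI ▸ mem_image_of_mem s (mem_univ i)))
  have hk := card_le_of_strictMono hs hlt
  generalize #I = k at s hs hsI hlt hk
  subst hsI
  obtain ⟨X, hX⟩ := reflect_sum_entry h hk
  have key {f : Fin k → ℕ} (hf : StrictMono f) (hn : ∀ i, f i < n) :
      -- For fixed `k` the factor between the two minors is the same for all rows. It is found from
      -- the last `k` rows, whose minor in `A` is `1` and whose reflection is `Ico 0 k`.
      flagMinor M (reflectSet n (univ.image f)) = ((Equiv.Perm.sign (@Fin.revPerm k) : ℤ) : ℝ)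
        * (flagMinor A (univ.image f) * det (of X)) := by
    rw [flagMinor_reflectSet_image M hf hn, flagMinor_image _ hf, ← det_mul]
    congr 2
    ext i j
    rw [of_apply, hX _ (hn i), mul_apply]
    rfl
  have h0 : StrictMono fun i : Fin k => n - k + (i : ℕ) := fun i j hij => by
    have hij : (i : ℕ) < j := hij
    simp only
    omega
  have hn0 (i : Fin k) : n - k + (i : ℕ) < n := by have := i.isLt; omega
  have img0 : univ.image (fun i : Fin k => n - k + (i : ℕ)) = Ico (n - k) n := by
    ext x
    simp only [mem_image, mem_univ, true_and, mem_Ico]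
    constructor
    · rintro ⟨i, rfl⟩
      exact ⟨by omega, hn0 i⟩
    · rintro ⟨h1, h2⟩
      exact ⟨⟨x - (n - k), by omega⟩, by simp only; omega⟩
  have k0 := key h0 hn0
  have k1 := key hs hlt
  have hr : reflectSet n (Ico (n - k) n) = Ico 0 k := by
    ext x
    rw [mem_reflectSet (fun x hx => mem_range.2 (mem_Ico.1 hx).2)]
    simp only [mem_Ico]
    omega
  rw [img0, hr, flagMinor_Ico h.1, one_mul] at k0
  rw [k1, k0]
  ring

lemma GaussEq.flagMinor_eq {M A B : Matrix (Fin n) (Fin n) ℝ} {d : Fin n → ℝ}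
    (h : GaussEq M A B d) (hM : M ∈ totallyPositive n) {I : Finset ℕ} (hI : I ⊆ range n) :
    flagMinor A I = flagMinor M (reflectSet n I) / flagMinor M (Ico 0 #I) := by
  have hk : #I ≤ n := by simpa using card_le_card hI
  have hpos : 0 < flagMinor M (Ico 0 #I) :=
    flagMinor_pos hM fun x hx => mem_range.2 ((mem_Ico.1 hx).2.trans_le hk)
  rw [eq_div_iff hpos.ne', h.flagMinor_mul hI]

lemma GaussEq.left_mem {M A B : Matrix (Fin n) (Fin n) ℝ} {d : Fin n → ℝ}
    (h : GaussEq M A B d) (hM : M ∈ totallyPositive n) : A ∈ totallyPositive n := by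
  refine mem_totallyPositive_of_flagMinor_pos h.1 fun I hI => ?_
  have hk : #I ≤ n := by simpa using card_le_card hI
  rw [h.flagMinor_eq hM hI]
  exact div_pos (flagMinor_pos hM fun x hx => mem_range.2 ((mem_reflectSet hI).1 hx).1)
    (flagMinor_pos hM fun x hx => mem_range.2 ((mem_Ico.1 hx).2.trans_le hk))

lemma GaussEq.right_mem {M A B : Matrix (Fin n) (Fin n) ℝ} {d : Fin n → ℝ}
    (h : GaussEq M A B d) (hM : M ∈ totallyPositive n) : B ∈ totallyPositive n := by
  rw [← antiT_antiT B]
  exact antiT_mem (h.antiT.left_mem (antiT_mem hM))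

lemma eq_of_flagMinor_eq {A A' : Matrix (Fin n) (Fin n) ℝ} (hA : A ∈ unipotentUpper n)
    (hA' : A' ∈ unipotentUpper n) (h : ∀ I ⊆ range n, flagMinor A I = flagMinor A' I) :
    A = A' := by
  ext i j
  rcases lt_or_ge j i with hij | hij
  · rw [hA.2 _ _ hij, hA'.2 _ _ hij]
  · have hij : (i : ℕ) ≤ j := hij
    -- Every entry on or above the diagonal is itself a flag minor: row `i` together with the tail
    -- of rows after `j`.
    have e {C : Matrix (Fin n) (Fin n) ℝ} (hC : C ∈ unipotentUpper n) :
        flagMinor C ((range 1).image (fun _ => (i : ℕ)) ∪ Ico ((j : ℕ) + 1) n) = C i j := by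
      rw [flagMinor_tail hC (by omega) (fun _ _ => by omega) (by omega)]
      simp
    rw [← e hA, ← e hA']
    refine h _ fun x hx => mem_range.2 ?_
    rcases mem_union.1 hx with hx | hx
    · obtain ⟨y, -, rfl⟩ := mem_image.1 hx
      exact i.isLt
    · exact (mem_Ico.1 hx).2

lemma GaussEq.left_unique {M A B A' B' : Matrix (Fin n) (Fin n) ℝ} {d d' : Fin n → ℝ}
    (h : GaussEq M A B d) (h' : GaussEq M A' B' d') (hM : M ∈ totallyPositive n) : A = A' :=
  eq_of_flagMinor_eq h.1 h'.1 fun I hI => by rw [h.flagMinor_eq hM hI, h'.flagMinor_eq hM hI]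

lemma isUnit_of_mem_unipotentUpper {A : Matrix (Fin n) (Fin n) ℝ} (hA : A ∈ unipotentUpper n) :
    IsUnit A := by
  rw [isUnit_iff_isUnit_det, det_of_isUpperTriangular (fun i j hij => hA.2 i j hij),
    prod_eq_one fun i _ => hA.1 i]
  exact isUnit_one

lemma GaussEq.unique {M A B A' B' : Matrix (Fin n) (Fin n) ℝ} {d d' : Fin n → ℝ}
    (h : GaussEq M A B d) (h' : GaussEq M A' B' d') (hM : M ∈ totallyPositive n) :
    A = A' ∧ B = B' ∧ d = d' := by
  have hA := h.left_unique h' hM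
  have hB : B = B' := by
    rw [← antiT_antiT B, ← antiT_antiT B', h.antiT.left_unique h'.antiT (antiT_mem hM)]
  refine ⟨hA, hB, ?_⟩
  subst hA hB
  have e := h.2.2.symm.trans h'.2.2
  have e1 := (isUnit_of_mem_unipotentUpper h.2.1).mul_right_cancel e
  rw [Matrix.mul_assoc, Matrix.mul_assoc] at e1
  have e2 := (isUnit_of_mem_unipotentUpper h.1).mul_left_cancel e1
  have e3 := congrArg (fun X => revMatrix n * X) e2
  simp only [← Matrix.mul_assoc, revMatrix_mul_revMatrix, Matrix.one_mul] at e3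
  exact diagonal_injective e3

/-- Up to sign, the leading minors of `M P` are the flag minors of the first rows of `M`, hence
nonzero. From `M P = L D U` follows `P M P = (P L P) P D U`, where `P L P` is upper unitriangular.
-/
lemma exists_gaussEq {M : Matrix (Fin n) (Fin n) ℝ} (hM : M ∈ totallyPositive n) :
    ∃ A B d, GaussEq M A B d := by
  obtain ⟨L, U, d, hL1, hL0, hU, hX⟩ := exists_ldu (M * revMatrix n) fun k hk => by
    have h0 : StrictMono fun i : Fin k => (i : ℕ) := fun i j hij => hij
    have himg : univ.image (fun i : Fin k => (i : ℕ)) = Ico 0 k := by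
      ext x
      simp only [mem_image, mem_univ, true_and, mem_Ico]
      exact ⟨fun ⟨i, hi⟩ => hi ▸ ⟨Nat.zero_le _, i.isLt⟩, fun h => ⟨⟨x, h.2⟩, rfl⟩⟩
    have hpos : 0 < flagMinor M (univ.image fun i : Fin k => (i : ℕ)) := by
      rw [himg]
      exact flagMinor_pos hM fun x hx => mem_range.2 ((mem_Ico.1 hx).2.trans_le hk)
    rw [flagMinor_image _ h0] at hpos
    have e : (M * revMatrix n).submatrix (Fin.castLE hk) (Fin.castLE hk)
        = (of fun i j : Fin k => entry M i (n - k + j)).submatrix id Fin.revPerm := by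
      ext i j
      have hi := i.isLt
      have hj := j.isLt
      rw [submatrix_apply, mul_revMatrix, submatrix_apply, of_apply, entry, dif_pos (by
        simp only [id, Fin.revPerm_apply, Fin.val_rev]; omega)]
      congr 1
      ext
      simp only [Fin.val_rev, Fin.val_castLE, Fin.revPerm_apply]
      omega
    rw [e, det_permute']
    refine mul_ne_zero ?_ hpos.ne'
    exact_mod_cast (Equiv.Perm.sign (@Fin.revPerm k)).ne_zero
  refine ⟨revMatrix n * L * revMatrix n, U, d, ⟨fun i => ?_, fun i j hij => ?_⟩, hU, ?_⟩
  · rw [revMatrix_mul_mul_revMatrix, of_apply, hL1]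
  · rw [revMatrix_mul_mul_revMatrix, of_apply, hL0 _ _ (Fin.rev_lt_rev.2 hij)]
  · rw [Matrix.mul_assoc, hX, Matrix.mul_assoc _ (revMatrix n) (revMatrix n),
      revMatrix_mul_revMatrix, Matrix.mul_one]
    simp only [Matrix.mul_assoc]

theorem existsUnique_isGauss {M : Matrix (Fin n) (Fin n) ℝ} (hM : M ∈ totallyPositive n) :
    ∃! q : Matrix (Fin n) (Fin n) ℝ × Matrix (Fin n) (Fin n) ℝ × (Fin n → ℝ),
      IsGauss M q.1 q.2.1 q.2.2 := by
  obtain ⟨A, B, d, h⟩ := exists_gaussEq hM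
  refine ⟨(A, B, d), ⟨h.left_mem hM, h.right_mem hM, h.2.2⟩, ?_⟩
  rintro ⟨A', B', d'⟩ ⟨hA', hB', he⟩
  obtain ⟨rfl, rfl, rfl⟩ := h.unique ⟨hA'.1, hB'.1, he⟩ hM
  rfl

lemma isGauss_prime {M : Matrix (Fin n) (Fin n) ℝ} (hM : M ∈ totallyPositive n) :
    IsGauss M (prime M) (dprime M) (gaussTriple M).2.2 :=
  Classical.epsilon_spec (existsUnique_isGauss hM).exists

lemma gaussEq_prime {M : Matrix (Fin n) (Fin n) ℝ} (hM : M ∈ totallyPositive n) :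
    GaussEq M (prime M) (dprime M) (gaussTriple M).2.2 :=
  ⟨(isGauss_prime hM).1.1, (isGauss_prime hM).2.1.1, (isGauss_prime hM).2.2⟩

/-! ### The dilogarithm sums of the factors -/

lemma reflectSet_insert (x : ℕ) (I : Finset ℕ) :
    reflectSet n (insert x I) = insert (n - 1 - x) (reflectSet n I) := image_insert _ _ _

/-- The size-dependent denominators cancel in the cross ratio. Reflection reverses the order of `a`,
`b`, `c` and thereby exchanges numerator and denominator. -/
lemma GaussEq.flagRatio_eq {M A B : Matrix (Fin n) (Fin n) ℝ} {d : Fin n → ℝ}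
    (h : GaussEq M A B d) (hM : M ∈ totallyPositive n) {S : Finset ℕ} (hS : S ⊆ range n)
    {a b c : ℕ} (ha : a ∉ S) (hb : b ∉ S) (hc : c ∉ S) (hab : a < b) (hbc : b < c) (hcn : c < n) :
    flagRatio A S a b c
      = (flagRatio M (reflectSet n S) (n - 1 - c) (n - 1 - b) (n - 1 - a))⁻¹ := by
  have hbn : b < n := hbc.trans hcn
  have han : a < n := hab.trans hbn
  have hsub {x : ℕ} (hx : x < n) {T : Finset ℕ} (hT : T ⊆ range n) : insert x T ⊆ range n :=
    insert_subset (mem_range.2 hx) hT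
  have h1 {x : ℕ} (hx : x ∉ S) (hxn : x < n) : flagMinor A (insert x S)
      = flagMinor M (insert (n - 1 - x) (reflectSet n S)) / flagMinor M (Ico 0 (#S + 1)) := by
    rw [h.flagMinor_eq hM (hsub hxn hS), card_insert_of_notMem hx, reflectSet_insert]
  have h2 {x y : ℕ} (hx : x ∉ S) (hy : y ∉ S) (hxy : x < y) (hyn : y < n) :
      flagMinor A (insert x (insert y S))
      = flagMinor M (insert (n - 1 - y) (insert (n - 1 - x) (reflectSet n S)))
        / flagMinor M (Ico 0 (#S + 2)) := by
    rw [h.flagMinor_eq hM (hsub (hxy.trans hyn) (hsub hyn hS)),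
      card_insert_of_notMem (by simp [hx, hxy.ne]), card_insert_of_notMem hy, reflectSet_insert,
      reflectSet_insert, insert_comm]
  have hcard : #S + 2 ≤ n := by
    have h := card_le_card (hsub han (hsub hbn hS))
    rwa [card_insert_of_notMem (by simp [ha, hab.ne]), card_insert_of_notMem hb, card_range] at h
  have p1 : 0 < flagMinor M (Ico 0 (#S + 1)) :=
    flagMinor_pos hM fun x hx => mem_range.2 ((mem_Ico.1 hx).2.trans_le (by omega))
  have p2 : 0 < flagMinor M (Ico 0 (#S + 2)) :=
    flagMinor_pos hM fun x hx => mem_range.2 ((mem_Ico.1 hx).2.trans_le hcard)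
  rw [flagRatio, flagRatio, h1 ha han, h1 hc hcn, h2 hb hc hbc hcn, h2 ha hb hab hbn, inv_div,
    div_mul_div_comm, div_mul_div_comm, mul_comm (flagMinor M (Ico 0 (#S + 2))),
    div_div_div_cancel_right₀ (mul_pos p1 p2).ne',
    mul_comm (flagMinor M (insert (n - 1 - a) (reflectSet n S))),
    mul_comm (flagMinor M (insert (n - 1 - c) (reflectSet n S)))]

/-- The value of the sum over the tetrahedron when all summands are `2 * ell 1`. -/
noncomputable def reflectionConst (n : ℕ) : ℝ :=
  ∑ k ∈ range n, ∑ j ∈ range k, ∑ _i ∈ range j, 2 * ell 1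

/-- Reflection carries the rows of the `Y` family to those of the `Ỹ` family, with inverted ratios;
`ell_inv` handles the inverses, and `lowSum_eq_tlowSum` returns to the `Y` family. -/
lemma GaussEq.lowSum_left {M A B : Matrix (Fin n) (Fin n) ℝ} {d : Fin n → ℝ}
    (h : GaussEq M A B d) (hM : M ∈ totallyPositive n) :
    lowSum A = reflectionConst n - lowSum M := by
  rw [lowSum_eq_tlowSum hM, tlowSum, ← sum_tetra_reflect, reflectionConst, lowSum,
    ← sum_sub_distrib]
  refine sum_congr rfl fun k hk => ?_
  rw [← sum_sub_distrib]
  refine sum_congr rfl fun j hj => ?_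
  rw [← sum_sub_distrib]
  refine sum_congr rfl fun i hi => ?_
  have hi := mem_range.1 hi
  have hj := mem_range.1 hj
  have hk := mem_range.1 hk
  obtain ⟨e1, e2, e3, e4⟩ := low_rows hi hj hk
  have hr : reflectSet n (Ico (i + 1) j ∪ Ico (k + 1) n)
      = Ico 0 (n - 1 - k) ∪ Ico (n - 1 - j + 1) (n - 1 - i) := by
    ext x
    rw [mem_reflectSet e1]
    simp only [mem_union, mem_Ico]
    omega
  rw [h.flagRatio_eq hM e1 e2 e3 e4 hi hj hk, hr, ell_inv]
  obtain ⟨f1, -⟩ := tlow_rows (i := n - 1 - k) (j := n - 1 - j) (k := n - 1 - i) (n := n)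
    (by omega) (by omega) (by omega)
  exact flagRatio_pos hM f1 (by omega) (by omega) (by omega)

lemma GaussEq.lowSum_right {M A B : Matrix (Fin n) (Fin n) ℝ} {d : Fin n → ℝ}
    (h : GaussEq M A B d) (hM : M ∈ totallyPositive n) :
    lowSum B = reflectionConst n - lowSum M := by
  rw [← lowSum_antiT h.2.1, h.antiT.lowSum_left (antiT_mem hM), lowSum_antiT hM.1]

lemma prime_mem {M : Matrix (Fin n) (Fin n) ℝ} (hM : M ∈ totallyPositive n) :
    prime M ∈ totallyPositive n := (isGauss_prime hM).1

lemma dprime_mem {M : Matrix (Fin n) (Fin n) ℝ} (hM : M ∈ totallyPositive n) :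
    dprime M ∈ totallyPositive n := (isGauss_prime hM).2.1

lemma lowSum_prime {M : Matrix (Fin n) (Fin n) ℝ} (hM : M ∈ totallyPositive n) :
    lowSum (prime M) = reflectionConst n - lowSum M := (gaussEq_prime hM).lowSum_left hM

lemma lowSum_dprime {M : Matrix (Fin n) (Fin n) ℝ} (hM : M ∈ totallyPositive n) :
    lowSum (dprime M) = reflectionConst n - lowSum M := (gaussEq_prime hM).lowSum_right hM

/-- Both signs of the exponent, for a family that enumerates the values of `W`. -/
lemma dilogSum_eq_of_sum {Z W : ℕ → ℕ → ℕ → ℝ} (s : Equiv.Perm (Fin 3))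
    (hsum : ∀ F : ℝ → ℝ, ∑ t ∈ tetra n, F (Z t.1 t.2.1 t.2.2)
      = ∑ k ∈ range n, ∑ j ∈ range k, ∑ i ∈ range j, F (W i j k))
    (hpos : ∀ i j k, i < j → j < k → k < n → 0 < W i j k) :
    dilogSum n s Z = if Equiv.Perm.sign s = 1
      then ∑ k ∈ range n, ∑ j ∈ range k, ∑ i ∈ range j, ell (W i j k)
      else reflectionConst n - ∑ k ∈ range n, ∑ j ∈ range k, ∑ i ∈ range j, ell (W i j k) := by
  split_ifs with hs
  · rw [dilogSum, hs, ← hsum]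
    simp
  · have hs' := (Int.units_eq_one_or (Equiv.Perm.sign s)).resolve_left hs
    rw [dilogSum, hs', reflectionConst, ← sum_sub_distrib]
    have := hsum fun x => ell x⁻¹
    simp only [Units.val_neg, Units.val_one, _root_.zpow_neg_one]
    rw [this]
    refine sum_congr rfl fun k hk => ?_
    rw [← sum_sub_distrib]
    refine sum_congr rfl fun j hj => ?_
    rw [← sum_sub_distrib]
    refine sum_congr rfl fun i hi => ?_
    rw [ell_inv (hpos _ _ _ (mem_range.1 hi) (mem_range.1 hj) (mem_range.1 hk))]

/-- The value of all four dilogarithm sums at `M` with the exponent given by `s`. -/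
noncomputable def signedSum (s : Equiv.Perm (Fin 3)) (M : Matrix (Fin n) (Fin n) ℝ) : ℝ :=
  if Equiv.Perm.sign s = 1 then lowSum M else reflectionConst n - lowSum M

lemma dilogSum_Ylow {M : Matrix (Fin n) (Fin n) ℝ} (hM : M ∈ totallyPositive n)
    (s : Equiv.Perm (Fin 3)) : dilogSum n s (Ylow M) = signedSum s M := by
  rw [signedSum, lowSum, ← dilogSum_eq_of_sum (Z := Ylow M) s]
  · intro F
    rw [sum_tetra fun a b c => F (Ylow M a b c)]
    refine sum_congr rfl fun k hk => sum_congr rfl fun j hj => sum_congr rfl fun i hi => ?_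
    rw [Ylow_eq M (mem_range.1 hi) (mem_range.1 hj) (mem_range.1 hk)]
  · intro i j k hi hj hk
    exact flagRatio_pos hM (low_rows hi hj hk).1 (by omega) (by omega) hk

lemma dilogSum_Ytlow {M : Matrix (Fin n) (Fin n) ℝ} (hM : M ∈ totallyPositive n)
    (s : Equiv.Perm (Fin 3)) : dilogSum n s (Ytlow M) = signedSum s M := by
  rw [signedSum, lowSum_eq_tlowSum hM, tlowSum, ← dilogSum_eq_of_sum (Z := Ytlow M) s]
  · intro F
    rw [sum_tetra fun a b c => F (Ytlow M a b c)]
    refine sum_congr rfl fun k hk => sum_congr rfl fun j hj => sum_congr rfl fun i hi => ?_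
    rw [Ytlow_eq M (mem_range.1 hi) (mem_range.1 hj) (mem_range.1 hk)]
  · intro i j k hi hj hk
    exact flagRatio_pos hM (tlow_rows hi hj hk).1 (by omega) (by omega) hk

lemma dilogSum_Ytup {M : Matrix (Fin n) (Fin n) ℝ} (hM : M ∈ totallyPositive n)
    (s : Equiv.Perm (Fin 3)) : dilogSum n s (Ytup M) = signedSum s M := by
  rw [signedSum, ← lowSum_antiT hM.1, lowSum, ← dilogSum_eq_of_sum (Z := Ytup M) s]
  · intro F
    rw [sum_tetra_reverse fun a b c => F (Ytup M a b c)]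
    refine sum_congr rfl fun k hk => sum_congr rfl fun j hj => sum_congr rfl fun i hi => ?_
    rw [Ytup_eq M (mem_range.1 hi) (mem_range.1 hj) (mem_range.1 hk)]
  · intro i j k hi hj hk
    exact flagRatio_pos (antiT_mem hM) (low_rows hi hj hk).1 (by omega) (by omega) hk

lemma dilogSum_Yup {M : Matrix (Fin n) (Fin n) ℝ} (hM : M ∈ totallyPositive n)
    (s : Equiv.Perm (Fin 3)) : dilogSum n s (Yup M) = signedSum s M := by
  rw [signedSum, ← lowSum_antiT hM.1, lowSum_eq_tlowSum (antiT_mem hM), tlowSum,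
    ← dilogSum_eq_of_sum (Z := Yup M) s]
  · intro F
    rw [sum_tetra_reverse fun a b c => F (Yup M a b c)]
    refine sum_congr rfl fun k hk => sum_congr rfl fun j hj => sum_congr rfl fun i hi => ?_
    rw [Yup_eq M (mem_range.1 hi) (mem_range.1 hj) (mem_range.1 hk)]
  · intro i j k hi hj hk
    exact flagRatio_pos (antiT_mem hM) (tlow_rows hi hj hk).1 (by omega) (by omega) hk

/-- Each letter of a word reflects `lowSum` in the same constant, and an odd sign applies this
reflection once more. Only the parity of the word matters, which is why both words for the longest
element give the same value. -/
lemma signedSum_of_isImage {M N : Matrix (Fin n) (Fin n) ℝ} {s : Equiv.Perm (Fin 3)}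
    (h : IsImage s M N) (hM : M ∈ totallyPositive n) :
    N ∈ totallyPositive n ∧ signedSum s N = lowSum M := by
  have h1 : Equiv.Perm.sign sigma1 = -1 := Equiv.Perm.sign_swap (by decide)
  have h2 : Equiv.Perm.sign sigma2 = -1 := Equiv.Perm.sign_swap (by decide)
  have hp := prime_mem hM
  have hd := dprime_mem hM
  have sp := lowSum_prime hM
  have sd := lowSum_dprime hM
  cases h with
  | id => exact ⟨hM, by simp [signedSum]⟩
  | s1 => exact ⟨hp, by simp [signedSum, h1, sp]⟩
  | s2 => exact ⟨hd, by simp [signedSum, h2, sd]⟩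
  | s21 => exact ⟨dprime_mem hp, by simp [signedSum, h1, h2, lowSum_dprime hp, sp]⟩
  | s12 => exact ⟨prime_mem hd, by simp [signedSum, h1, h2, lowSum_prime hd, sd]⟩
  | s121 =>
    exact ⟨prime_mem (dprime_mem hp), by
      simp [signedSum, h1, h2, lowSum_prime (dprime_mem hp), lowSum_dprime hp, sp]⟩
  | s212 =>
    exact ⟨dprime_mem (prime_mem hd), by
      simp [signedSum, h1, h2, lowSum_dprime (prime_mem hd), lowSum_prime hd, sd]⟩

end TPDilog

theorem theorem3p8 (n : ℕ) (hn : 2 ≤ n) :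
    -- the maps `M ↦ M'`, `M ↦ M''` are well defined on `N_n^+`
    (∀ M ∈ TPDilog.totallyPositive n,
      ∃! q : Matrix (Fin n) (Fin n) ℝ × Matrix (Fin n) (Fin n) ℝ × (Fin n → ℝ),
        TPDilog.IsGauss M q.1 q.2.1 q.2.2) ∧
    -- the dilogarithm identities
    ∀ M ∈ TPDilog.totallyPositive n,
      ∀ (s₁ s₂ s₃ s₄ : Equiv.Perm (Fin 3)) (M₁ M₂ M₃ M₄ : Matrix (Fin n) (Fin n) ℝ),
        TPDilog.IsImage s₁ M M₁ → TPDilog.IsImage s₂ M M₂ →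
        TPDilog.IsImage s₃ M M₃ → TPDilog.IsImage s₄ M M₄ →
          TPDilog.dilogSum n s₁ (TPDilog.Ylow M₁) = TPDilog.dilogSum n s₂ (TPDilog.Ytup M₂) ∧
          TPDilog.dilogSum n s₂ (TPDilog.Ytup M₂) = TPDilog.dilogSum n s₃ (TPDilog.Ytlow M₃) ∧
          TPDilog.dilogSum n s₃ (TPDilog.Ytlow M₃) = TPDilog.dilogSum n s₄ (TPDilog.Yup M₄) := by
  refine ⟨fun M hM => TPDilog.existsUnique_isGauss hM,
    fun M hM s₁ s₂ s₃ s₄ M₁ M₂ M₃ M₄ h₁ h₂ h₃ h₄ => ?_⟩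
  obtain ⟨m₁, e₁⟩ := TPDilog.signedSum_of_isImage h₁ hM
  obtain ⟨m₂, e₂⟩ := TPDilog.signedSum_of_isImage h₂ hM
  obtain ⟨m₃, e₃⟩ := TPDilog.signedSum_of_isImage h₃ hM
  obtain ⟨m₄, e₄⟩ := TPDilog.signedSum_of_isImage h₄ hM
  rw [TPDilog.dilogSum_Ylow m₁, TPDilog.dilogSum_Ytup m₂, TPDilog.dilogSum_Ytlow m₃,
    TPDilog.dilogSum_Yup m₄, e₁, e₂, e₃, e₄]
  exact ⟨rfl, rfl, rfl⟩
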